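/- **Setting.** Let $D$ be a probability distribution on $\mathcal X\times[n]$, $n\ge 1$, with class priors $\pi_y=\mathbf P(Y=y)>0$ for all $y$, $\pi_{\min}=\min_y\pi_y$, and conditional class probabilities $\eta_y(x)=\mathbf P(Y=y\mid X=x)$. A (randomized) classifier is a measurable map $h:\mathcal X\to\Delta_n$ into the probability simplex; for a distribution $E$ on $\mathcal X\times[n]$ its confusion matrix is $\mathrm{conf}(h,E)_{i,j}=\mathbf E_{(X,Y)\sim E}[h_j(X)\mathbf 1(Y=i)]$, and $\mathcal C_D=\{\mathrm{conf}(h,D): h\text{ a classifier}\}$. For a function $\psi$ of the confusion matrix, $\mathrm{regret}^\psi_D[h]=\sup_{g}\psi(\mathrm{conf}(g,D))-\psi(\mathrm{conf}(h,D))$, the supremum being over all classifiers $g$. **Metrics.** Write $s_y=\sum_{\hat y}C_{y,\hat y}$. The metrics $\psi$ and their smoothed versions $\psi_\rho$, $\rho\in(0,1)$, are * H-mean: $\psi(C)=n\big(\sum_y \frac{s_y}{C_{y,y}}\big)^{-1}$ ($=0$ if some $C_{y,y}=0$), $\ \psi_\rho(C)=n\big(\sum_y\frac{s_y+\rho}{C_{y,y}+\rho}\big)^{-1}$;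 * Q-mean: $\psi(C)=1-\sqrt{\frac1n\sum_y\big(1-\frac{C_{y,y}}{s_y}\big)^2}$, $\ \psi_\rho(C)=1-\sqrt{\frac1n\sum_y\Big(\frac{\sum_{\hat y\neq y}C_{y,\hat y}+\rho}{s_y+\rho}\Big)^2}$; * G-mean: $\psi(C)=\big(\prod_y\frac{C_{y,y}}{s_y}\big)^{1/n}$, $\ \psi_\rho(C)=\big(\prod_y\frac{C_{y,y}+\rho}{s_y+\rho}\big)^{1/n}$. **Algorithm (BayesCG run on $\psi_\rho$).** Parameters $\alpha\in(0,1)$ and an integer $\kappa\ge1$. Given an i.i.d. sample $S\sim D^m$, split it into $S'$ (the first $\lfloor(1-\alpha)m\rfloor$ points) and $S''$ (the remaining $\lceil\alpha m\rceil$ points), with empirical distribution $D_{S''}$. Learn $\widehat\eta_{S'}:\mathcal X\to\Delta_n$ from $S'$ by a class probability estimation (CPE) procedure and choose an initial classifier $\widehat h^0$ (possibly depending on $S$). For $j=1,\dots,\kappa m$ set $\widehat G^j=\nabla\psi_\rho(\mathrm{conf}(\widehat h^{j-1},D_{S''}))$; let $\widehat u^j(x)$ be the vertex of $\Delta_n$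 at the largest $y$ maximizing $\sum_k\widehat G^j_{k,y}\,\widehat\eta_{S',k}(x)$; and set $\widehat h^j=\big(1-\tfrac2{j+1}\big)\widehat h^{j-1}+\tfrac2{j+1}\widehat u^j$. The output is $\widehat h^{\mathrm{FW},\rho}_S=\widehat h^{\kappa m}$. (The CPE procedure and the choice of $\widehat h^0$ are jointly measurable in the sample and the instance.) **Corollary (Consistency of BayesCG for H-mean, Q-mean and G-mean).** For each of the three metrics $\psi$: 1. For every $\rho\in(0,1)$, $\psi_\rho$ is concave over $\mathcal C_D$, satisfies $\sup_{C\in\mathcal C_D}|\psi(C)-\psi_\rho(C)|\le\theta(\rho)$, and over $[0,1]^{n\times n}$ it is $L_\rho$-Lipschitz with respect to the $\ell_1$ norm (entrywise) and $\beta_\rho$-smooth, i.e. it has a gradient with $\|\nabla\psi_\rho(M)-\nabla\psi_\rho(N)\|_\infty\le\beta_\rho\|M-N\|_1$, where | metric | $\theta(\rho)$ | $L_\rho$ | $\beta_\rho$ | |---|---|---|---| | H-mean | $\frac{n}{\pi_{\min}}\rho$ | $\frac n\rho$ | $\frac{2n}{\rho^2}$ | | Q-mean | $\frac{1}{\pi_{\min}}\rho$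 | $\frac1{\sqrt n}\frac1\rho$ | $\frac2{\sqrt n}\frac1{\rho^2}\big(1+\frac1\rho\big)$ | | G-mean | $2\big(\frac{\rho}{\pi_{\min}}\big)^{1/n}$ | $\frac1n\frac1\rho\big(1+\frac1\rho\big)^{1-1/n}$ | $\frac{2}{n\rho^2}$ | 2. If $\mathbf E_X\big[\|\widehat\eta_{S'}(X)-\eta(X)\|_1\big]\to0$ in probability as $m\to\infty$, then there is a sequence $\rho_m\in(0,1)$ with $\rho_m\to0$ such that $\mathrm{regret}^\psi_D\big[\widehat h^{\mathrm{FW},\rho_m}_S\big]\to0$ in probability as $m\to\infty$ (over $S\sim D^m$). -/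

import Mathlib

open MeasureTheory ProbabilityTheory Filter Topology

noncomputable section

namespace BayesCG

/-! ### Classifiers and confusion matrices -/

/-- A randomized classifier: a measurable map from the instance space to the probability
simplex over the labels. -/
def IsClassifier {X : Type*} [MeasurableSpace X] {n : ℕ} (h : X → Fin n → ℝ) : Prop :=
  Measurable h ∧ ∀ x, h x ∈ stdSimplex ℝ (Fin n)

/-- The confusion matrix of `h` under `D`: entry `(i, j)` is `E[h_j(X) 1(Y = i)]`. -/
def conf {X : Type*} [MeasurableSpace X] {n : ℕ} (D : Measure (X × Fin n))
    (h : X → Fin n → ℝ) : Matrix (Fin n) (Fin n) ℝ :=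
  fun i j => ∫ z, h z.1 j * (if z.2 = i then 1 else 0) ∂D

/-- The set of feasible confusion matrices. -/
def feasible {X : Type*} [MeasurableSpace X] {n : ℕ} (D : Measure (X × Fin n)) :
    Set (Matrix (Fin n) (Fin n) ℝ) :=
  {C | ∃ h : X → Fin n → ℝ, IsClassifier h ∧ C = conf D h}

/-- The prior probability of the label `y`. -/
def prior {X : Type*} [MeasurableSpace X] {n : ℕ} (D : Measure (X × Fin n)) (y : Fin n) : ℝ :=
  D.snd.real {y}

/-- The smallest prior probability. -/
def priorMin {X : Type*} [MeasurableSpace X] {n : ℕ} (D : Measure (X × Fin n)) : ℝ :=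
  ⨅ y, prior D y

/-- The conditional class probabilities `P(Y = y | X = x)`. -/
def condProb {X : Type*} [MeasurableSpace X] {n : ℕ} [NeZero n] (D : Measure (X × Fin n))
    [IsFiniteMeasure D] (x : X) (y : Fin n) : ℝ :=
  (D.condKernel x).real {y}

/-- The expected `ℓ₁` distance `E_X ‖η'(X) - η(X)‖₁` between a model and the true conditional
class probabilities. -/
def cpeError {X : Type*} [MeasurableSpace X] {n : ℕ} [NeZero n] (D : Measure (X × Fin n))
    [IsFiniteMeasure D] (η' : X → Fin n → ℝ) : ℝ :=
  ∫ x, ∑ y, |η' x y - condProb D x y| ∂D.fst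

/-- The `ψ`-regret of `h`: optimal value over all randomized classifiers minus the value at
`h`. -/
def regret {X : Type*} [MeasurableSpace X] {n : ℕ} (D : Measure (X × Fin n))
    (ψ : Matrix (Fin n) (Fin n) ℝ → ℝ) (h : X → Fin n → ℝ) : ℝ :=
  (⨆ g : {g : X → Fin n → ℝ // IsClassifier g}, ψ (conf D g)) - ψ (conf D h)

/-! ### Samples -/

/-- The empirical distribution of a sample. -/
def empirical {Z : Type*} [MeasurableSpace Z] {k : ℕ} (S : Fin k → Z) : Measure Z :=
  (k : ENNReal)⁻¹ • ∑ i, Measure.dirac (S i)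

/-- Convergence in probability, as the sample size tends to infinity, of a real functional of an
i.i.d. sample. -/
def TendstoInProb {Z : Type*} [MeasurableSpace Z] (D : Measure Z)
    (φ : ∀ m : ℕ, (Fin m → Z) → ℝ) (a : ℝ) : Prop :=
  ∀ ε : ℝ, 0 < ε →
    Tendsto (fun m => Measure.pi (fun _ : Fin m => D) {S | ε ≤ |φ m S - a|}) atTop (𝓝 0)

/-- A (measurable) procedure that maps samples of every size to functions from the instance
space to the probability simplex. -/
def IsLearner {X : Type*} [MeasurableSpace X] {n : ℕ}
    (A : ∀ k : ℕ, (Fin k → X × Fin n) → X → Fin n → ℝ) : Prop :=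
  ∀ k, Measurable (fun p : (Fin k → X × Fin n) × X => A k p.1 p.2) ∧
    ∀ S x, A k S x ∈ stdSimplex ℝ (Fin n)

/-- The size of the first part of the split of a sample of size `m`. -/
def size₁ (α : ℝ) (m : ℕ) : ℕ := ⌊(1 - α) * m⌋₊

/-- The size of the second part of the split of a sample of size `m`. -/
def size₂ (α : ℝ) (m : ℕ) : ℕ := ⌈α * m⌉₊

theorem size_add {α : ℝ} (hα : α ∈ Set.Ioo (0 : ℝ) 1) (m : ℕ) :
    size₁ α m + size₂ α m = m := by
  have h0 : 0 ≤ α * m := mul_nonneg hα.1.le (Nat.cast_nonneg m)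
  have h1 : 0 ≤ (1 - α) * m := mul_nonneg (by linarith [hα.2]) (Nat.cast_nonneg m)
  have a1 : (size₁ α m : ℝ) ≤ (1 - α) * m := Nat.floor_le h1
  have a2 : (1 - α) * m < (size₁ α m : ℝ) + 1 := Nat.lt_floor_add_one _
  have b1 : α * m ≤ (size₂ α m : ℝ) := Nat.le_ceil _
  have b2 : (size₂ α m : ℝ) < α * m + 1 := Nat.ceil_lt_add_one h0
  have c1 : ((size₁ α m + size₂ α m : ℕ) : ℝ) < (m + 1 : ℕ) := by push_cast; linarith
  have c2 : (m : ℝ) < ((size₁ α m + size₂ α m + 1 : ℕ) : ℝ) := by push_cast; linarith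
  have d1 := Nat.cast_lt.mp c1
  have d2 := Nat.cast_lt.mp c2
  omega

/-- The first part `S'` of the sample. -/
def part₁ {Z : Type*} {α : ℝ} (hα : α ∈ Set.Ioo (0 : ℝ) 1) {m : ℕ} (S : Fin m → Z) :
    Fin (size₁ α m) → Z :=
  fun i => S (Fin.cast (size_add hα m) (Fin.castAdd (size₂ α m) i))

/-- The second part `S''` of the sample. -/
def part₂ {Z : Type*} {α : ℝ} (hα : α ∈ Set.Ioo (0 : ℝ) 1) {m : ℕ} (S : Fin m → Z) :
    Fin (size₂ α m) → Z :=
  fun i => S (Fin.cast (size_add hα m) (Fin.natAdd (size₁ α m) i))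

/-! ### The algorithm -/

/-- The gradient of a function of a matrix: the matrix of its partial derivatives. -/
def grad {n : ℕ} (ψ : Matrix (Fin n) (Fin n) ℝ → ℝ) (C : Matrix (Fin n) (Fin n) ℝ) :
    Matrix (Fin n) (Fin n) ℝ :=
  fun i j => deriv (fun t : ℝ => ψ (C + t • Matrix.single i j (1 : ℝ))) 0

/-- `i` is the largest maximizer of `v`. -/
def IsLastArgmax {n : ℕ} (v : Fin n → ℝ) (i : Fin n) : Prop :=
  (∀ y, v y ≤ v i) ∧ ∀ y, i < y → v y < v i

open Classical in
/-- The plug-in classifier for the gain matrix `G` and the model `η'`: it puts mass one on the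
largest `i` that maximizes the inner product of the `i`-th column of `G` with `η' x`. -/
def plugIn {X : Type*} {n : ℕ} (G : Matrix (Fin n) (Fin n) ℝ) (η' : X → Fin n → ℝ) :
    X → Fin n → ℝ :=
  fun x i => if IsLastArgmax (fun y => ∑ k, G k y * η' x k) i then 1 else 0

/-- The iterates of the sample-based conditional gradient method, for the model `η'`, the
distribution `E` used for the gradients (the empirical one) and the initial classifier `h₀`. -/
def iterate {X : Type*} [MeasurableSpace X] {n : ℕ} (ψ : Matrix (Fin n) (Fin n) ℝ → ℝ)
    (η' : X → Fin n → ℝ) (E : Measure (X × Fin n)) (h₀ : X → Fin n → ℝ) :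
    ℕ → X → Fin n → ℝ
  | 0 => h₀
  | j + 1 =>
    let h := iterate ψ η' E h₀ j
    let u := plugIn (grad ψ (conf E h)) η'
    let γ : ℝ := 2 / (((j + 1 : ℕ) : ℝ) + 1)
    fun x i => (1 - γ) * h x i + γ * u x i

/-- The classifier that BayesCG returns on the sample `S` when run on `ψ` with parameters
`α` and `κ`, class probability estimation procedure `cpe` and initial classifier `h₀ m S`. -/
def bayesCG {X : Type*} [MeasurableSpace X] {n : ℕ} {α : ℝ} (hα : α ∈ Set.Ioo (0 : ℝ) 1)
    (κ : ℕ) (cpe h₀ : ∀ k : ℕ, (Fin k → X × Fin n) → X → Fin n → ℝ)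
    (ψ : Matrix (Fin n) (Fin n) ℝ → ℝ) (m : ℕ) (S : Fin m → X × Fin n) : X → Fin n → ℝ :=
  iterate ψ (cpe (size₁ α m) (part₁ hα S)) (empirical (part₂ hα S)) (h₀ m S) (κ * m)

/-! ### The metrics and their smoothed versions -/

open Classical in
/-- The H-mean. It vanishes when one of the true positive rates does, by continuity; the
displayed formula is used on all other matrices. -/
def hMean {n : ℕ} (C : Matrix (Fin n) (Fin n) ℝ) : ℝ :=
  if ∃ y, C y y = 0 then 0 else (n : ℝ) * (∑ y, (∑ z, C y z) / C y y)⁻¹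

/-- The Q-mean. -/
def qMean {n : ℕ} (C : Matrix (Fin n) (Fin n) ℝ) : ℝ :=
  1 - √((1 / (n : ℝ)) * ∑ y, (1 - C y y / ∑ z, C y z) ^ 2)

/-- The G-mean. -/
def gMean {n : ℕ} (C : Matrix (Fin n) (Fin n) ℝ) : ℝ :=
  (∏ y, C y y / ∑ z, C y z) ^ (1 / (n : ℝ))

/-- The smoothed H-mean. -/
def hMeanSmooth {n : ℕ} (ρ : ℝ) (C : Matrix (Fin n) (Fin n) ℝ) : ℝ :=
  (n : ℝ) * (∑ y, (∑ z, C y z + ρ) / (C y y + ρ))⁻¹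

/-- The smoothed Q-mean. -/
def qMeanSmooth {n : ℕ} (ρ : ℝ) (C : Matrix (Fin n) (Fin n) ℝ) : ℝ :=
  1 - √((1 / (n : ℝ)) *
    ∑ y, ((∑ z ∈ Finset.univ.erase y, C y z + ρ) / (∑ z, C y z + ρ)) ^ 2)

/-- The smoothed G-mean. -/
def gMeanSmooth {n : ℕ} (ρ : ℝ) (C : Matrix (Fin n) (Fin n) ℝ) : ℝ :=
  (∏ y, (C y y + ρ) / (∑ z, C y z + ρ)) ^ (1 / (n : ℝ))

/-! ### Regularity with respect to the `ℓ₁` norm -/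

/-- The entrywise `ℓ₁` norm of a matrix. -/
def l1Norm {n : ℕ} (M : Matrix (Fin n) (Fin n) ℝ) : ℝ := ∑ i, ∑ j, |M i j|

/-- The matrices with entries in `[0, 1]`. -/
def cube (n : ℕ) : Set (Matrix (Fin n) (Fin n) ℝ) := {C | ∀ i j, C i j ∈ Set.Icc (0 : ℝ) 1}

/-- `ψ` is `L`-Lipschitz with respect to the `ℓ₁` norm over `s`. -/
def LipschitzL1On {n : ℕ} (L : ℝ) (ψ : Matrix (Fin n) (Fin n) ℝ → ℝ)
    (s : Set (Matrix (Fin n) (Fin n) ℝ)) : Prop :=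
  ∀ M ∈ s, ∀ N ∈ s, |ψ M - ψ N| ≤ L * l1Norm (M - N)

/-- `ψ` is `β`-smooth with respect to the `ℓ₁` norm over `s`: its partial derivatives exist, and
`‖∇ψ(M) - ∇ψ(N)‖_∞ ≤ β ‖M - N‖₁`. -/
def SmoothL1On {n : ℕ} (β : ℝ) (ψ : Matrix (Fin n) (Fin n) ℝ → ℝ)
    (s : Set (Matrix (Fin n) (Fin n) ℝ)) : Prop :=
  (∀ M ∈ s, ∀ i j,
    DifferentiableAt ℝ (fun t : ℝ => ψ (M + t • Matrix.single i j (1 : ℝ))) 0) ∧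
  ∀ M ∈ s, ∀ N ∈ s, ∀ i j, |grad ψ M i j - grad ψ N i j| ≤ β * l1Norm (M - N)

/-- `ψρ` is a smoothing of `ψ` with approximation error `θ`, Lipschitz constants `L` and
smoothness parameters `β`: for every `ρ ∈ (0, 1)` the function `ψρ ρ` is concave over the
feasible confusion matrices, `L ρ`-Lipschitz and `β ρ`-smooth, and it differs from `ψ` by at most
`θ ρ` over the feasible confusion matrices. -/
def IsSmoothing {X : Type*} [MeasurableSpace X] {n : ℕ} (D : Measure (X × Fin n))
    (ψ : Matrix (Fin n) (Fin n) ℝ → ℝ) (ψρ : ℝ → Matrix (Fin n) (Fin n) ℝ → ℝ)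
    (θ L β : ℝ → ℝ) : Prop :=
  ∀ ρ ∈ Set.Ioo (0 : ℝ) 1,
    ConcaveOn ℝ (feasible D) (ψρ ρ) ∧
    LipschitzL1On (L ρ) (ψρ ρ) (cube n) ∧
    SmoothL1On (β ρ) (ψρ ρ) (cube n) ∧
    ∀ C ∈ feasible D, |ψ C - ψρ ρ C| ≤ θ ρ

end BayesCG

end

/-! ### Confusion matrices, the pairing of ℓ∞ with ℓ₁, and calculus over the cube. -/

noncomputable section

namespace BayesCG

variable {X : Type*} [MeasurableSpace X] {n : ℕ}

/-! ### Basic facts on confusion matrices -/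

/-! The theorem combines an analytic study of three explicit functions with a consistency proof for
the conditional gradient method run on noisy data.

Analysis. The row sums of a feasible confusion matrix are the class priors (`rowSum_eq_prior`), so
over the feasible set the denominators of the metrics are constants. There the smoothed metrics are
a weighted harmonic mean, one minus a quadratic mean, and a geometric mean of positive affine
functions of the matrix. Concavity is then Cauchy–Schwarz for the first two and the inequality of
arithmetic and geometric means for the third. Adding `ρ` to numerator and denominator moves a recall
by at most `ρ / priorMin D` (`smoothRatio_sub_le`), which gives the approximation errors. For the
Lipschitz and smoothness constants, the gradients are computed explicitly; they and their
directional derivatives are bounded over the cube, and the mean value inequality along segments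
concludes (`lipschitzL1On_of_hasDerivAt`).

Algorithm, for a fixed smooth concave metric. `sub_iterate_le` bounds the optimality gap after `k`
steps by a gradient error of order `β n² ε`, a linear maximization error `2 B` times the CPE error,
and an optimization error of order `1 / k`. Here `ε` is the uniform deviation of empirical confusion
matrices over all plug-in classifiers of the learnt model. Only plug-in classifiers matter, because
every iterate after the first step is a convex combination of them.

The deviation tends to zero because the plug-in family is small: once the model is fixed, the region
where a label is chosen is an intersection of `n` half-spaces (open or closed, through the origin)
in the `n`-dimensional space of model values. Sauer–Shelah gives a polynomial growth function
(`exists_finset_plugIn`), and symmetrization with a maximal inequality for Rademacher sums turns it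
into a bound in expectation (`lintegral_iSup_average_sub_le`). The second part of the sample is
independent of the model, so Fubini and Markov apply. A dense sequence of gain matrices keeps the
suprema countable and measurable.

Conclusion. For each fixed `ρ` the gap exceeds any given level with probability tending to zero. A
diagonal choice lets `ρ` tend to zero slowly enough to preserve this, and the regret for the
original metric is at most the gap plus twice the approximation error (`abs_regret_le`). -/

theorem IsClassifier.nonneg {h : X → Fin n → ℝ} (hh : IsClassifier h) (x : X) (j : Fin n) :
    0 ≤ h x j := (hh.2 x).1 j

theorem IsClassifier.sum_eq_one {h : X → Fin n → ℝ} (hh : IsClassifier h) (x : X) :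
    ∑ j, h x j = 1 := (hh.2 x).2

theorem IsClassifier.le_one {h : X → Fin n → ℝ} (hh : IsClassifier h) (x : X) (j : Fin n) :
    h x j ≤ 1 := by
  rw [← hh.sum_eq_one x]
  exact Finset.single_le_sum (fun i _ => hh.nonneg x i) (Finset.mem_univ j)

theorem IsClassifier.convexComb {h u : X → Fin n → ℝ} (hh : IsClassifier h)
    (hu : IsClassifier u) {a b : ℝ} (ha : 0 ≤ a) (hb : 0 ≤ b) (hab : a + b = 1) :
    IsClassifier (fun x i => a * h x i + b * u x i) := by
  refine ⟨?_, fun x => ?_⟩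
  · exact ((hh.1.const_smul a).add (hu.1.const_smul b))
  · exact (convex_stdSimplex ℝ (Fin n)) (hh.2 x) (hu.2 x) ha hb hab

theorem measurable_labelIndicator (i : Fin n) :
    Measurable (fun z : X × Fin n => if z.2 = i then (1 : ℝ) else 0) :=
  (measurable_of_finite (fun y : Fin n => if y = i then (1 : ℝ) else 0)).comp measurable_snd

theorem IsClassifier.measurable_apply {h : X → Fin n → ℝ} (hh : IsClassifier h) (j : Fin n) :
    Measurable (fun x => h x j) := (measurable_pi_apply j).comp hh.1

theorem IsClassifier.measurable_confIntegrand {h : X → Fin n → ℝ} (hh : IsClassifier h)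
    (i j : Fin n) :
    Measurable (fun z : X × Fin n => h z.1 j * (if z.2 = i then (1 : ℝ) else 0)) :=
  ((hh.measurable_apply j).comp measurable_fst).mul (measurable_labelIndicator i)

theorem IsClassifier.confIntegrand_nonneg {h : X → Fin n → ℝ} (hh : IsClassifier h)
    (i j : Fin n) (z : X × Fin n) : 0 ≤ h z.1 j * (if z.2 = i then (1 : ℝ) else 0) :=
  mul_nonneg (hh.nonneg _ _) (by split_ifs <;> norm_num)

theorem IsClassifier.confIntegrand_le_one {h : X → Fin n → ℝ} (hh : IsClassifier h)
    (i j : Fin n) (z : X × Fin n) : h z.1 j * (if z.2 = i then (1 : ℝ) else 0) ≤ 1 := by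
  have := hh.le_one z.1 j
  split_ifs <;> simp [this]

theorem IsClassifier.integrable_confIntegrand {h : X → Fin n → ℝ} (hh : IsClassifier h)
    (D : Measure (X × Fin n)) [IsFiniteMeasure D] (i j : Fin n) :
    Integrable (fun z : X × Fin n => h z.1 j * (if z.2 = i then (1 : ℝ) else 0)) D := by
  refine Integrable.of_bound (hh.measurable_confIntegrand i j).aestronglyMeasurable 1
    (Eventually.of_forall fun z => ?_)
  rw [Real.norm_of_nonneg (hh.confIntegrand_nonneg i j z)]
  exact hh.confIntegrand_le_one i j z

theorem conf_nonneg {h : X → Fin n → ℝ} (hh : IsClassifier h) (D : Measure (X × Fin n))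
    (i j : Fin n) : 0 ≤ conf D h i j :=
  integral_nonneg fun z => hh.confIntegrand_nonneg i j z

theorem conf_row_sum {h : X → Fin n → ℝ} (hh : IsClassifier h) (D : Measure (X × Fin n))
    [IsFiniteMeasure D] (i : Fin n) : ∑ j, conf D h i j = prior D i := by
  unfold conf prior
  rw [← integral_finsetSum _ fun j _ => hh.integrable_confIntegrand D i j]
  simp_rw [← Finset.sum_mul, hh.sum_eq_one, one_mul]
  rw [Measure.snd, map_measureReal_apply measurable_snd (measurableSet_singleton i)]
  rw [← integral_indicator_one (measurable_snd (measurableSet_singleton i))]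
  exact integral_congr_ae (Eventually.of_forall fun z => by simp [Set.indicator])

theorem prior_nonneg (D : Measure (X × Fin n)) (y : Fin n) : 0 ≤ prior D y := measureReal_nonneg

theorem sum_prior (D : Measure (X × Fin n)) [IsProbabilityMeasure D] :
    ∑ y, prior D y = 1 := by
  unfold prior
  rw [sum_measureReal_singleton]
  simp

theorem prior_le_one (D : Measure (X × Fin n)) [IsProbabilityMeasure D] (y : Fin n) :
    prior D y ≤ 1 := measureReal_le_one

theorem conf_le_prior {h : X → Fin n → ℝ} (hh : IsClassifier h) (D : Measure (X × Fin n))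
    [IsFiniteMeasure D] (i j : Fin n) : conf D h i j ≤ prior D i := by
  rw [← conf_row_sum hh D i]
  exact Finset.single_le_sum (fun k _ => conf_nonneg hh D i k) (Finset.mem_univ j)

theorem conf_mem_cube {h : X → Fin n → ℝ} (hh : IsClassifier h) (D : Measure (X × Fin n))
    [IsProbabilityMeasure D] : conf D h ∈ cube n :=
  fun i j => ⟨conf_nonneg hh D i j, (conf_le_prior hh D i j).trans (prior_le_one D i)⟩

theorem conf_convexComb {h u : X → Fin n → ℝ} (hh : IsClassifier h) (hu : IsClassifier u)
    (D : Measure (X × Fin n)) [IsFiniteMeasure D] (a b : ℝ) :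
    conf D (fun x i => a * h x i + b * u x i) = a • conf D h + b • conf D u := by
  ext i j
  simp only [conf, Matrix.add_apply, Matrix.smul_apply, smul_eq_mul]
  rw [← integral_const_mul, ← integral_const_mul, ← integral_add
    ((hh.integrable_confIntegrand D i j).const_mul a)
    ((hu.integrable_confIntegrand D i j).const_mul b)]
  congr 1
  ext z
  ring

theorem convex_feasible (D : Measure (X × Fin n)) [IsFiniteMeasure D] :
    Convex ℝ (feasible D) := by
  rintro _ ⟨h, hh, rfl⟩ _ ⟨u, hu, rfl⟩ a b ha hb hab
  exact ⟨_, hh.convexComb hu ha hb hab, (conf_convexComb hh hu D a b).symm⟩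

theorem feasible_subset_cube (D : Measure (X × Fin n)) [IsProbabilityMeasure D] :
    feasible D ⊆ cube n := by
  rintro _ ⟨h, hh, rfl⟩
  exact conf_mem_cube hh D

theorem l1Norm_conf {h : X → Fin n → ℝ} (hh : IsClassifier h) (D : Measure (X × Fin n))
    [IsProbabilityMeasure D] : l1Norm (conf D h) = 1 := by
  unfold l1Norm
  simp_rw [abs_of_nonneg (conf_nonneg hh D _ _), conf_row_sum hh D, sum_prior]

/-! ### The entrywise norms -/

theorem l1Norm_nonneg (M : Matrix (Fin n) (Fin n) ℝ) : 0 ≤ l1Norm M :=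
  Finset.sum_nonneg fun _ _ => Finset.sum_nonneg fun _ _ => abs_nonneg _

theorem l1Norm_sub_le (M N : Matrix (Fin n) (Fin n) ℝ) :
    l1Norm (M - N) ≤ l1Norm M + l1Norm N := by
  unfold l1Norm
  simp_rw [← Finset.sum_add_distrib]
  exact Finset.sum_le_sum fun i _ => Finset.sum_le_sum fun j _ => abs_sub _ _

theorem l1Norm_smul (a : ℝ) (M : Matrix (Fin n) (Fin n) ℝ) :
    l1Norm (a • M) = |a| * l1Norm M := by
  simp [l1Norm, abs_mul, Finset.mul_sum]

theorem l1Norm_sub_comm (M N : Matrix (Fin n) (Fin n) ℝ) : l1Norm (M - N) = l1Norm (N - M) := by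
  simp [l1Norm, abs_sub_comm]

theorem row_le_l1Norm (M : Matrix (Fin n) (Fin n) ℝ) (i : Fin n) :
    ∑ j, |M i j| ≤ l1Norm M :=
  Finset.single_le_sum (f := fun i => ∑ j, |M i j|)
    (fun _ _ => Finset.sum_nonneg fun _ _ => abs_nonneg _) (Finset.mem_univ i)

theorem l1Norm_le_of_entry_le {M : Matrix (Fin n) (Fin n) ℝ} {ε : ℝ}
    (h : ∀ i j, |M i j| ≤ ε) : l1Norm M ≤ n ^ 2 * ε := by
  calc l1Norm M ≤ ∑ _i : Fin n, ∑ _j : Fin n, ε :=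
        Finset.sum_le_sum fun i _ => Finset.sum_le_sum fun j _ => h i j
    _ = n ^ 2 * ε := by simp; ring

/-- The entrywise inner product of matrices. -/
def frob (G V : Matrix (Fin n) (Fin n) ℝ) : ℝ := ∑ i, ∑ j, G i j * V i j

theorem frob_sub_right (G V W : Matrix (Fin n) (Fin n) ℝ) :
    frob G (V - W) = frob G V - frob G W := by
  simp [frob, mul_sub, Finset.sum_sub_distrib]

theorem frob_sub_left (G H V : Matrix (Fin n) (Fin n) ℝ) :
    frob (G - H) V = frob G V - frob H V := by
  simp [frob, sub_mul, Finset.sum_sub_distrib]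

theorem abs_frob_le {G : Matrix (Fin n) (Fin n) ℝ} {B : ℝ} (hG : ∀ i j, |G i j| ≤ B)
    (V : Matrix (Fin n) (Fin n) ℝ) : |frob G V| ≤ B * l1Norm V := by
  unfold frob l1Norm
  rw [Finset.mul_sum]
  refine (Finset.abs_sum_le_sum_abs _ _).trans (Finset.sum_le_sum fun i _ => ?_)
  rw [Finset.mul_sum]
  refine (Finset.abs_sum_le_sum_abs _ _).trans (Finset.sum_le_sum fun j _ => ?_)
  rw [abs_mul]
  exact mul_le_mul_of_nonneg_right (hG i j) (abs_nonneg _)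

theorem frob_single (G : Matrix (Fin n) (Fin n) ℝ) (i j : Fin n) :
    frob G (Matrix.single i j 1) = G i j := by
  unfold frob
  rw [Finset.sum_eq_single i, Finset.sum_eq_single j]
  · simp
  · intro b _ hb; simp [Matrix.single, hb.symm]
  · simp
  · intro b _ hb; simp [Matrix.single, hb.symm]
  · simp

/-! ### Directional derivatives -/

theorem convex_cube : Convex ℝ (cube n) := by
  intro M hM N hN a b ha hb hab i j
  exact (convex_Icc (0 : ℝ) 1) (hM i j) (hN i j) ha hb hab

theorem lineMap_mem_cube {M N : Matrix (Fin n) (Fin n) ℝ} (hM : M ∈ cube n) (hN : N ∈ cube n)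
    {t : ℝ} (ht : t ∈ Set.Icc (0 : ℝ) 1) : M + t • (N - M) ∈ cube n := by
  have := convex_cube hM hN (sub_nonneg.2 ht.2) ht.1 (by ring)
  convert this using 1
  module

/-- Moves the base point along the line, so that derivatives need only be computed at parameter
zero, once for every base point. -/
theorem hasDerivAt_line {f : Matrix (Fin n) (Fin n) ℝ → ℝ} {M V : Matrix (Fin n) (Fin n) ℝ}
    {t d : ℝ} (h : HasDerivAt (fun s : ℝ => f ((M + t • V) + s • V)) d 0) :
    HasDerivAt (fun s : ℝ => f (M + s • V)) d t := by
  have h2 : HasDerivAt (fun s : ℝ => s - t) 1 t := (hasDerivAt_id t).sub_const t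
  have h3 := HasDerivAt.comp (h := fun s : ℝ => s - t) t (by simpa using h) h2
  rw [mul_one] at h3
  refine h3.congr_of_eventuallyEq (Eventually.of_forall fun s => ?_)
  simp only [Function.comp]
  congr 1
  module

/-- A function with a directional derivative bounded by `K` times the `ℓ₁` norm of the direction
is `K`-Lipschitz over the cube. -/
theorem lipschitzL1On_of_hasDerivAt {f : Matrix (Fin n) (Fin n) ℝ → ℝ}
    {f' : Matrix (Fin n) (Fin n) ℝ → Matrix (Fin n) (Fin n) ℝ → ℝ} {K : ℝ}
    (hf : ∀ M ∈ cube n, ∀ V, HasDerivAt (fun t : ℝ => f (M + t • V)) (f' M V) 0)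
    (hK : ∀ M ∈ cube n, ∀ V, |f' M V| ≤ K * l1Norm V) : LipschitzL1On K f (cube n) := by
  intro M hM N hN
  -- The mean value inequality on the segment from `M` to `N`, which stays in the cube by convexity.
  have key := Convex.norm_image_sub_le_of_norm_hasDerivWithin_le (𝕜 := ℝ)
    (f := fun t : ℝ => f (M + t • (N - M)))
    (f' := fun t : ℝ => f' (M + t • (N - M)) (N - M)) (s := Set.Icc 0 1) (C := K * l1Norm (N - M))
    (fun t ht => (hasDerivAt_line (hf _ (lineMap_mem_cube hM hN ht) _)).hasDerivWithinAt)
    (fun t ht => hK _ (lineMap_mem_cube hM hN ht) _) (convex_Icc 0 1)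
    (Set.left_mem_Icc.2 zero_le_one) (Set.right_mem_Icc.2 zero_le_one)
  simp only [one_smul, zero_smul, add_zero, add_sub_cancel, sub_zero, norm_one, mul_one,
    Real.norm_eq_abs] at key
  rwa [abs_sub_comm, l1Norm_sub_comm]

/-- `g` is the gradient of `ψ` over the cube. -/
def HasGrad (ψ : Matrix (Fin n) (Fin n) ℝ → ℝ)
    (g : Matrix (Fin n) (Fin n) ℝ → Matrix (Fin n) (Fin n) ℝ) : Prop :=
  ∀ M ∈ cube n, ∀ V, HasDerivAt (fun t : ℝ => ψ (M + t • V)) (frob (g M) V) 0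

/-- `HasGrad` asks for two-sided derivatives in all directions, also at boundary points of the cube,
so it determines the `deriv`s in `grad` there too. -/
theorem HasGrad.grad_eq {ψ : Matrix (Fin n) (Fin n) ℝ → ℝ}
    {g : Matrix (Fin n) (Fin n) ℝ → Matrix (Fin n) (Fin n) ℝ} (hg : HasGrad ψ g)
    {M : Matrix (Fin n) (Fin n) ℝ} (hM : M ∈ cube n) : grad ψ M = g M := by
  ext i j
  rw [grad, (hg M hM (Matrix.single i j 1)).deriv, frob_single]

theorem HasGrad.lipschitzL1On {ψ : Matrix (Fin n) (Fin n) ℝ → ℝ}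
    {g : Matrix (Fin n) (Fin n) ℝ → Matrix (Fin n) (Fin n) ℝ} (hg : HasGrad ψ g) {K : ℝ}
    (hK : ∀ M ∈ cube n, ∀ i j, |g M i j| ≤ K) : LipschitzL1On K ψ (cube n) :=
  lipschitzL1On_of_hasDerivAt hg fun M hM V => abs_frob_le (hK M hM) V

theorem HasGrad.smoothL1On {ψ : Matrix (Fin n) (Fin n) ℝ → ℝ}
    {g : Matrix (Fin n) (Fin n) ℝ → Matrix (Fin n) (Fin n) ℝ} (hg : HasGrad ψ g) {β : ℝ}
    (hβ : ∀ i j, LipschitzL1On β (fun M => g M i j) (cube n)) : SmoothL1On β ψ (cube n) := by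
  refine ⟨fun M hM i j => (hg M hM _).differentiableAt, fun M hM N hN i j => ?_⟩
  rw [hg.grad_eq hM, hg.grad_eq hN]
  exact hβ i j M hM N hN

end BayesCG

end

/-! ### Tools shared by the three metrics. -/

noncomputable section

namespace BayesCG

variable {n : ℕ}

/-! ### Row sums -/

/-- The sum of the off-diagonal entries in a row. -/
def offSum (M : Matrix (Fin n) (Fin n) ℝ) (y : Fin n) : ℝ := ∑ z ∈ Finset.univ.erase y, M y z

theorem diag_add_offSum (M : Matrix (Fin n) (Fin n) ℝ) (y : Fin n) :
    M y y + offSum M y = ∑ z, M y z :=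
  Finset.add_sum_erase Finset.univ (fun z => M y z) (Finset.mem_univ y)

theorem abs_diag_add_abs_offSum_le (V : Matrix (Fin n) (Fin n) ℝ) (y : Fin n) :
    |V y y| + |offSum V y| ≤ ∑ z, |V y z| := by
  rw [← Finset.add_sum_erase Finset.univ (fun z => |V y z|) (Finset.mem_univ y)]
  exact add_le_add le_rfl (Finset.abs_sum_le_sum_abs _ _)

theorem abs_diag_le_l1Norm (V : Matrix (Fin n) (Fin n) ℝ) (y : Fin n) : |V y y| ≤ l1Norm V := by
  have := abs_diag_add_abs_offSum_le V y
  have := row_le_l1Norm V y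
  have := abs_nonneg (offSum V y)
  linarith

/-- The metrics see a row only through its diagonal entry and its off-diagonal sum. Collecting the
coefficients of these two before taking absolute values keeps the cancellation between the diagonal
and the row sum. -/
theorem abs_mul_diag_add_mul_offSum_le {p r K : ℝ} (hp : |p| ≤ K) (hr : |r| ≤ K)
    (V : Matrix (Fin n) (Fin n) ℝ) (y : Fin n) :
    |p * V y y + r * offSum V y| ≤ K * ∑ z, |V y z| := by
  have hK : 0 ≤ K := (abs_nonneg p).trans hp
  calc |p * V y y + r * offSum V y| ≤ |p * V y y| + |r * offSum V y| := abs_add_le _ _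
    _ ≤ K * |V y y| + K * |offSum V y| := by
        rw [abs_mul, abs_mul]
        gcongr
    _ = K * (|V y y| + |offSum V y|) := by ring
    _ ≤ _ := mul_le_mul_of_nonneg_left (abs_diag_add_abs_offSum_le V y) hK

theorem offSum_nonneg {M : Matrix (Fin n) (Fin n) ℝ} (hM : M ∈ cube n) (y : Fin n) :
    0 ≤ offSum M y := Finset.sum_nonneg fun z _ => (hM y z).1

theorem diag_nonneg {M : Matrix (Fin n) (Fin n) ℝ} (hM : M ∈ cube n) (y : Fin n) :
    0 ≤ M y y := (hM y y).1

theorem hasDerivAt_entry (M V : Matrix (Fin n) (Fin n) ℝ) (i j : Fin n) :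
    HasDerivAt (fun t : ℝ => (M + t • V) i j) (V i j) 0 := by
  have h : HasDerivAt (fun t : ℝ => M i j + t * V i j) (1 * V i j) 0 :=
    ((hasDerivAt_id (0 : ℝ)).mul_const (V i j)).const_add (M i j)
  simpa using h

theorem hasDerivAt_rowSum (M V : Matrix (Fin n) (Fin n) ℝ) (i : Fin n) :
    HasDerivAt (fun t : ℝ => ∑ z, (M + t • V) i z) (∑ z, V i z) 0 :=
  HasDerivAt.fun_sum fun z _ => hasDerivAt_entry M V i z

theorem hasDerivAt_offSum (M V : Matrix (Fin n) (Fin n) ℝ) (i : Fin n) :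
    HasDerivAt (fun t : ℝ => offSum (M + t • V) i) (offSum V i) 0 :=
  HasDerivAt.fun_sum fun z _ => hasDerivAt_entry M V i z

/-- A function of the diagonal entries and the row sums has a gradient of this shape: constant along
each row, up to a diagonal correction. -/
theorem frob_diag_sub (c d : Fin n → ℝ) (V : Matrix (Fin n) (Fin n) ℝ) :
    frob (fun i j => (if i = j then c i else 0) - d i) V =
      ∑ i, (c i * V i i - d i * ∑ z, V i z) := by
  unfold frob
  refine Finset.sum_congr rfl fun i _ => ?_
  simp [sub_mul, Finset.sum_sub_distrib, Finset.mul_sum]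

/-! ### Feasible matrices -/

section Feasible

variable {X : Type*} [MeasurableSpace X]

/-- The source of concavity: on the feasible set the denominators of the metrics do not vary. -/
theorem rowSum_eq_prior {D : Measure (X × Fin n)} [IsFiniteMeasure D]
    {C : Matrix (Fin n) (Fin n) ℝ} (hC : C ∈ feasible D) (y : Fin n) :
    ∑ z, C y z = prior D y := by
  obtain ⟨h, hh, rfl⟩ := hC
  exact conf_row_sum hh D y

theorem diag_le_prior {D : Measure (X × Fin n)} [IsFiniteMeasure D]
    {C : Matrix (Fin n) (Fin n) ℝ} (hC : C ∈ feasible D) (y : Fin n) :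
    C y y ≤ prior D y := by
  obtain ⟨h, hh, rfl⟩ := hC
  exact conf_le_prior hh D y y

theorem feasible_diag_nonneg {D : Measure (X × Fin n)}
    {C : Matrix (Fin n) (Fin n) ℝ} (hC : C ∈ feasible D) (y : Fin n) : 0 ≤ C y y := by
  obtain ⟨h, hh, rfl⟩ := hC
  exact conf_nonneg hh D y y

theorem priorMin_le (D : Measure (X × Fin n)) (y : Fin n) : priorMin D ≤ prior D y :=
  ciInf_le (Set.finite_range _).bddBelow y

theorem priorMin_pos [NeZero n] {D : Measure (X × Fin n)} (h : ∀ y, 0 < prior D y) :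
    0 < priorMin D := by
  obtain ⟨y, hy⟩ := exists_eq_ciInf_of_finite (f := prior D)
  rw [priorMin, ← hy]
  exact h y

/-- Adding `ρ` to the numerator and the denominator of a ratio `c / p ≤ 1`. -/
theorem smoothRatio_sub {c p ρ : ℝ} (hp : 0 < p) (hρ : 0 < ρ) :
    (c + ρ) / (p + ρ) - c / p = ρ * (p - c) / (p * (p + ρ)) := by
  have : p + ρ ≠ 0 := by positivity
  field_simp
  ring

theorem smoothRatio_sub_nonneg {c p ρ : ℝ} (hp : 0 < p) (hρ : 0 < ρ) (hcp : c ≤ p) :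
    0 ≤ (c + ρ) / (p + ρ) - c / p := by
  rw [smoothRatio_sub hp hρ]
  have := sub_nonneg.2 hcp
  positivity

theorem smoothRatio_sub_le {c p ρ q : ℝ} (hq : 0 < q) (hqp : q ≤ p) (hρ : 0 < ρ)
    (hc : 0 ≤ c) : (c + ρ) / (p + ρ) - c / p ≤ ρ / q := by
  have hp : 0 < p := hq.trans_le hqp
  rw [smoothRatio_sub hp hρ]
  calc ρ * (p - c) / (p * (p + ρ)) ≤ ρ * (p + ρ) / (p * (p + ρ)) := by
        gcongr; linarith
    _ = ρ / p := by
        have : p + ρ ≠ 0 := by positivity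
        field_simp
    _ ≤ ρ / q := by gcongr

end Feasible

end BayesCG

end

/-! ### H-mean: gradient bounds, concavity by Cauchy–Schwarz, approximation. -/

noncomputable section

namespace BayesCG

variable {n : ℕ}

/-! ### The H-mean -/

/-- The smoothed reciprocal recall of a class. -/
def hRatio (ρ : ℝ) (M : Matrix (Fin n) (Fin n) ℝ) (y : Fin n) : ℝ :=
  (∑ z, M y z + ρ) / (M y y + ρ)

/-- The sum of the smoothed reciprocal recalls. -/
def hSum (ρ : ℝ) (M : Matrix (Fin n) (Fin n) ℝ) : ℝ := ∑ y, hRatio ρ M y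

/-- The directional derivative of `hRatio`. -/
def hRatioDeriv (ρ : ℝ) (M V : Matrix (Fin n) (Fin n) ℝ) (y : Fin n) : ℝ :=
  (offSum V y - (hRatio ρ M y - 1) * V y y) / (M y y + ρ)

/-- The gradient of the smoothed H-mean. -/
def hGrad (ρ : ℝ) (M : Matrix (Fin n) (Fin n) ℝ) : Matrix (Fin n) (Fin n) ℝ :=
  fun i j => (if i = j then n / hSum ρ M ^ 2 * (hRatio ρ M i / (M i i + ρ)) else 0) -
    n / hSum ρ M ^ 2 * (1 / (M i i + ρ))

section

variable {ρ : ℝ} {M : Matrix (Fin n) (Fin n) ℝ}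

theorem one_le_hRatio (hρ : 0 < ρ) (hM : M ∈ cube n) (y : Fin n) : 1 ≤ hRatio ρ M y := by
  have h1 := diag_nonneg hM y
  have h2 := offSum_nonneg hM y
  have h3 := diag_add_offSum M y
  rw [hRatio, le_div_iff₀ (by linarith)]
  linarith

theorem hRatio_le_hSum (hρ : 0 < ρ) (hM : M ∈ cube n) (y : Fin n) :
    hRatio ρ M y ≤ hSum ρ M :=
  Finset.single_le_sum (f := hRatio ρ M)
    (fun i _ => zero_le_one.trans (one_le_hRatio hρ hM i)) (Finset.mem_univ y)

theorem card_le_hSum (hρ : 0 < ρ) (hM : M ∈ cube n) : (n : ℝ) ≤ hSum ρ M := by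
  calc (n : ℝ) = ∑ _y : Fin n, 1 := by simp
    _ ≤ hSum ρ M := Finset.sum_le_sum fun y _ => one_le_hRatio hρ hM y

theorem one_le_hSum [NeZero n] (hρ : 0 < ρ) (hM : M ∈ cube n) : 1 ≤ hSum ρ M :=
  (one_le_hRatio hρ hM 0).trans (hRatio_le_hSum hρ hM 0)

theorem hasDerivAt_hRatio (hρ : 0 < ρ) (hM : M ∈ cube n) (V : Matrix (Fin n) (Fin n) ℝ)
    (y : Fin n) :
    HasDerivAt (fun t : ℝ => hRatio ρ (M + t • V) y) (hRatioDeriv ρ M V y) 0 := by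
  have ha : M y y + ρ ≠ 0 := by have := diag_nonneg hM y; positivity
  have h := ((hasDerivAt_rowSum M V y).add_const ρ).fun_div
    ((hasDerivAt_entry M V y y).add_const ρ) (by simpa using ha)
  refine h.congr_deriv ?_
  simp only [zero_smul, add_zero, hRatioDeriv, hRatio, ← diag_add_offSum V]
  field_simp
  ring

theorem hasDerivAt_hSum (hρ : 0 < ρ) (hM : M ∈ cube n) (V : Matrix (Fin n) (Fin n) ℝ) :
    HasDerivAt (fun t : ℝ => hSum ρ (M + t • V)) (∑ y, hRatioDeriv ρ M V y) 0 :=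
  HasDerivAt.fun_sum fun y _ => hasDerivAt_hRatio hρ hM V y

/-- The coefficients `1` and `hRatio - 1` are both at most `hSum`. The bound is stated relative to
`hSum` because the powers of `hSum` in the denominator of the gradient will cancel it. -/
theorem abs_hRatioDeriv_le [NeZero n] (hρ : 0 < ρ) (hM : M ∈ cube n)
    (V : Matrix (Fin n) (Fin n) ℝ) (y : Fin n) :
    |hRatioDeriv ρ M V y| ≤ hSum ρ M * (∑ z, |V y z|) / ρ := by
  have h1 := one_le_hRatio hρ hM y
  have h2 := hRatio_le_hSum hρ hM y
  have h3 := diag_nonneg hM y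
  have h4 := one_le_hSum hρ hM
  rw [hRatioDeriv, abs_div, abs_of_pos (show 0 < M y y + ρ by linarith)]
  have h5 := abs_mul_diag_add_mul_offSum_le (p := -(hRatio ρ M y - 1)) (r := 1) (K := hSum ρ M)
    (by rw [abs_neg, abs_of_nonneg] <;> linarith) (by simpa using h4) V y
  have h6 : offSum V y - (hRatio ρ M y - 1) * V y y =
    -(hRatio ρ M y - 1) * V y y + 1 * offSum V y := by ring
  rw [h6]
  gcongr
  linarith

theorem abs_sum_hRatioDeriv_le [NeZero n] (hρ : 0 < ρ) (hM : M ∈ cube n)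
    (V : Matrix (Fin n) (Fin n) ℝ) :
    |∑ y, hRatioDeriv ρ M V y| ≤ hSum ρ M * l1Norm V / ρ := by
  refine (Finset.abs_sum_le_sum_abs _ _).trans
    ((Finset.sum_le_sum fun y _ => abs_hRatioDeriv_le hρ hM V y).trans_eq ?_)
  rw [l1Norm, Finset.mul_sum, Finset.sum_div]

theorem hasGrad_hMeanSmooth [NeZero n] (hρ : 0 < ρ) :
    HasGrad (hMeanSmooth (n := n) ρ) (hGrad ρ) := by
  intro M hM V
  have hS : hSum ρ M ≠ 0 := by have := one_le_hSum hρ hM; positivity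
  have h := ((hasDerivAt_hSum hρ hM V).fun_inv (by simpa using hS)).const_mul (n : ℝ)
  refine h.congr_deriv ?_
  unfold hGrad
  rw [frob_diag_sub]
  simp only [zero_smul, add_zero, Finset.sum_div, ← Finset.sum_neg_distrib, Finset.mul_sum]
  refine Finset.sum_congr rfl fun y _ => ?_
  have ha : M y y + ρ ≠ 0 := by have := diag_nonneg hM y; positivity
  rw [hRatioDeriv, ← Finset.mul_sum, ← diag_add_offSum V]
  field_simp
  ring

theorem abs_hGrad_le [NeZero n] (hρ : 0 < ρ) (hM : M ∈ cube n) (i j : Fin n) :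
    |hGrad ρ M i j| ≤ n / ρ := by
  have h0 := one_le_hSum hρ hM
  have h1 := one_le_hRatio hρ hM i
  have h2 := hRatio_le_hSum hρ hM i
  have h3 := diag_nonneg hM i
  have ha : 0 < M i i + ρ := by linarith
  have hn : (0 : ℝ) ≤ n := Nat.cast_nonneg n
  -- The numerator `p` is `hRatio - 1` on the diagonal and `1` off it; both are at most `hSum`,
  -- hence at most its square.
  have key : ∀ p : ℝ, |p| ≤ hSum ρ M → |n / hSum ρ M ^ 2 * (p / (M i i + ρ))| ≤ n / ρ := by
    intro p hp
    rw [abs_mul, abs_div p, abs_of_pos ha, abs_of_nonneg (by positivity)]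
    calc n / hSum ρ M ^ 2 * (|p| / (M i i + ρ))
        ≤ n / hSum ρ M ^ 2 * (hSum ρ M ^ 2 / ρ) := by
          gcongr
          · exact hp.trans (le_self_pow₀ h0 two_ne_zero)
          · linarith
      _ = n / ρ := by field_simp
  unfold hGrad
  split_ifs with hij
  · rw [← mul_sub, ← sub_div]
    exact key _ (by rw [abs_of_nonneg] <;> linarith)
  · rw [zero_sub, abs_neg]
    exact key _ (by simpa using h0)

/-- By the product rule the derivative of an entry is `n / hSum * (1 / (M i i + ρ))` times a
combination of logarithmic derivatives. The prefactor is at most `1 / ρ` because `hSum` is at least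
`n`, and the combination is at most four times `l1Norm V / ρ`. -/
theorem lipschitzL1On_hGrad [NeZero n] (hρ : 0 < ρ) (i j : Fin n) :
    LipschitzL1On (2 * n / ρ ^ 2) (fun M => hGrad ρ M i j) (cube n) := by
  have hn0 : n ≠ 0 := NeZero.ne n
  -- The general argument yields `4 / ρ ^ 2`, which is below `2 * n / ρ ^ 2` only from `n = 2` on.
  -- For a single class the gradient vanishes.
  by_cases hn1 : n = 1
  · subst hn1
    intro M hM N hN
    have hz : ∀ M ∈ cube 1, hGrad ρ M i j = 0 := by
      intro M hM
      have ha : M i i + ρ ≠ 0 := by have := diag_nonneg hM i; positivity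
      have hr : ∑ z, M i z = M i i := by
        rw [Fin.sum_univ_one, Subsingleton.elim (0 : Fin 1) i]
      unfold hGrad hRatio
      rw [if_pos (Subsingleton.elim i j), hr, div_self ha, sub_self]
    simp only [hz M hM, hz N hN, sub_self, abs_zero]
    have := l1Norm_nonneg (M - N)
    positivity
  have hn2 : (2 : ℝ) ≤ n := by exact_mod_cast (show 2 ≤ n by omega)
  -- `A` is the relative derivative of `hSum`, `B` the numerator of the entry over `hSum`, `E` the
  -- derivative of that numerator over `hSum`, and `F` the relative derivative of the diagonal
  -- denominator.
  have hsm : ∀ {A B E F ℓ : ℝ}, |A| ≤ ℓ → |B| ≤ 1 → |E| ≤ ℓ → |F| ≤ ℓ →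
      |-2 * A * B + E - B * F| ≤ 4 * ℓ := by
    intro A B E F ℓ hA hB hE hF
    have hℓ : 0 ≤ ℓ := (abs_nonneg A).trans hA
    have h1 : |A * B| ≤ ℓ * 1 := by rw [abs_mul]; gcongr
    have h2 : |B * F| ≤ 1 * ℓ := by rw [abs_mul]; gcongr
    rw [abs_le] at h1 h2 hE ⊢
    constructor <;> nlinarith
  have hinv : ∀ M ∈ cube n, ∀ V : Matrix (Fin n) (Fin n) ℝ,
      HasDerivAt (fun t : ℝ => n / hSum ρ (M + t • V) ^ 2)
        (-2 * n * (∑ y, hRatioDeriv ρ M V y) / hSum ρ M ^ 3) 0 := by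
    intro M hM V
    have hS : hSum ρ M ≠ 0 := by have := one_le_hSum hρ hM; positivity
    have h := (((hasDerivAt_hSum hρ hM V).fun_pow 2).fun_inv (by simpa using hS)).const_mul (n : ℝ)
    refine (h.congr_deriv ?_)
    simp only [zero_smul, add_zero, Nat.cast_ofNat, Nat.add_one_sub_one, pow_one]
    field_simp
  have hfin : ∀ M ∈ cube n, ∀ V : Matrix (Fin n) (Fin n) ℝ, ∀ x : ℝ,
      |x| ≤ 4 * (l1Norm V / ρ) →
      |n / hSum ρ M * (1 / (M i i + ρ)) * x| ≤ 2 * n / ρ ^ 2 * l1Norm V := by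
    intro M hM V x hx
    have hS := one_le_hSum hρ hM
    have hSn := card_le_hSum hρ hM
    have ha := diag_nonneg hM i
    have hV := l1Norm_nonneg V
    have h1 : n / hSum ρ M ≤ 1 := (div_le_one (by linarith)).2 hSn
    have h2 : 1 / (M i i + ρ) ≤ 1 / ρ := by gcongr; linarith
    have h3 : 0 < M i i + ρ := by linarith
    rw [abs_mul, abs_of_nonneg (by positivity)]
    calc n / hSum ρ M * (1 / (M i i + ρ)) * |x| ≤ 1 * (1 / ρ) * (4 * (l1Norm V / ρ)) := by
          gcongr
      _ = 2 * 2 / ρ ^ 2 * l1Norm V := by ring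
      _ ≤ 2 * n / ρ ^ 2 * l1Norm V := by gcongr
  by_cases hij : i = j
  · refine lipschitzL1On_of_hasDerivAt (f' := fun M V => n / hSum ρ M * (1 / (M i i + ρ)) *
      (-2 * ((∑ y, hRatioDeriv ρ M V y) / hSum ρ M) * ((hRatio ρ M i - 1) / hSum ρ M) +
        hRatioDeriv ρ M V i / hSum ρ M -
        (hRatio ρ M i - 1) / hSum ρ M * (V i i / (M i i + ρ)))) ?_ ?_
    · intro M hM V
      have ha : M i i + ρ ≠ 0 := by have := diag_nonneg hM i; positivity
      have hS : hSum ρ M ≠ 0 := by have := one_le_hSum hρ hM; positivity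
      have h := (hinv M hM V).fun_mul (((hasDerivAt_hRatio hρ hM V i).sub_const 1).fun_div
        ((hasDerivAt_entry M V i i).add_const ρ) (by simpa using ha))
      have hfun : (fun t : ℝ => hGrad ρ (M + t • V) i j) = fun t : ℝ =>
          n / hSum ρ (M + t • V) ^ 2 *
            ((hRatio ρ (M + t • V) i - 1) / ((M + t • V) i i + ρ)) := by
        funext t
        rw [hGrad, if_pos hij, ← mul_sub, ← sub_div]
      rw [hfun]
      refine h.congr_deriv ?_
      simp only [zero_smul, add_zero]
      field_simp
      ring
    · intro M hM V
      refine hfin M hM V _ (hsm ?_ ?_ ?_ ?_)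
      · have hS := one_le_hSum hρ hM
        rw [abs_div, abs_of_pos (show 0 < hSum ρ M by linarith), div_le_iff₀ (by linarith)]
        exact (abs_sum_hRatioDeriv_le hρ hM V).trans_eq (by ring)
      · have hS := one_le_hSum hρ hM
        have h1 := one_le_hRatio hρ hM i
        have h2 := hRatio_le_hSum hρ hM i
        rw [abs_div, abs_of_pos (show 0 < hSum ρ M by linarith), div_le_one (by linarith),
          abs_of_nonneg (by linarith)]
        linarith
      · have hS := one_le_hSum hρ hM
        rw [abs_div, abs_of_pos (show 0 < hSum ρ M by linarith), div_le_iff₀ (by linarith)]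
        refine (abs_hRatioDeriv_le hρ hM V i).trans ?_
        rw [mul_comm, mul_div_right_comm]
        gcongr
        exact row_le_l1Norm V i
      · have ha := diag_nonneg hM i
        rw [abs_div, abs_of_pos (show 0 < M i i + ρ by linarith)]
        have := abs_nonneg (V i i)
        have := l1Norm_nonneg V
        gcongr
        · exact abs_diag_le_l1Norm V i
        · linarith
  · refine lipschitzL1On_of_hasDerivAt (f' := fun M V => n / hSum ρ M * (1 / (M i i + ρ)) *
      (-2 * ((∑ y, hRatioDeriv ρ M V y) / hSum ρ M) * (-1 / hSum ρ M) +
        0 - (-1 / hSum ρ M) * (V i i / (M i i + ρ)))) ?_ ?_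
    · intro M hM V
      have ha : M i i + ρ ≠ 0 := by have := diag_nonneg hM i; positivity
      have hS : hSum ρ M ≠ 0 := by have := one_le_hSum hρ hM; positivity
      have h := (hinv M hM V).fun_mul ((hasDerivAt_const (0 : ℝ) (-1 : ℝ)).fun_div
        ((hasDerivAt_entry M V i i).add_const ρ) (by simpa using ha))
      have hfun : (fun t : ℝ => hGrad ρ (M + t • V) i j) = fun t : ℝ =>
          n / hSum ρ (M + t • V) ^ 2 * (-1 / ((M + t • V) i i + ρ)) := by
        funext t
        rw [hGrad, if_neg hij]
        ring
      rw [hfun]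
      refine h.congr_deriv ?_
      simp only [zero_smul, add_zero]
      field_simp
      ring
    · intro M hM V
      have hV := l1Norm_nonneg V
      refine hfin M hM V _ (hsm ?_ ?_ ?_ ?_)
      · have hS := one_le_hSum hρ hM
        rw [abs_div, abs_of_pos (show 0 < hSum ρ M by linarith), div_le_iff₀ (by linarith)]
        exact (abs_sum_hRatioDeriv_le hρ hM V).trans_eq (by ring)
      · have hS := one_le_hSum hρ hM
        rw [abs_div, abs_of_pos (show 0 < hSum ρ M by linarith), div_le_one (by linarith)]
        simpa using hS
      · rw [abs_zero]; positivity
      · have ha := diag_nonneg hM i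
        rw [abs_div, abs_of_pos (show 0 < M i i + ρ by linarith)]
        have := abs_nonneg (V i i)
        gcongr
        · exact abs_diag_le_l1Norm V i
        · linarith

end

/-! ### Concavity and approximation for the H-mean -/

section

variable {X : Type*} [MeasurableSpace X] {ρ : ℝ}

/-- The weighted harmonic mean is concave. -/
theorem concave_inv_sum_div [NeZero n] {c x y z : Fin n → ℝ} {a b : ℝ} (hc : ∀ i, 0 < c i)
    (hx : ∀ i, 0 < x i) (hy : ∀ i, 0 < y i) (ha : 0 ≤ a) (hb : 0 ≤ b)
    (hz : ∀ i, z i = a * x i + b * y i) (hz0 : ∀ i, 0 < z i) :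
    a * (∑ i, c i / x i)⁻¹ + b * (∑ i, c i / y i)⁻¹ ≤ (∑ i, c i / z i)⁻¹ := by
  have hpos : ∀ u : Fin n → ℝ, (∀ i, 0 < u i) → 0 < ∑ i, c i / u i := fun u hu =>
    Finset.sum_pos (fun i _ => div_pos (hc i) (hu i)) ⟨0, Finset.mem_univ 0⟩
  set S := ∑ i, c i / z i with hS
  have hS0 : 0 < S := hpos z hz0
  -- Cauchy–Schwarz bounds the harmonic mean at `u` by its tangent at `z`, which is linear in `u`.
  -- The combination of the tangent values at `x` and `y` is the value at `z`.
  have key : ∀ u : Fin n → ℝ, (∀ i, 0 < u i) →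
      (∑ i, c i / u i)⁻¹ ≤ (∑ i, c i * u i / z i ^ 2) / S ^ 2 := by
    intro u hu
    have h := Finset.sum_sq_le_sum_mul_sum_of_sq_le_mul Finset.univ (r := fun i => c i / z i)
      (f := fun i => c i / u i) (g := fun i => c i * u i / z i ^ 2)
      (fun i _ => (div_pos (hc i) (hu i)).le)
      (fun i _ => (div_pos (mul_pos (hc i) (hu i)) (pow_pos (hz0 i) 2)).le)
      (fun i _ => le_of_eq (by have := (hu i).ne'; have := (hz0 i).ne'; field_simp))
    rw [inv_le_iff_one_le_mul₀ (hpos u hu), div_mul_eq_mul_div, le_div_iff₀ (by positivity),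
      one_mul, mul_comm]
    exact h
  calc a * (∑ i, c i / x i)⁻¹ + b * (∑ i, c i / y i)⁻¹
      ≤ a * ((∑ i, c i * x i / z i ^ 2) / S ^ 2) + b * ((∑ i, c i * y i / z i ^ 2) / S ^ 2) := by
        gcongr
        · exact key x hx
        · exact key y hy
    _ = (∑ i, c i / z i) / S ^ 2 := by
        rw [← mul_div_assoc, ← mul_div_assoc, ← add_div, Finset.mul_sum, Finset.mul_sum,
          ← Finset.sum_add_distrib]
        congr 1
        refine Finset.sum_congr rfl fun i _ => ?_
        have h0 := (hz0 i).ne'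
        have h1 : a * (c i * x i / z i ^ 2) + b * (c i * y i / z i ^ 2) =
          c i * (a * x i + b * y i) / z i ^ 2 := by ring
        rw [h1, ← hz i]
        field_simp
    _ = S⁻¹ := by rw [← hS]; field_simp

theorem concaveOn_hMeanSmooth [NeZero n] (D : Measure (X × Fin n)) [IsProbabilityMeasure D]
    (hρ : 0 < ρ) : ConcaveOn ℝ (feasible D) (hMeanSmooth ρ) := by
  refine ⟨convex_feasible D, fun M hM N hN a b ha hb hab => ?_⟩
  have hP := convex_feasible D hM hN ha hb hab
  have hform : ∀ C ∈ feasible D,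
      hMeanSmooth ρ C = n * (∑ y, (prior D y + ρ) / (C y y + ρ))⁻¹ := by
    intro C hC
    simp only [hMeanSmooth, rowSum_eq_prior hC]
  have hd : ∀ C ∈ feasible D, ∀ y, 0 < C y y + ρ := fun C hC y => by
    have := feasible_diag_nonneg hC y
    positivity
  have h := concave_inv_sum_div (c := fun y => prior D y + ρ) (z := fun y => (a • M + b • N) y y + ρ)
    (fun y => by have := prior_nonneg D y; positivity) (hd M hM) (hd N hN) ha hb
    (fun y => by
      simp only [Matrix.add_apply, Matrix.smul_apply, smul_eq_mul]
      linear_combination (-ρ) * hab) (hd _ hP)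
  rw [hform M hM, hform N hN, hform _ hP, smul_eq_mul, smul_eq_mul]
  have hn : (0 : ℝ) ≤ n := Nat.cast_nonneg n
  calc _ = n * (a * (∑ y, (prior D y + ρ) / (M y y + ρ))⁻¹ +
        b * (∑ y, (prior D y + ρ) / (N y y + ρ))⁻¹) := by ring
    _ ≤ _ := mul_le_mul_of_nonneg_left h hn

theorem abs_hMean_sub_le [NeZero n] (D : Measure (X × Fin n)) [IsProbabilityMeasure D]
    (hprior : ∀ y, 0 < prior D y) (hρ : 0 < ρ) {C : Matrix (Fin n) (Fin n) ℝ}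
    (hC : C ∈ feasible D) : |hMean C - hMeanSmooth ρ C| ≤ n / priorMin D * ρ := by
  have hq := priorMin_pos hprior
  have hn : (0 : ℝ) ≤ n := Nat.cast_nonneg n
  have hc : ∀ y, 0 ≤ C y y := feasible_diag_nonneg hC
  set t' : Fin n → ℝ := fun y => (prior D y + ρ) / (C y y + ρ) with ht'
  have ht'0 : ∀ y, 0 < t' y := fun y => by
    have := hc y; have := hprior y; simp only [ht']; positivity
  have hS' : 0 < ∑ y, t' y := Finset.sum_pos (fun y _ => ht'0 y) ⟨0, Finset.mem_univ 0⟩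
  have hform' : hMeanSmooth ρ C = n * (∑ y, t' y)⁻¹ := by
    simp only [hMeanSmooth, rowSum_eq_prior hC, ht']
  have htinv : ∀ y, (t' y)⁻¹ = (C y y + ρ) / (prior D y + ρ) := fun y => by simp [ht', inv_div]
  have hdiff : ∀ y, (t' y)⁻¹ - C y y / prior D y ≤ ρ / priorMin D := fun y => by
    rw [htinv]
    exact smoothRatio_sub_le hq (priorMin_le D y) hρ (hc y)
  have hdiff0 : ∀ y, 0 ≤ (t' y)⁻¹ - C y y / prior D y := fun y => by
    rw [htinv]
    exact smoothRatio_sub_nonneg (hprior y) hρ (diag_le_prior hC y)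
  by_cases h0 : ∃ y, C y y = 0
  -- With a vanishing recall the metric is zero, and the smoothed harmonic mean is at most `n` times
  -- the smoothed recall of that class.
  · rw [hMean, if_pos h0, hform', zero_sub, abs_neg, abs_of_nonneg (by positivity)]
    obtain ⟨y, hy⟩ := h0
    have h1 : (∑ y, t' y)⁻¹ ≤ (t' y)⁻¹ :=
      inv_anti₀ (ht'0 y) (Finset.single_le_sum (fun i _ => (ht'0 i).le) (Finset.mem_univ y))
    have h2 := hdiff y
    rw [hy, zero_div, sub_zero] at h2
    calc n * (∑ y, t' y)⁻¹ ≤ n * (ρ / priorMin D) := by gcongr; exact h1.trans h2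
      _ = n / priorMin D * ρ := by ring
  · have hc0 : ∀ y, 0 < C y y := fun y => (hc y).lt_of_ne' fun h => h0 ⟨y, h⟩
    set t : Fin n → ℝ := fun y => prior D y / C y y with ht
    have ht0 : ∀ y, 0 < t y := fun y => div_pos (hprior y) (hc0 y)
    have hS : 0 < ∑ y, t y := Finset.sum_pos (fun y _ => ht0 y) ⟨0, Finset.mem_univ 0⟩
    have htt : ∀ y, C y y / prior D y = (t y)⁻¹ := fun y => by simp [ht, inv_div]
    rw [hMean, if_neg h0, hform']
    simp only [rowSum_eq_prior hC]
    change |n * (∑ y, t y)⁻¹ - n * (∑ y, t' y)⁻¹| ≤ _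
    have hle : ∀ y, t' y ≤ t y := fun y => by
      have := hdiff0 y
      rw [htt] at this
      exact (inv_le_inv₀ (ht0 y) (ht'0 y)).1 (by linarith)
    -- Termwise, `t - t'` is the change of the recall times `t * t'`; enlarging one factor `t'` to
    -- the full sum makes the bound sum to a product.
    have hsum : ∑ y, t y - ∑ y, t' y ≤ ρ / priorMin D * ((∑ y, t y) * ∑ y, t' y) := by
      calc ∑ y, t y - ∑ y, t' y = ∑ y, ((t' y)⁻¹ - (t y)⁻¹) * (t y * t' y) := by
            rw [← Finset.sum_sub_distrib]
            refine Finset.sum_congr rfl fun y _ => ?_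
            have := (ht0 y).ne'; have := (ht'0 y).ne'
            field_simp
        _ ≤ ∑ y, ρ / priorMin D * (t y * ∑ z, t' z) := by
            refine Finset.sum_le_sum fun y _ => ?_
            have h1 := hdiff y
            rw [htt] at h1
            have h2 : t' y ≤ ∑ z, t' z :=
              Finset.single_le_sum (fun i _ => (ht'0 i).le) (Finset.mem_univ y)
            have := ht0 y; have := ht'0 y
            gcongr
        _ = _ := by rw [← Finset.mul_sum, ← Finset.sum_mul]
    have hle' : ∑ y, t' y ≤ ∑ y, t y := Finset.sum_le_sum fun y _ => hle y
    have heq : (∑ y, t' y)⁻¹ - (∑ y, t y)⁻¹ =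
        (∑ y, t y - ∑ y, t' y) / ((∑ y, t y) * ∑ y, t' y) := by field_simp
    rw [← mul_sub, abs_mul, abs_of_nonneg hn, abs_sub_comm, heq,
      abs_of_nonneg (div_nonneg (by linarith) (by positivity))]
    calc n * ((∑ y, t y - ∑ y, t' y) / ((∑ y, t y) * ∑ y, t' y)) ≤ n * (ρ / priorMin D) := by
          refine mul_le_mul_of_nonneg_left ?_ hn
          rwa [div_le_iff₀ (by positivity)]
      _ = n / priorMin D * ρ := by ring

theorem isSmoothing_hMean [NeZero n] (D : Measure (X × Fin n)) [IsProbabilityMeasure D]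
    (hprior : ∀ y, 0 < prior D y) :
    IsSmoothing D hMean hMeanSmooth (fun ρ => n / priorMin D * ρ) (fun ρ => n / ρ)
      (fun ρ => 2 * n / ρ ^ 2) := fun _ hρ =>
  ⟨concaveOn_hMeanSmooth D hρ.1,
    (hasGrad_hMeanSmooth hρ.1).lipschitzL1On fun _ hM => abs_hGrad_le hρ.1 hM,
    (hasGrad_hMeanSmooth hρ.1).smoothL1On (lipschitzL1On_hGrad hρ.1),
    fun _ hC => abs_hMean_sub_le D hprior hρ.1 hC⟩

end

end BayesCG

end

/-! ### Q-mean: gradient bounds, concavity by Minkowski, approximation. -/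

noncomputable section

namespace BayesCG

variable {n : ℕ}

/-! ### The Q-mean -/

/-- The smoothed error rate of a class. -/
def qRatio (ρ : ℝ) (M : Matrix (Fin n) (Fin n) ℝ) (y : Fin n) : ℝ :=
  (offSum M y + ρ) / (∑ z, M y z + ρ)

/-- The quadratic mean of a vector. -/
def quadMean (v : Fin n → ℝ) : ℝ := √((1 / (n : ℝ)) * ∑ y, v y ^ 2)

/-- The directional derivative of `qRatio`. -/
def qRatioDeriv (ρ : ℝ) (M V : Matrix (Fin n) (Fin n) ℝ) (y : Fin n) : ℝ :=
  (M y y * offSum V y - (offSum M y + ρ) * V y y) / (∑ z, M y z + ρ) ^ 2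

/-- The gradient of the smoothed Q-mean. -/
def qGrad (ρ : ℝ) (M : Matrix (Fin n) (Fin n) ℝ) : Matrix (Fin n) (Fin n) ℝ :=
  fun i j =>
    (if i = j then
      1 / (n : ℝ) * (qRatio ρ M i / quadMean (qRatio ρ M)) * (1 / (∑ z, M i z + ρ)) else 0) -
    1 / (n : ℝ) * (qRatio ρ M i / quadMean (qRatio ρ M)) * (M i i / (∑ z, M i z + ρ) ^ 2)

theorem sq_quadMean (v : Fin n → ℝ) : quadMean v ^ 2 = (1 / (n : ℝ)) * ∑ y, v y ^ 2 :=
  Real.sq_sqrt (mul_nonneg (by positivity) (Finset.sum_nonneg fun _ _ => sq_nonneg _))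

theorem quadMean_nonneg (v : Fin n → ℝ) : 0 ≤ quadMean v := Real.sqrt_nonneg _

theorem quadMean_const [NeZero n] {c : ℝ} (hc : 0 ≤ c) : quadMean (fun _ : Fin n => c) = c := by
  have : (n : ℝ) ≠ 0 := Nat.cast_ne_zero.2 (NeZero.ne n)
  rw [quadMean, Finset.sum_const, Finset.card_univ, Fintype.card_fin, nsmul_eq_mul,
    ← mul_assoc, one_div_mul_cancel this, one_mul, Real.sqrt_sq hc]

theorem quadMean_mono {v w : Fin n → ℝ} (hv : ∀ y, 0 ≤ v y) (h : ∀ y, v y ≤ w y) :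
    quadMean v ≤ quadMean w := by
  unfold quadMean
  gcongr with y
  · exact hv y
  · exact h y

theorem sum_mul_le_quadMean [NeZero n] (v w : Fin n → ℝ) :
    (1 / (n : ℝ)) * ∑ y, v y * w y ≤ quadMean v * quadMean w := by
  refine le_of_sq_le_sq ?_ (mul_nonneg (quadMean_nonneg v) (quadMean_nonneg w))
  rw [mul_pow, mul_pow, sq_quadMean, sq_quadMean]
  have h := Finset.sum_mul_sq_le_sq_mul_sq Finset.univ v w
  calc (1 / (n : ℝ)) ^ 2 * (∑ y, v y * w y) ^ 2
      ≤ (1 / (n : ℝ)) ^ 2 * ((∑ y, v y ^ 2) * ∑ y, w y ^ 2) := by gcongr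
    _ = _ := by ring

/-- Minkowski's inequality: expand the square of the left side as inner products with `v` and `w`,
apply Cauchy–Schwarz to each, and divide by the left side. -/
theorem quadMean_convexComb_le [NeZero n] (v w : Fin n → ℝ) {a b : ℝ} (ha : 0 ≤ a)
    (hb : 0 ≤ b) :
    quadMean (fun y => a * v y + b * w y) ≤ a * quadMean v + b * quadMean w := by
  set z : Fin n → ℝ := fun y => a * v y + b * w y with hz
  have h0 : 0 ≤ a * quadMean v + b * quadMean w :=
    add_nonneg (mul_nonneg ha (quadMean_nonneg v)) (mul_nonneg hb (quadMean_nonneg w))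
  have h1 := mul_le_mul_of_nonneg_left (sum_mul_le_quadMean z v) ha
  have h2 := mul_le_mul_of_nonneg_left (sum_mul_le_quadMean z w) hb
  have h3 : quadMean z ^ 2 =
      a * ((1 / (n : ℝ)) * ∑ y, z y * v y) + b * ((1 / (n : ℝ)) * ∑ y, z y * w y) := by
    rw [sq_quadMean, Finset.mul_sum, Finset.mul_sum, Finset.mul_sum, Finset.mul_sum,
      Finset.mul_sum, ← Finset.sum_add_distrib]
    refine Finset.sum_congr rfl fun y _ => ?_
    simp only [hz]
    ring
  rcases (quadMean_nonneg z).eq_or_lt with h4 | h4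
  · rwa [← h4]
  · refine le_of_mul_le_mul_left ?_ h4
    nlinarith

/-- The triangle inequality; the normalization by `1 / n` makes a constant vector as large as its
entries, so no factor depending on `n` appears. -/
theorem abs_quadMean_sub_le [NeZero n] (v w : Fin n → ℝ) {δ : ℝ} (hδ : 0 ≤ δ)
    (h : ∀ y, |v y - w y| ≤ δ) : |quadMean v - quadMean w| ≤ δ := by
  have key : ∀ v w : Fin n → ℝ, (∀ y, |v y - w y| ≤ δ) → quadMean v ≤ quadMean w + δ := by
    intro v w h
    have h1 := quadMean_convexComb_le w (fun y => v y - w y) zero_le_one zero_le_one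
    have h2 : quadMean (fun y => v y - w y) ≤ δ := by
      calc quadMean (fun y => v y - w y) = quadMean (fun y => |v y - w y|) := by
            simp [quadMean]
        _ ≤ quadMean (fun _ : Fin n => δ) := quadMean_mono (fun y => abs_nonneg _) h
        _ = δ := quadMean_const hδ
    simp only [one_mul, add_sub_cancel] at h1
    linarith
  have h1 := key v w h
  have h2 := key w v fun y => by rw [abs_sub_comm]; exact h y
  rw [abs_le]
  constructor <;> linarith

theorem le_sqrt_mul_quadMean [NeZero n] {v : Fin n → ℝ} (y : Fin n) :
    v y ≤ √(n : ℝ) * quadMean v := by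
  have hn : (n : ℝ) ≠ 0 := Nat.cast_ne_zero.2 (NeZero.ne n)
  rw [quadMean, ← Real.sqrt_mul (Nat.cast_nonneg n), ← mul_assoc, mul_one_div_cancel hn, one_mul]
  exact Real.le_sqrt_of_sq_le
    (Finset.single_le_sum (f := fun y => v y ^ 2) (fun _ _ => sq_nonneg _) (Finset.mem_univ y))

section

variable {ρ : ℝ} {M : Matrix (Fin n) (Fin n) ℝ}

theorem qMeanSmooth_eq (ρ : ℝ) (M : Matrix (Fin n) (Fin n) ℝ) :
    qMeanSmooth ρ M = 1 - quadMean (qRatio ρ M) := rfl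

theorem qRatio_pos (hρ : 0 < ρ) (hM : M ∈ cube n) (y : Fin n) : 0 < qRatio ρ M y := by
  have h1 := diag_nonneg hM y
  have h2 := offSum_nonneg hM y
  have h3 := diag_add_offSum M y
  unfold qRatio
  apply div_pos <;> linarith

/-- The worst case is a row with diagonal entry one and nothing else. This keeps the square root
away from zero and is the origin of the factor `1 + 1 / ρ` in the smoothness constant. -/
theorem le_qRatio (hρ : 0 < ρ) (hM : M ∈ cube n) (y : Fin n) : ρ / (1 + ρ) ≤ qRatio ρ M y := by
  have h1 := diag_nonneg hM y
  have h1' : M y y ≤ 1 := (hM y y).2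
  have h2 := offSum_nonneg hM y
  have h3 := diag_add_offSum M y
  rw [qRatio, div_le_div_iff₀ (by linarith) (by linarith)]
  nlinarith

theorem le_quadMean_qRatio [NeZero n] (hρ : 0 < ρ) (hM : M ∈ cube n) :
    ρ / (1 + ρ) ≤ quadMean (qRatio ρ M) := by
  have h0 : 0 ≤ ρ / (1 + ρ) := by positivity
  rw [← quadMean_const (n := n) h0]
  exact quadMean_mono (fun _ => h0) (le_qRatio hρ hM)

theorem quadMean_qRatio_pos [NeZero n] (hρ : 0 < ρ) (hM : M ∈ cube n) :
    0 < quadMean (qRatio ρ M) :=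
  (show 0 < ρ / (1 + ρ) by positivity).trans_le (le_quadMean_qRatio hρ hM)

theorem rowSum_add_pos (hρ : 0 < ρ) (hM : M ∈ cube n) (y : Fin n) : 0 < ∑ z, M y z + ρ := by
  have h1 := diag_nonneg hM y
  have h2 := offSum_nonneg hM y
  have h3 := diag_add_offSum M y
  linarith

theorem hasDerivAt_qRatio (hρ : 0 < ρ) (hM : M ∈ cube n) (V : Matrix (Fin n) (Fin n) ℝ)
    (y : Fin n) :
    HasDerivAt (fun t : ℝ => qRatio ρ (M + t • V) y) (qRatioDeriv ρ M V y) 0 := by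
  have hb := (rowSum_add_pos hρ hM y).ne'
  have h := ((hasDerivAt_offSum M V y).add_const ρ).fun_div
    ((hasDerivAt_rowSum M V y).add_const ρ) (by simpa using hb)
  refine h.congr_deriv ?_
  simp only [zero_smul, add_zero, qRatioDeriv, ← diag_add_offSum]
  ring

theorem abs_qRatioDeriv_le (hρ : 0 < ρ) (hM : M ∈ cube n)
    (V : Matrix (Fin n) (Fin n) ℝ) (y : Fin n) :
    |qRatioDeriv ρ M V y| ≤ (∑ z, |V y z|) / ρ := by
  have h1 := diag_nonneg hM y
  have h2 := offSum_nonneg hM y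
  have h3 := diag_add_offSum M y
  have hb := rowSum_add_pos hρ hM y
  have h5 := abs_mul_diag_add_mul_offSum_le (p := -(offSum M y + ρ)) (r := M y y)
    (K := ∑ z, M y z + ρ)
    (by rw [abs_neg, abs_of_nonneg] <;> linarith) (by rw [abs_of_nonneg] <;> linarith) V y
  have h6 : M y y * offSum V y - (offSum M y + ρ) * V y y =
    -(offSum M y + ρ) * V y y + M y y * offSum V y := by ring
  rw [qRatioDeriv, h6, abs_div, abs_of_pos (pow_pos hb 2)]
  have hV : 0 ≤ ∑ z, |V y z| := Finset.sum_nonneg fun _ _ => abs_nonneg _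
  calc _ ≤ (∑ z, M y z + ρ) * (∑ z, |V y z|) / (∑ z, M y z + ρ) ^ 2 := by gcongr
    _ = (∑ z, |V y z|) / (∑ z, M y z + ρ) := by field_simp
    _ ≤ _ := by gcongr; linarith

theorem sum_abs_qRatioDeriv_le (hρ : 0 < ρ) (hM : M ∈ cube n) (V : Matrix (Fin n) (Fin n) ℝ) :
    ∑ y, |qRatioDeriv ρ M V y| ≤ l1Norm V / ρ := by
  refine (Finset.sum_le_sum fun y _ => abs_qRatioDeriv_le hρ hM V y).trans_eq ?_
  rw [l1Norm, Finset.sum_div]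

theorem hasDerivAt_quadMean_qRatio [NeZero n] (hρ : 0 < ρ) (hM : M ∈ cube n)
    (V : Matrix (Fin n) (Fin n) ℝ) :
    HasDerivAt (fun t : ℝ => quadMean (qRatio ρ (M + t • V)))
      (1 / (n : ℝ) * (∑ y, qRatio ρ M y * qRatioDeriv ρ M V y) / quadMean (qRatio ρ M)) 0 := by
  have hQ := quadMean_qRatio_pos hρ hM
  have hQ2 : (1 / (n : ℝ)) * ∑ y, qRatio ρ M y ^ 2 ≠ 0 := by
    rw [← sq_quadMean]; positivity
  have h := ((HasDerivAt.fun_sum (u := Finset.univ) fun y _ =>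
    (hasDerivAt_qRatio hρ hM V y).fun_pow 2).const_mul (1 / (n : ℝ))).sqrt (by simpa using hQ2)
  refine h.congr_deriv ?_
  simp only [zero_smul, add_zero, Nat.cast_ofNat, Nat.add_one_sub_one, pow_one]
  change _ / (2 * quadMean (qRatio ρ M)) = _
  simp_rw [mul_assoc (2 : ℝ), ← Finset.mul_sum]
  field_simp

theorem hasGrad_qMeanSmooth [NeZero n] (hρ : 0 < ρ) :
    HasGrad (qMeanSmooth (n := n) ρ) (qGrad ρ) := by
  intro M hM V
  refine ((hasDerivAt_quadMean_qRatio hρ hM V).const_sub 1).congr_deriv ?_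
  unfold qGrad
  rw [frob_diag_sub, Finset.mul_sum, Finset.sum_div, ← Finset.sum_neg_distrib]
  refine Finset.sum_congr rfl fun y _ => ?_
  have hb := (rowSum_add_pos hρ hM y).ne'
  have hQ := (quadMean_qRatio_pos hρ hM).ne'
  rw [qRatioDeriv]
  rw [← diag_add_offSum M] at hb ⊢
  rw [← diag_add_offSum V]
  field_simp
  ring

/-- A single coordinate is at most `√n` times the quadratic mean, which turns `1 / n` into `1 / √n`.
-/
theorem qRatio_div_quadMean_le [NeZero n] (hρ : 0 < ρ) (hM : M ∈ cube n) (i : Fin n) :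
    1 / (n : ℝ) * (qRatio ρ M i / quadMean (qRatio ρ M)) ≤ 1 / √(n : ℝ) := by
  have hQ := quadMean_qRatio_pos hρ hM
  have hn : (0 : ℝ) < n := Nat.cast_pos.2 (NeZero.pos n)
  calc 1 / (n : ℝ) * (qRatio ρ M i / quadMean (qRatio ρ M)) ≤ 1 / (n : ℝ) * √(n : ℝ) := by
        gcongr
        rw [div_le_iff₀ hQ]
        exact le_sqrt_mul_quadMean i
    _ = 1 / √(n : ℝ) := by
        rw [div_mul_eq_mul_div, one_mul, div_eq_div_iff hn.ne' (by positivity), one_mul]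
        exact Real.mul_self_sqrt hn.le

/-- The partial derivatives of `qRatio`. -/
def qPartial (ρ : ℝ) (M : Matrix (Fin n) (Fin n) ℝ) (i j : Fin n) : ℝ :=
  (if i = j then 1 / (∑ z, M i z + ρ) else 0) - M i i / (∑ z, M i z + ρ) ^ 2

theorem qGrad_eq (ρ : ℝ) (M : Matrix (Fin n) (Fin n) ℝ) (i j : Fin n) :
    qGrad ρ M i j =
      1 / (n : ℝ) * (qRatio ρ M i / quadMean (qRatio ρ M)) * qPartial ρ M i j := by
  unfold qGrad qPartial
  split_ifs <;> ring

theorem abs_qPartial_le (hρ : 0 < ρ) (hM : M ∈ cube n) (i j : Fin n) :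
    |qPartial ρ M i j| ≤ 1 / ρ := by
  have h1 := diag_nonneg hM i
  have h2 := offSum_nonneg hM i
  have h3 := diag_add_offSum M i
  have hb := rowSum_add_pos hρ hM i
  have h4 : M i i / (∑ z, M i z + ρ) ^ 2 ≤ 1 / (∑ z, M i z + ρ) := by
    rw [div_le_div_iff₀ (by positivity) hb, one_mul, sq]
    gcongr
    linarith
  have h5 : 1 / (∑ z, M i z + ρ) ≤ 1 / ρ := by gcongr; linarith
  have h6 : 0 ≤ M i i / (∑ z, M i z + ρ) ^ 2 := by positivity
  unfold qPartial
  split_ifs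
  · rw [abs_of_nonneg] <;> linarith
  · rw [zero_sub, abs_neg, abs_of_nonneg h6]; linarith

theorem abs_qGrad_le [NeZero n] (hρ : 0 < ρ) (hM : M ∈ cube n) (i j : Fin n) :
    |qGrad ρ M i j| ≤ 1 / √(n : ℝ) * (1 / ρ) := by
  have hQ := quadMean_qRatio_pos hρ hM
  have hq := qRatio_pos hρ hM i
  rw [qGrad_eq, abs_mul, abs_of_nonneg (a := 1 / (n : ℝ) * _) (by positivity)]
  have := qRatio_div_quadMean_le hρ hM i
  have := abs_qPartial_le hρ hM i j
  gcongr

/-- The directional derivative of `qPartial`. -/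
def qPartialDeriv (ρ : ℝ) (M V : Matrix (Fin n) (Fin n) ℝ) (i j : Fin n) : ℝ :=
  (if i = j then -(∑ z, V i z) / (∑ z, M i z + ρ) ^ 2 else 0) -
    (V i i * (∑ z, M i z + ρ) - 2 * M i i * ∑ z, V i z) / (∑ z, M i z + ρ) ^ 3

theorem hasDerivAt_qPartial (hρ : 0 < ρ) (hM : M ∈ cube n) (V : Matrix (Fin n) (Fin n) ℝ)
    (i j : Fin n) :
    HasDerivAt (fun t : ℝ => qPartial ρ (M + t • V) i j) (qPartialDeriv ρ M V i j) 0 := by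
  have hb := (rowSum_add_pos hρ hM i).ne'
  have hs := (hasDerivAt_rowSum M V i).add_const ρ
  have h1 := (hasDerivAt_entry M V i i).fun_div (hs.fun_pow 2) (by simpa using hb)
  unfold qPartial qPartialDeriv
  by_cases hij : i = j
  · simp only [if_pos hij]
    have h2 := (hasDerivAt_const (0 : ℝ) (1 : ℝ)).fun_div hs (by simpa using hb)
    refine (h2.fun_sub h1).congr_deriv ?_
    simp only [zero_smul, add_zero, Nat.cast_ofNat, Nat.add_one_sub_one, pow_one]
    field_simp
    ring
  · simp only [if_neg hij]
    refine (h1.const_sub 0).congr_deriv ?_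
    simp only [zero_smul, add_zero, Nat.cast_ofNat, Nat.add_one_sub_one, pow_one, zero_sub]
    field_simp

theorem abs_qPartialDeriv_le (hρ : 0 < ρ) (hM : M ∈ cube n)
    (V : Matrix (Fin n) (Fin n) ℝ) (i j : Fin n) :
    |qPartialDeriv ρ M V i j| ≤ 2 * (l1Norm V / ρ ^ 2) := by
  have h1 := diag_nonneg hM i
  have h2 := offSum_nonneg hM i
  have h3 := diag_add_offSum M i
  have hb := rowSum_add_pos hρ hM i
  have hV : 0 ≤ ∑ z, |V i z| := Finset.sum_nonneg fun _ _ => abs_nonneg _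
  have key : ∀ p r : ℝ, |p| ≤ 2 * (∑ z, M i z + ρ) → |r| ≤ 2 * (∑ z, M i z + ρ) →
      |(p * V i i + r * offSum V i) / (∑ z, M i z + ρ) ^ 3| ≤ 2 * (l1Norm V / ρ ^ 2) := by
    intro p r hp hr
    have h := abs_mul_diag_add_mul_offSum_le hp hr V i
    rw [abs_div, abs_of_pos (pow_pos hb 3)]
    calc _ ≤ 2 * (∑ z, M i z + ρ) * (∑ z, |V i z|) / (∑ z, M i z + ρ) ^ 3 := by gcongr
      _ = 2 * ((∑ z, |V i z|) / (∑ z, M i z + ρ) ^ 2) := by field_simp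
      _ ≤ _ := by
        gcongr
        · exact l1Norm_nonneg V
        · exact row_le_l1Norm V i
        · linarith
  unfold qPartialDeriv
  split_ifs
  · convert key (2 * M i i - 2 * (∑ z, M i z + ρ)) (2 * M i i - (∑ z, M i z + ρ)) ?_ ?_ using 2
    · rw [← diag_add_offSum V]
      field_simp
      ring
    · rw [abs_le]; constructor <;> linarith
    · rw [abs_le]; constructor <;> linarith
  · convert key (2 * M i i - (∑ z, M i z + ρ)) (2 * M i i) ?_ ?_ using 2
    · rw [← diag_add_offSum V]
      field_simp
      ring
    · rw [abs_le]; constructor <;> linarith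
    · rw [abs_le]; constructor <;> linarith

/-- A coordinate of the component of `w` orthogonal to `v` is at most the `ℓ₁` norm of `w`. -/
theorem abs_sub_proj_le (v w : Fin n → ℝ) (hv : 0 < ∑ y, v y ^ 2) (i : Fin n) :
    |w i - v i * ((∑ y, v y * w y) / ∑ y, v y ^ 2)| ≤ ∑ y, |w y| := by
  set c := (∑ y, v y * w y) / ∑ y, v y ^ 2 with hc
  refine abs_le_of_sq_le_sq ?_ (Finset.sum_nonneg fun _ _ => abs_nonneg _)
  calc (w i - v i * c) ^ 2 ≤ ∑ y, (w y - v y * c) ^ 2 :=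
        Finset.single_le_sum (f := fun y => (w y - v y * c) ^ 2) (fun _ _ => sq_nonneg _)
          (Finset.mem_univ i)
    _ = ∑ y, w y ^ 2 - 2 * c * ∑ y, v y * w y + c ^ 2 * ∑ y, v y ^ 2 := by
        rw [Finset.mul_sum, Finset.mul_sum, ← Finset.sum_sub_distrib, ← Finset.sum_add_distrib]
        exact Finset.sum_congr rfl fun y _ => by ring
    _ = ∑ y, w y ^ 2 - (∑ y, v y * w y) ^ 2 / ∑ y, v y ^ 2 := by
        rw [hc]; field_simp; ring
    _ ≤ ∑ y, |w y| ^ 2 := by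
        simp only [sq_abs]
        have : 0 ≤ (∑ y, v y * w y) ^ 2 / ∑ y, v y ^ 2 := by positivity
        linarith
    _ ≤ (∑ y, |w y|) ^ 2 := Finset.sum_sq_le_sq_sum_of_nonneg fun _ _ => abs_nonneg _

/-- An entry of the gradient is `qRatio / quadMean` times a partial derivative of `qRatio`. Both
terms of the quotient rule for the first factor are treated together: they form a coordinate of the
derivative vector projected orthogonally to `qRatio`, divided by `quadMean`, so `abs_sub_proj_le`
applies. -/
theorem lipschitzL1On_qGrad [NeZero n] (hρ : ρ ∈ Set.Ioo (0 : ℝ) 1) (i j : Fin n) :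
    LipschitzL1On (2 / √(n : ℝ) * (1 / ρ ^ 2) * (1 + 1 / ρ)) (fun M => qGrad ρ M i j)
      (cube n) := by
  obtain ⟨hρ0, hρ1⟩ := hρ
  have hn : (0 : ℝ) < n := Nat.cast_pos.2 (NeZero.pos n)
  have hn1 : (1 : ℝ) ≤ n := by exact_mod_cast NeZero.pos n
  have hsn : 1 ≤ √(n : ℝ) := Real.one_le_sqrt.2 hn1
  refine lipschitzL1On_of_hasDerivAt (f' := fun M V =>
    1 / (n : ℝ) * (1 / quadMean (qRatio ρ M)) * (qRatioDeriv ρ M V i - qRatio ρ M i *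
      ((∑ y, qRatio ρ M y * qRatioDeriv ρ M V y) / ∑ y, qRatio ρ M y ^ 2)) * qPartial ρ M i j +
    1 / (n : ℝ) * (qRatio ρ M i / quadMean (qRatio ρ M)) * qPartialDeriv ρ M V i j) ?_ ?_
  · intro M hM V
    have hQ := quadMean_qRatio_pos hρ0 hM
    have hQ2 := sq_quadMean (qRatio ρ M)
    have h := (((hasDerivAt_qRatio hρ0 hM V i).fun_div (hasDerivAt_quadMean_qRatio hρ0 hM V)
      (by simpa using hQ.ne')).const_mul (1 / (n : ℝ))).fun_mul (hasDerivAt_qPartial hρ0 hM V i j)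
    simp only [qGrad_eq]
    refine h.congr_deriv ?_
    have hS : ∑ y, qRatio ρ M y ^ 2 = n * quadMean (qRatio ρ M) ^ 2 := by
      rw [hQ2]; field_simp
    rw [hS]
    simp only [zero_smul, add_zero]
    field_simp
  · intro M hM V
    have hQ := quadMean_qRatio_pos hρ0 hM
    have hq := qRatio_pos hρ0 hM i
    have hV := l1Norm_nonneg V
    have hQ' : 1 / quadMean (qRatio ρ M) ≤ 1 + 1 / ρ := by
      calc 1 / quadMean (qRatio ρ M) ≤ 1 / (ρ / (1 + ρ)) := by
            have := le_quadMean_qRatio hρ0 hM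
            gcongr
        _ = 1 + 1 / ρ := by field_simp; ring
    have hS : 0 < ∑ y, qRatio ρ M y ^ 2 := Finset.sum_pos
      (fun y _ => pow_pos (qRatio_pos hρ0 hM y) 2) ⟨i, Finset.mem_univ i⟩
    have hproj := (abs_sub_proj_le (qRatio ρ M) (qRatioDeriv ρ M V) hS i).trans
      (sum_abs_qRatioDeriv_le hρ0 hM V)
    have hp := abs_qPartial_le hρ0 hM i j
    have hp' := abs_qPartialDeriv_le hρ0 hM V i j
    have hr := qRatio_div_quadMean_le hρ0 hM i
    -- Needed for the summand in which the quotient was differentiated: there `1 / n` stands beside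
    -- `1 / quadMean`, without a factor `qRatio` to compare with.
    have hns : 1 / (n : ℝ) ≤ 1 / √(n : ℝ) := by
      have : √(n : ℝ) ≤ n := (Real.sqrt_le_left hn.le).2 (by nlinarith)
      gcongr
    refine (abs_add_le _ _).trans ?_
    rw [abs_mul, abs_mul, abs_mul _ (qPartialDeriv ρ M V i j),
      abs_of_nonneg (a := 1 / (n : ℝ) * (1 / _)) (by positivity),
      abs_of_nonneg (a := 1 / (n : ℝ) * (_ / _)) (by positivity)]
    -- Since `ρ < 1`, the total factor `1 + 1 / ρ + 2` is at most `2 * (1 + 1 / ρ)`.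
    have h1 : 1 ≤ 1 / ρ := (one_le_div hρ0).2 hρ1.le
    calc _ ≤ 1 / √(n : ℝ) * (1 + 1 / ρ) * (l1Norm V / ρ) * (1 / ρ) +
          1 / √(n : ℝ) * (2 * (l1Norm V / ρ ^ 2)) := by gcongr
      _ = 1 / √(n : ℝ) * (l1Norm V / ρ ^ 2) * (1 + 1 / ρ + 2) := by
          field_simp
      _ ≤ 1 / √(n : ℝ) * (l1Norm V / ρ ^ 2) * (2 * (1 + 1 / ρ)) := by
          gcongr
          linarith
      _ = _ := by ring

end

/-! ### Concavity and approximation for the Q-mean -/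

section

variable {X : Type*} [MeasurableSpace X] {ρ : ℝ}

/-- With fixed row sums the smoothed error rates are affine in the matrix, and `quadMean` is convex.
-/
theorem concaveOn_qMeanSmooth [NeZero n] (D : Measure (X × Fin n)) [IsProbabilityMeasure D]
    (ρ : ℝ) : ConcaveOn ℝ (feasible D) (qMeanSmooth ρ) := by
  refine ⟨convex_feasible D, fun M hM N hN a b ha hb hab => ?_⟩
  have hP := convex_feasible D hM hN ha hb hab
  have hcomb : qRatio ρ (a • M + b • N) = fun y => a * qRatio ρ M y + b * qRatio ρ N y := by
    funext y
    unfold qRatio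
    rw [rowSum_eq_prior hM, rowSum_eq_prior hN, rowSum_eq_prior hP, ← mul_div_assoc,
      ← mul_div_assoc, ← add_div]
    congr 1
    simp only [offSum, Matrix.add_apply, Matrix.smul_apply, smul_eq_mul,
      Finset.sum_add_distrib, ← Finset.mul_sum]
    linear_combination (-ρ) * hab
  have h := quadMean_convexComb_le (qRatio ρ M) (qRatio ρ N) ha hb
  rw [← hcomb] at h
  simp only [qMeanSmooth_eq, smul_eq_mul]
  linear_combination h + hab

theorem abs_qMean_sub_le [NeZero n] (D : Measure (X × Fin n)) [IsProbabilityMeasure D]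
    (hprior : ∀ y, 0 < prior D y) (hρ : 0 < ρ) {C : Matrix (Fin n) (Fin n) ℝ}
    (hC : C ∈ feasible D) : |qMean C - qMeanSmooth ρ C| ≤ 1 / priorMin D * ρ := by
  have hq := priorMin_pos hprior
  have hform : qMean C = 1 - quadMean (fun y => 1 - C y y / ∑ z, C y z) := rfl
  rw [hform, qMeanSmooth_eq, sub_sub_sub_cancel_left]
  refine abs_quadMean_sub_le _ _ (by positivity) fun y => ?_
  have hp := hprior y
  have hc := feasible_diag_nonneg hC y
  have hcp := diag_le_prior hC y
  have hpm := priorMin_le D y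
  have hs := diag_add_offSum C y
  rw [qRatio, rowSum_eq_prior hC]
  rw [rowSum_eq_prior hC] at hs
  have hbρ : prior D y + ρ ≠ 0 := by positivity
  have heq : (offSum C y + ρ) / (prior D y + ρ) - (1 - C y y / prior D y) =
      ρ * C y y / (prior D y * (prior D y + ρ)) := by
    rw [show offSum C y = prior D y - C y y by linarith]
    field_simp
    ring
  rw [heq, abs_of_nonneg (by positivity)]
  calc ρ * C y y / (prior D y * (prior D y + ρ))
      ≤ ρ * (prior D y + ρ) / (prior D y * (prior D y + ρ)) := by gcongr; linarith
    _ = 1 / prior D y * ρ := by field_simp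
    _ ≤ 1 / priorMin D * ρ := by gcongr

theorem isSmoothing_qMean [NeZero n] (D : Measure (X × Fin n)) [IsProbabilityMeasure D]
    (hprior : ∀ y, 0 < prior D y) :
    IsSmoothing D qMean qMeanSmooth (fun ρ => 1 / priorMin D * ρ)
      (fun ρ => 1 / √(n : ℝ) * (1 / ρ))
      (fun ρ => 2 / √(n : ℝ) * (1 / ρ ^ 2) * (1 + 1 / ρ)) := fun _ hρ =>
  ⟨concaveOn_qMeanSmooth D _,
    (hasGrad_qMeanSmooth hρ.1).lipschitzL1On fun _ hM => abs_qGrad_le hρ.1 hM,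
    (hasGrad_qMeanSmooth hρ.1).smoothL1On (lipschitzL1On_qGrad hρ),
    fun _ hC => abs_qMean_sub_le D hprior hρ.1 hC⟩

end

end BayesCG

end

/-! ### G-mean: logarithmic derivatives, concavity by AM–GM, approximation. -/

noncomputable section

namespace BayesCG

variable {n : ℕ}

/-! ### The G-mean -/

/-- The gradient of the smoothed G-mean. -/
def gGrad (ρ : ℝ) (M : Matrix (Fin n) (Fin n) ℝ) : Matrix (Fin n) (Fin n) ℝ :=
  fun i j => (if i = j then 1 / (n : ℝ) * gMeanSmooth ρ M * (1 / (M i i + ρ)) else 0) -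
    1 / (n : ℝ) * gMeanSmooth ρ M * (1 / (∑ z, M i z + ρ))

/-- The partial derivatives of the logarithm of the smoothed recall of a class. -/
def gLogPartial (ρ : ℝ) (M : Matrix (Fin n) (Fin n) ℝ) (i j : Fin n) : ℝ :=
  (if i = j then 1 / (M i i + ρ) else 0) - 1 / (∑ z, M i z + ρ)

/-- The directional derivative of `gLogPartial`. -/
def gLogPartialDeriv (ρ : ℝ) (M V : Matrix (Fin n) (Fin n) ℝ) (i j : Fin n) : ℝ :=
  (if i = j then -V i i / (M i i + ρ) ^ 2 else 0) + (∑ z, V i z) / (∑ z, M i z + ρ) ^ 2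

/-- The directional derivative of the sum of the logarithms of the smoothed recalls. -/
def gLogDeriv (ρ : ℝ) (M V : Matrix (Fin n) (Fin n) ℝ) : ℝ :=
  ∑ y, (V y y / (M y y + ρ) - (∑ z, V y z) / (∑ z, M y z + ρ))

theorem gGrad_eq (ρ : ℝ) (M : Matrix (Fin n) (Fin n) ℝ) (i j : Fin n) :
    gGrad ρ M i j = 1 / (n : ℝ) * (gMeanSmooth ρ M * gLogPartial ρ M i j) := by
  unfold gGrad gLogPartial
  split_ifs <;> ring

section

variable {ρ : ℝ} {M : Matrix (Fin n) (Fin n) ℝ}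

theorem diag_add_pos (hρ : 0 < ρ) (hM : M ∈ cube n) (y : Fin n) : 0 < M y y + ρ := by
  have := diag_nonneg hM y
  positivity

theorem diag_le_rowSum (hM : M ∈ cube n) (y : Fin n) : M y y ≤ ∑ z, M y z := by
  have := diag_add_offSum M y
  have := offSum_nonneg hM y
  linarith

/-- Positivity is assumed in place of membership in the cube, because the formula is also needed at
nearby points outside it. -/
theorem gMeanSmooth_eq_exp (hd : ∀ y, 0 < M y y + ρ) (hr : ∀ y, 0 < ∑ z, M y z + ρ) :
    gMeanSmooth ρ M = Real.exp (1 / (n : ℝ) *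
      ∑ y, (Real.log (M y y + ρ) - Real.log (∑ z, M y z + ρ))) := by
  unfold gMeanSmooth
  have hpos : ∀ y, 0 < (M y y + ρ) / (∑ z, M y z + ρ) := fun y => div_pos (hd y) (hr y)
  rw [Real.rpow_def_of_pos (Finset.prod_pos fun y _ => hpos y), mul_comm,
    Real.log_prod fun y _ => (hpos y).ne']
  simp_rw [Real.log_div (hd _).ne' (hr _).ne']

theorem gMeanSmooth_pos (hρ : 0 < ρ) (hM : M ∈ cube n) : 0 < gMeanSmooth ρ M := by
  rw [gMeanSmooth_eq_exp (diag_add_pos hρ hM) (rowSum_add_pos hρ hM)]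
  exact Real.exp_pos _

theorem gMeanSmooth_le_one (hρ : 0 < ρ) (hM : M ∈ cube n) : gMeanSmooth ρ M ≤ 1 := by
  have h0 : ∀ y, 0 ≤ (M y y + ρ) / (∑ z, M y z + ρ) := fun y =>
    (div_pos (diag_add_pos hρ hM y) (rowSum_add_pos hρ hM y)).le
  refine Real.rpow_le_one (Finset.prod_nonneg fun y _ => h0 y)
    (Finset.prod_le_one (fun y _ => h0 y) fun y _ => ?_) (by positivity)
  rw [div_le_one (rowSum_add_pos hρ hM y)]
  have := diag_le_rowSum hM y
  linarith

theorem hasDerivAt_gMeanSmooth (hρ : 0 < ρ) (hM : M ∈ cube n)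
    (V : Matrix (Fin n) (Fin n) ℝ) :
    HasDerivAt (fun t : ℝ => gMeanSmooth ρ (M + t • V))
      (gMeanSmooth ρ M * (1 / (n : ℝ) * gLogDeriv ρ M V)) 0 := by
  have h1 : ∀ y, HasDerivAt (fun t : ℝ => (M + t • V) y y + ρ) (V y y) 0 := fun y =>
    (hasDerivAt_entry M V y y).add_const ρ
  have h2 : ∀ y, HasDerivAt (fun t : ℝ => ∑ z, (M + t • V) y z + ρ) (∑ z, V y z) 0 := fun y =>
    (hasDerivAt_rowSum M V y).add_const ρ
  have hd0 := diag_add_pos hρ hM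
  have hr0 := rowSum_add_pos hρ hM
  have hlog := ((HasDerivAt.fun_sum (u := Finset.univ) fun y _ =>
    ((h1 y).log (by simpa using (hd0 y).ne')).fun_sub
      ((h2 y).log (by simpa using (hr0 y).ne'))).const_mul (1 / (n : ℝ))).exp
  -- The line through a boundary point may leave the cube, but positivity of the finitely many
  -- denominators and numerators is an open condition.
  have hev : ∀ᶠ t : ℝ in 𝓝 0, (∀ y, 0 < (M + t • V) y y + ρ) ∧
      ∀ y, 0 < ∑ z, (M + t • V) y z + ρ := by
    rw [eventually_and, eventually_all, eventually_all]
    exact ⟨fun y => (h1 y).continuousAt.eventually_const_lt (by simpa using hd0 y),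
      fun y => (h2 y).continuousAt.eventually_const_lt (by simpa using hr0 y)⟩
  refine (hlog.congr_of_eventuallyEq ?_).congr_deriv ?_
  · filter_upwards [hev] with t ht
    exact gMeanSmooth_eq_exp ht.1 ht.2
  · rw [gMeanSmooth_eq_exp hd0 hr0, gLogDeriv]
    simp only [zero_smul, add_zero]

theorem hasGrad_gMeanSmooth (hρ : 0 < ρ) : HasGrad (gMeanSmooth (n := n) ρ) (gGrad ρ) := by
  intro M hM V
  refine (hasDerivAt_gMeanSmooth hρ hM V).congr_deriv ?_
  unfold gGrad
  rw [frob_diag_sub, gLogDeriv, Finset.mul_sum, Finset.mul_sum]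
  exact Finset.sum_congr rfl fun y _ => by ring

theorem abs_gLogPartial_le (hρ : 0 < ρ) (hM : M ∈ cube n) (i j : Fin n) :
    |gLogPartial ρ M i j| ≤ 1 / ρ := by
  have h1 := diag_nonneg hM i
  have h2 := diag_le_rowSum hM i
  have hd := diag_add_pos hρ hM i
  have hr := rowSum_add_pos hρ hM i
  have h4 : 1 / (∑ z, M i z + ρ) ≤ 1 / (M i i + ρ) := by gcongr
  have h5 : 1 / (M i i + ρ) ≤ 1 / ρ := by gcongr; linarith
  have h6 : 0 < 1 / (∑ z, M i z + ρ) := by positivity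
  unfold gLogPartial
  split_ifs
  · rw [abs_of_nonneg] <;> linarith
  · rw [zero_sub, abs_neg, abs_of_pos h6]; linarith

/-- The smoothed G-mean is at most one, so only its logarithmic derivative counts. This is sharper
than the stated Lipschitz constant, whose further factor is at least one. -/
theorem abs_gGrad_le (hρ : 0 < ρ) (hM : M ∈ cube n) (i j : Fin n) :
    |gGrad ρ M i j| ≤ 1 / (n : ℝ) * (1 / ρ) := by
  rw [gGrad_eq, abs_mul, abs_mul, abs_of_pos (gMeanSmooth_pos hρ hM),
    abs_of_nonneg (by positivity)]
  have h1 := abs_gLogPartial_le hρ hM i j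
  have h2 := gMeanSmooth_le_one hρ hM
  calc 1 / (n : ℝ) * (gMeanSmooth ρ M * |gLogPartial ρ M i j|)
      ≤ 1 / (n : ℝ) * (1 * (1 / ρ)) := by gcongr
    _ = _ := by rw [one_mul]

theorem hasDerivAt_gLogPartial (hρ : 0 < ρ) (hM : M ∈ cube n)
    (V : Matrix (Fin n) (Fin n) ℝ) (i j : Fin n) :
    HasDerivAt (fun t : ℝ => gLogPartial ρ (M + t • V) i j) (gLogPartialDeriv ρ M V i j) 0 := by
  have hd := (diag_add_pos hρ hM i).ne'
  have hr := (rowSum_add_pos hρ hM i).ne'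
  have h1 := (hasDerivAt_const (0 : ℝ) (1 : ℝ)).fun_div
    ((hasDerivAt_entry M V i i).add_const ρ) (by simpa using hd)
  have h2 := (hasDerivAt_const (0 : ℝ) (1 : ℝ)).fun_div
    ((hasDerivAt_rowSum M V i).add_const ρ) (by simpa using hr)
  unfold gLogPartial gLogPartialDeriv
  by_cases hij : i = j
  · simp only [if_pos hij]
    refine (h1.fun_sub h2).congr_deriv ?_
    simp only [zero_smul, add_zero]
    ring
  · simp only [if_neg hij]
    refine (h2.const_sub 0).congr_deriv ?_
    simp only [zero_smul, add_zero]
    ring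

theorem abs_gLogPartialDeriv_le (hρ : 0 < ρ) (hM : M ∈ cube n)
    (V : Matrix (Fin n) (Fin n) ℝ) (i j : Fin n) :
    |gLogPartialDeriv ρ M V i j| ≤ l1Norm V / ρ ^ 2 := by
  have h1 := diag_nonneg hM i
  have h2 := diag_le_rowSum hM i
  have hd := diag_add_pos hρ hM i
  have hr := rowSum_add_pos hρ hM i
  have h4 : 1 / (∑ z, M i z + ρ) ^ 2 ≤ 1 / (M i i + ρ) ^ 2 := by gcongr
  have h5 : 1 / (M i i + ρ) ^ 2 ≤ 1 / ρ ^ 2 := by gcongr; linarith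
  have h6 : 0 < 1 / (∑ z, M i z + ρ) ^ 2 := by positivity
  have key : ∀ p : ℝ, |p| ≤ 1 / ρ ^ 2 →
      |p * V i i + 1 / (∑ z, M i z + ρ) ^ 2 * offSum V i| ≤ l1Norm V / ρ ^ 2 := by
    intro p hp
    have h := abs_mul_diag_add_mul_offSum_le hp
      (show |1 / (∑ z, M i z + ρ) ^ 2| ≤ 1 / ρ ^ 2 by rw [abs_of_pos h6]; linarith) V i
    refine h.trans ?_
    rw [one_div_mul_eq_div]
    gcongr
    exact row_le_l1Norm V i
  unfold gLogPartialDeriv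
  split_ifs
  · convert key (1 / (∑ z, M i z + ρ) ^ 2 - 1 / (M i i + ρ) ^ 2) ?_ using 2
    · rw [← diag_add_offSum V]
      ring
    · rw [abs_le]; constructor <;> linarith
  · convert key (1 / (∑ z, M i z + ρ) ^ 2) ?_ using 2
    · rw [← diag_add_offSum V]
      ring
    · rw [abs_of_pos h6]; linarith

theorem abs_gLogDeriv_le (hρ : 0 < ρ) (hM : M ∈ cube n) (V : Matrix (Fin n) (Fin n) ℝ) :
    |gLogDeriv ρ M V| ≤ l1Norm V / ρ := by
  have h : gLogDeriv ρ M V = frob (gLogPartial ρ M) V := by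
    unfold gLogPartial
    rw [frob_diag_sub]
    exact Finset.sum_congr rfl fun y _ => by ring
  rw [h]
  exact (abs_frob_le (abs_gLogPartial_le hρ hM) V).trans_eq (by ring)

/-- Each entry is `1 / n` times the metric times a logarithmic partial derivative. Both terms of the
product rule are at most `l1Norm V / ρ ^ 2`, whence the factor two. -/
theorem lipschitzL1On_gGrad [NeZero n] (hρ : 0 < ρ) (i j : Fin n) :
    LipschitzL1On (2 / (n * ρ ^ 2)) (fun M => gGrad ρ M i j) (cube n) := by
  have hn : (0 : ℝ) < n := Nat.cast_pos.2 (NeZero.pos n)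
  have hn1 : (1 : ℝ) ≤ n := by exact_mod_cast NeZero.pos n
  refine lipschitzL1On_of_hasDerivAt (f' := fun M V =>
    1 / (n : ℝ) * (gMeanSmooth ρ M * (1 / (n : ℝ) * gLogDeriv ρ M V) * gLogPartial ρ M i j +
      gMeanSmooth ρ M * gLogPartialDeriv ρ M V i j)) ?_ ?_
  · intro M hM V
    have h := ((hasDerivAt_gMeanSmooth hρ hM V).fun_mul
      (hasDerivAt_gLogPartial hρ hM V i j)).const_mul (1 / (n : ℝ))
    simp only [gGrad_eq]
    refine h.congr_deriv ?_
    simp only [zero_smul, add_zero]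
  · intro M hM V
    have h0 := gMeanSmooth_pos hρ hM
    have h1 := gMeanSmooth_le_one hρ hM
    have h2 := abs_gLogDeriv_le hρ hM V
    have h3 := abs_gLogPartial_le hρ hM i j
    have h4 := abs_gLogPartialDeriv_le hρ hM V i j
    have hV := l1Norm_nonneg V
    have h5 : 1 / (n : ℝ) ≤ 1 := (div_le_one hn).2 hn1
    rw [abs_mul, abs_of_nonneg (a := 1 / (n : ℝ)) (by positivity)]
    have h6 := abs_add_le (gMeanSmooth ρ M * (1 / (n : ℝ) * gLogDeriv ρ M V) *
      gLogPartial ρ M i j) (gMeanSmooth ρ M * gLogPartialDeriv ρ M V i j)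
    rw [abs_mul, abs_mul, abs_mul, abs_mul, abs_of_pos h0,
      abs_of_nonneg (a := 1 / (n : ℝ)) (by positivity)] at h6
    calc _ ≤ 1 / (n : ℝ) * (1 * (1 * (l1Norm V / ρ)) * (1 / ρ) + 1 * (l1Norm V / ρ ^ 2)) := by
          refine mul_le_mul_of_nonneg_left (h6.trans ?_) (by positivity)
          gcongr
      _ = _ := by field_simp; ring

end

/-! ### Concavity and approximation for the G-mean -/

section

variable {X : Type*} [MeasurableSpace X] {ρ : ℝ}

/-- The inequality of the arithmetic and the geometric mean. -/
theorem geomMean_le_arithMean [NeZero n] {x : Fin n → ℝ} (hx : ∀ y, 0 ≤ x y) :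
    (∏ y, x y) ^ (1 / (n : ℝ)) ≤ 1 / (n : ℝ) * ∑ y, x y := by
  have hn : (n : ℝ) ≠ 0 := Nat.cast_ne_zero.2 (NeZero.ne n)
  have h := Real.geom_mean_le_arith_mean_weighted Finset.univ (fun _ : Fin n => 1 / (n : ℝ)) x
    (fun _ _ => by positivity) (by simp [hn]) fun y _ => hx y
  rwa [Real.finsetProd_rpow _ _ fun y _ => hx y, ← Finset.mul_sum] at h

/-- The geometric mean is concave. -/
theorem concave_geomMean [NeZero n] {x y z : Fin n → ℝ} {a b : ℝ}
    (hx : ∀ i, 0 ≤ x i) (hy : ∀ i, 0 ≤ y i) (ha : 0 ≤ a) (hb : 0 ≤ b)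
    (hz : ∀ i, z i = a * x i + b * y i) (hz0 : ∀ i, 0 < z i) :
    a * (∏ i, x i) ^ (1 / (n : ℝ)) + b * (∏ i, y i) ^ (1 / (n : ℝ)) ≤
      (∏ i, z i) ^ (1 / (n : ℝ)) := by
  have hn : (n : ℝ) ≠ 0 := Nat.cast_ne_zero.2 (NeZero.ne n)
  have hzp : 0 < ∏ i, z i := Finset.prod_pos fun i _ => hz0 i
  -- AM–GM applied to the ratios `u i / z i`: again the tangent at `z`, as a linear upper bound.
  have key : ∀ u : Fin n → ℝ, (∀ i, 0 ≤ u i) → (∏ i, u i) ^ (1 / (n : ℝ)) ≤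
      (∏ i, z i) ^ (1 / (n : ℝ)) * (1 / (n : ℝ) * ∑ i, u i / z i) := by
    intro u hu
    have h := geomMean_le_arithMean fun i => div_nonneg (hu i) (hz0 i).le
    rw [Finset.prod_div_distrib, Real.div_rpow (Finset.prod_nonneg fun i _ => hu i) hzp.le,
      div_le_iff₀ (Real.rpow_pos_of_pos hzp _)] at h
    rwa [mul_comm]
  calc _ ≤ a * ((∏ i, z i) ^ (1 / (n : ℝ)) * (1 / (n : ℝ) * ∑ i, x i / z i)) +
        b * ((∏ i, z i) ^ (1 / (n : ℝ)) * (1 / (n : ℝ) * ∑ i, y i / z i)) := by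
        gcongr
        · exact key x hx
        · exact key y hy
    _ = (∏ i, z i) ^ (1 / (n : ℝ)) * (1 / (n : ℝ) *
        (a * ∑ i, x i / z i + b * ∑ i, y i / z i)) := by ring
    _ = (∏ i, z i) ^ (1 / (n : ℝ)) := by
        have : a * ∑ i, x i / z i + b * ∑ i, y i / z i = n := by
          rw [Finset.mul_sum, Finset.mul_sum, ← Finset.sum_add_distrib]
          calc ∑ i, (a * (x i / z i) + b * (y i / z i)) = ∑ _i : Fin n, (1 : ℝ) := by
                refine Finset.sum_congr rfl fun i _ => ?_
                rw [← mul_div_assoc, ← mul_div_assoc, ← add_div, ← hz, div_self (hz0 i).ne']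
            _ = n := by simp
        rw [this, one_div_mul_cancel hn, mul_one]

theorem concaveOn_gMeanSmooth [NeZero n] (D : Measure (X × Fin n)) [IsProbabilityMeasure D]
    (hρ : 0 < ρ) : ConcaveOn ℝ (feasible D) (gMeanSmooth ρ) := by
  refine ⟨convex_feasible D, fun M hM N hN a b ha hb hab => ?_⟩
  have hP := convex_feasible D hM hN ha hb hab
  have hpos : ∀ C ∈ feasible D, ∀ y, 0 < (C y y + ρ) / (∑ z, C y z + ρ) := fun C hC y =>
    div_pos (diag_add_pos hρ (feasible_subset_cube D hC) y)
      (rowSum_add_pos hρ (feasible_subset_cube D hC) y)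
  refine concave_geomMean (fun y => (hpos M hM y).le) (fun y => (hpos N hN y).le) ha hb
    (fun y => ?_) (hpos _ hP)
  rw [rowSum_eq_prior hM, rowSum_eq_prior hN, rowSum_eq_prior hP, ← mul_div_assoc,
    ← mul_div_assoc, ← add_div]
  congr 1
  simp only [Matrix.add_apply, Matrix.smul_apply, smul_eq_mul]
  linear_combination (-ρ) * hab

/-- Products of numbers in `[0, 1]` that differ by at most `δ`. -/
theorem prod_sub_prod_le {x y : Fin n → ℝ} {δ : ℝ} (hx : ∀ i, 0 ≤ x i) (hxy : ∀ i, x i ≤ y i)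
    (hy : ∀ i, y i ≤ 1) (hδ : ∀ i, y i - x i ≤ δ) (s : Finset (Fin n)) :
    ∏ i ∈ s, y i - ∏ i ∈ s, x i ≤ s.card * δ := by
  classical
  induction s using Finset.induction_on with
  | empty => simp
  | insert i s his ih =>
    rw [Finset.prod_insert his, Finset.prod_insert his, Finset.card_insert_of_notMem his]
    have h1 : ∏ i ∈ s, x i ≤ 1 := Finset.prod_le_one (fun i _ => hx i)
      fun i _ => (hxy i).trans (hy i)
    have h2 : 0 ≤ ∏ i ∈ s, x i := Finset.prod_nonneg fun i _ => hx i
    have h3 : ∏ i ∈ s, x i ≤ ∏ i ∈ s, y i := Finset.prod_le_prod (fun i _ => hx i)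
      fun i _ => hxy i
    have h4 := hx i
    have h5 := hxy i
    have h6 := hy i
    have h7 := hδ i
    push_cast
    -- Telescoping: the difference of products is `y i` times the difference of the remaining
    -- products plus `(y i - x i)` times the remaining product of the `x`.
    nlinarith [mul_le_mul_of_nonneg_right h6 (sub_nonneg.2 h3),
      mul_le_mul_of_nonneg_left h1 (sub_nonneg.2 h5)]

/-- The products of recalls differ by at most `n * (ρ / priorMin D)`, the power `1 / n` is
subadditive, and `n ^ (1 / n)` is at most two because `n ≤ 2 ^ n`. -/
theorem abs_gMean_sub_le [NeZero n] (D : Measure (X × Fin n)) [IsProbabilityMeasure D]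
    (hprior : ∀ y, 0 < prior D y) (hρ : 0 < ρ) {C : Matrix (Fin n) (Fin n) ℝ}
    (hC : C ∈ feasible D) :
    |gMean C - gMeanSmooth ρ C| ≤ 2 * (ρ / priorMin D) ^ (1 / (n : ℝ)) := by
  have hq := priorMin_pos hprior
  have hn : (n : ℝ) ≠ 0 := Nat.cast_ne_zero.2 (NeZero.ne n)
  have hn1 : 1 / (n : ℝ) ≤ 1 := by
    rw [div_le_one (Nat.cast_pos.2 (NeZero.pos n))]
    exact_mod_cast NeZero.pos n
  have hn0 : 0 ≤ 1 / (n : ℝ) := by positivity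
  simp only [gMean, gMeanSmooth, rowSum_eq_prior hC]
  set t : Fin n → ℝ := fun y => C y y / prior D y with ht
  set t' : Fin n → ℝ := fun y => (C y y + ρ) / (prior D y + ρ) with ht'
  have hc := feasible_diag_nonneg hC
  have ht0 : ∀ y, 0 ≤ t y := fun y => div_nonneg (hc y) (hprior y).le
  have htt' : ∀ y, t y ≤ t' y := fun y =>
    sub_nonneg.1 (smoothRatio_sub_nonneg (hprior y) hρ (diag_le_prior hC y))
  have ht'1 : ∀ y, t' y ≤ 1 := fun y => by
    have := hprior y
    have := diag_le_prior hC y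
    rw [ht', div_le_one (by linarith)]
    linarith
  have hd : ∀ y, t' y - t y ≤ ρ / priorMin D := fun y =>
    smoothRatio_sub_le hq (priorMin_le D y) hρ (hc y)
  have hP0 : 0 ≤ ∏ y, t y := Finset.prod_nonneg fun y _ => ht0 y
  have hPP : ∏ y, t y ≤ ∏ y, t' y := Finset.prod_le_prod (fun y _ => ht0 y) fun y _ => htt' y
  have hsub := prod_sub_prod_le ht0 htt' ht'1 hd Finset.univ
  rw [Finset.card_univ, Fintype.card_fin] at hsub
  have hmono : (∏ y, t y) ^ (1 / (n : ℝ)) ≤ (∏ y, t' y) ^ (1 / (n : ℝ)) :=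
    Real.rpow_le_rpow hP0 hPP hn0
  have hadd : (∏ y, t' y) ^ (1 / (n : ℝ)) ≤
      (∏ y, t y) ^ (1 / (n : ℝ)) + (n * (ρ / priorMin D)) ^ (1 / (n : ℝ)) := by
    calc (∏ y, t' y) ^ (1 / (n : ℝ)) ≤ (∏ y, t y + n * (ρ / priorMin D)) ^ (1 / (n : ℝ)) :=
          Real.rpow_le_rpow (hP0.trans hPP) (by linarith) hn0
      _ ≤ _ := Real.rpow_add_le_add_rpow hP0 (by positivity) hn0 hn1
  have htwo : (n * (ρ / priorMin D)) ^ (1 / (n : ℝ)) ≤ 2 * (ρ / priorMin D) ^ (1 / (n : ℝ)) := by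
    rw [Real.mul_rpow (Nat.cast_nonneg n) (by positivity)]
    gcongr
    calc (n : ℝ) ^ (1 / (n : ℝ)) ≤ ((2 : ℝ) ^ n) ^ (1 / (n : ℝ)) := by
          gcongr
          exact_mod_cast Nat.lt_two_pow_self.le
      _ = 2 := by
          rw [one_div]
          exact Real.pow_rpow_inv_natCast (by norm_num) (NeZero.ne n)
  rw [abs_sub_comm, abs_of_nonneg (sub_nonneg.2 hmono)]
  linarith

theorem isSmoothing_gMean [NeZero n] (D : Measure (X × Fin n)) [IsProbabilityMeasure D]
    (hprior : ∀ y, 0 < prior D y) :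
    IsSmoothing D gMean gMeanSmooth (fun ρ => 2 * (ρ / priorMin D) ^ (1 / (n : ℝ)))
      (fun ρ => 1 / (n : ℝ) * (1 / ρ) * (1 + 1 / ρ) ^ (1 - 1 / (n : ℝ)))
      (fun ρ => 2 / (n * ρ ^ 2)) := fun ρ hρ => by
  refine ⟨concaveOn_gMeanSmooth D hρ.1, (hasGrad_gMeanSmooth hρ.1).lipschitzL1On
    fun M hM i j => (abs_gGrad_le hρ.1 hM i j).trans ?_,
    (hasGrad_gMeanSmooth hρ.1).smoothL1On (lipschitzL1On_gGrad hρ.1),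
    fun C hC => abs_gMean_sub_le D hprior hρ.1 hC⟩
  have hρ0 := hρ.1
  have hn1 : 1 / (n : ℝ) ≤ 1 := by
    rw [div_le_one (Nat.cast_pos.2 (NeZero.pos n))]
    exact_mod_cast NeZero.pos n
  have h1 : (1 : ℝ) ≤ 1 + 1 / ρ := by
    have : 0 ≤ 1 / ρ := by positivity
    linarith
  exact le_mul_of_one_le_right (by positivity) (Real.one_le_rpow h1 (by linarith))

end

end BayesCG

end

/-! ### Plug-in classifiers and the conditional gradient method with inexact gradients. -/

noncomputable section

namespace BayesCG

variable {n : ℕ}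

/-! ### Plug-in classifiers -/

theorem exists_isLastArgmax [NeZero n] (v : Fin n → ℝ) : ∃ i, IsLastArgmax v i := by
  classical
  obtain ⟨k, -, hk⟩ := Finset.exists_max_image Finset.univ v ⟨0, Finset.mem_univ 0⟩
  set s : Finset (Fin n) := Finset.univ.filter fun i => v i = v k with hs
  have hne : s.Nonempty := ⟨k, by simp [hs]⟩
  have hmem : v (s.max' hne) = v k := by simpa [hs] using s.max'_mem hne
  refine ⟨s.max' hne, fun y => hmem ▸ hk y (Finset.mem_univ y), fun y hy => ?_⟩
  rw [hmem]
  refine (hk y (Finset.mem_univ y)).lt_of_ne fun h => ?_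
  exact absurd (s.le_max' y (by simp [hs, h])) (not_le.2 hy)

theorem IsLastArgmax.eq {v : Fin n → ℝ} {i k : Fin n} (hi : IsLastArgmax v i)
    (hk : IsLastArgmax v k) : i = k := by
  rcases lt_trichotomy i k with h | h | h
  · exact absurd (hi.2 k h) (not_lt.2 (hk.1 i))
  · exact h
  · exact absurd (hk.2 i h) (not_lt.2 (hi.1 k))

theorem plugIn_eq_single {W : Type*} {G : Matrix (Fin n) (Fin n) ℝ} {η : W → Fin n → ℝ} {x : W}
    {i : Fin n} (hi : IsLastArgmax (fun y => ∑ k, G k y * η x k) i) :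
    plugIn G η x = Pi.single i 1 := by
  funext j
  unfold plugIn
  by_cases h : j = i
  · subst h
    rw [if_pos hi, Pi.single_eq_same]
  · rw [if_neg fun hj => h (hj.eq hi), Pi.single_eq_of_ne h]

theorem measurableSet_isLastArgmax {W : Type*} [MeasurableSpace W] {v : W → Fin n → ℝ}
    (hv : ∀ y, Measurable fun x => v x y) (i : Fin n) :
    MeasurableSet {x | IsLastArgmax (v x) i} := by
  have : {x | IsLastArgmax (v x) i} =
      (⋂ y, {x | v x y ≤ v x i}) ∩ ⋂ y, {x | i < y → v x y < v x i} := by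
    ext x
    simp [IsLastArgmax]
  rw [this]
  refine (MeasurableSet.iInter fun y => measurableSet_le (hv y) (hv i)).inter
    (MeasurableSet.iInter fun y => ?_)
  by_cases h : i < y
  · simpa [h] using measurableSet_lt (hv y) (hv i)
  · simp [h]

theorem measurable_plugIn {W : Type*} [MeasurableSpace W] (G : Matrix (Fin n) (Fin n) ℝ)
    {η : W → Fin n → ℝ} (hη : Measurable η) : Measurable (plugIn G η) := by
  refine measurable_pi_iff.2 fun i => ?_
  refine Measurable.ite (measurableSet_isLastArgmax (fun y => ?_) i) measurable_const
    measurable_const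
  exact Finset.measurable_sum _ fun k _ => ((measurable_pi_apply k).comp hη).const_mul _

theorem plugIn_mem_stdSimplex [NeZero n] {W : Type*} (G : Matrix (Fin n) (Fin n) ℝ)
    (η : W → Fin n → ℝ) (x : W) : plugIn G η x ∈ stdSimplex ℝ (Fin n) := by
  obtain ⟨i, hi⟩ := exists_isLastArgmax fun y => ∑ k, G k y * η x k
  rw [plugIn_eq_single hi]
  exact single_mem_stdSimplex ℝ i

theorem isClassifier_plugIn [NeZero n] {X : Type*} [MeasurableSpace X]
    (G : Matrix (Fin n) (Fin n) ℝ) {η : X → Fin n → ℝ} (hη : Measurable η) :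
    IsClassifier (plugIn G η) := ⟨measurable_plugIn G hη, plugIn_mem_stdSimplex G η⟩

/-- The plug-in classifier maximizes the gain that the model predicts. -/
theorem sum_mul_le_plugIn [NeZero n] {W : Type*} (G : Matrix (Fin n) (Fin n) ℝ)
    (η : W → Fin n → ℝ) (x : W) {p : Fin n → ℝ} (hp : p ∈ stdSimplex ℝ (Fin n)) :
    ∑ j, p j * ∑ i, G i j * η x i ≤ ∑ j, plugIn G η x j * ∑ i, G i j * η x i := by
  obtain ⟨k, hk⟩ := exists_isLastArgmax fun y => ∑ i, G i y * η x i
  rw [plugIn_eq_single hk]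
  simp only [Pi.single_apply, ite_mul, one_mul, zero_mul, Finset.sum_ite_eq', Finset.mem_univ,
    if_true]
  calc ∑ j, p j * ∑ i, G i j * η x i ≤ ∑ j, p j * ∑ i, G i k * η x i :=
        Finset.sum_le_sum fun j _ => mul_le_mul_of_nonneg_left (hk.1 j) (hp.1 j)
    _ = ∑ i, G i k * η x i := by rw [← Finset.sum_mul, hp.2, one_mul]

/-! ### The linear maximization step -/

theorem IsClassifier.integrable_mul {X : Type*} [MeasurableSpace X] {h u : X → Fin n → ℝ} (hh : IsClassifier h)
    (hu : IsClassifier u) (μ : Measure X) [IsFiniteMeasure μ] (i j : Fin n) :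
    Integrable (fun x => h x j * u x i) μ := by
  refine Integrable.of_bound ((hh.measurable_apply j).mul
    (hu.measurable_apply i)).aestronglyMeasurable 1 (Eventually.of_forall fun x => ?_)
  rw [Real.norm_of_nonneg (mul_nonneg (hh.nonneg x j) (hu.nonneg x i))]
  exact mul_le_one₀ (hh.le_one x j) (hu.nonneg x i) (hu.le_one x i)

theorem abs_gain_le {p : Fin n → ℝ} (hp : p ∈ stdSimplex ℝ (Fin n))
    {G : Matrix (Fin n) (Fin n) ℝ} {B : ℝ} (hG : ∀ i j, |G i j| ≤ B) (w : Fin n → ℝ) :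
    |∑ j, p j * ∑ i, G i j * w i| ≤ B * ∑ i, |w i| := by
  calc |∑ j, p j * ∑ i, G i j * w i| ≤ ∑ j, p j * (B * ∑ i, |w i|) := by
        refine (Finset.abs_sum_le_sum_abs _ _).trans (Finset.sum_le_sum fun j _ => ?_)
        rw [abs_mul, abs_of_nonneg (hp.1 j), Finset.mul_sum]
        refine mul_le_mul_of_nonneg_left ?_ (hp.1 j)
        refine (Finset.abs_sum_le_sum_abs _ _).trans (Finset.sum_le_sum fun i _ => ?_)
        rw [abs_mul]
        exact mul_le_mul_of_nonneg_right (hG i j) (abs_nonneg _)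
    _ = B * ∑ i, |w i| := by rw [← Finset.sum_mul, hp.2, one_mul]

section LinearMax

variable {X : Type*} [MeasurableSpace X] [NeZero n]

theorem measurable_condProb (D : Measure (X × Fin n)) [IsFiniteMeasure D] (y : Fin n) :
    Measurable fun x => condProb D x y :=
  (D.condKernel.measurable_coe (measurableSet_singleton y)).ennreal_toReal

theorem condProb_mem_stdSimplex (D : Measure (X × Fin n)) [IsFiniteMeasure D] (x : X) :
    condProb D x ∈ stdSimplex ℝ (Fin n) := by
  refine ⟨fun y => measureReal_nonneg, ?_⟩
  unfold condProb
  rw [sum_measureReal_singleton]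
  simp

theorem isClassifier_condProb (D : Measure (X × Fin n)) [IsFiniteMeasure D] :
    IsClassifier (condProb D) :=
  ⟨measurable_pi_iff.2 (measurable_condProb D), condProb_mem_stdSimplex D⟩

theorem conf_eq_integral_condProb {h : X → Fin n → ℝ} (hh : IsClassifier h)
    (D : Measure (X × Fin n)) [IsFiniteMeasure D] (i j : Fin n) :
    conf D h i j = ∫ x, h x j * condProb D x i ∂D.fst := by
  rw [conf, ← Measure.integral_condKernel (hh.integrable_confIntegrand D i j)]
  refine integral_congr_ae (Eventually.of_forall fun x => ?_)
  simp only [integral_const_mul]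
  congr 1
  rw [condProb, ← integral_indicator_one (measurableSet_singleton i)]
  exact integral_congr_ae (Eventually.of_forall fun y => by simp [Set.indicator])

theorem integrable_gain {h : X → Fin n → ℝ} (hh : IsClassifier h)
    (D : Measure (X × Fin n)) [IsFiniteMeasure D] (G : Matrix (Fin n) (Fin n) ℝ) :
    Integrable (fun x => ∑ j, h x j * ∑ i, G i j * condProb D x i) D.fst := by
  refine integrable_finsetSum _ fun j _ => ?_
  simp_rw [Finset.mul_sum]
  refine integrable_finsetSum _ fun i _ => ?_
  refine ((hh.integrable_mul (isClassifier_condProb D) D.fst i j).const_mul (G i j)).congr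
    (Eventually.of_forall fun x => ?_)
  simp only
  ring

theorem frob_conf_eq_integral {h : X → Fin n → ℝ} (hh : IsClassifier h)
    (D : Measure (X × Fin n)) [IsFiniteMeasure D] (G : Matrix (Fin n) (Fin n) ℝ) :
    frob G (conf D h) = ∫ x, ∑ j, h x j * ∑ i, G i j * condProb D x i ∂D.fst := by
  have hint := fun i j => (hh.integrable_mul (isClassifier_condProb D) D.fst i j).const_mul (G i j)
  calc frob G (conf D h)
      = ∑ i, ∑ j, ∫ x, G i j * (h x j * condProb D x i) ∂D.fst := by
        simp only [frob, conf_eq_integral_condProb hh D, integral_const_mul]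
    _ = ∫ x, ∑ i, ∑ j, G i j * (h x j * condProb D x i) ∂D.fst := by
        rw [integral_finsetSum _ fun i _ => integrable_finsetSum _ fun j _ => hint i j]
        exact Finset.sum_congr rfl fun i _ => (integral_finsetSum _ fun j _ => hint i j).symm
    _ = _ := by
        congr 1
        funext x
        rw [Finset.sum_comm]
        refine Finset.sum_congr rfl fun j _ => ?_
        rw [Finset.mul_sum]
        exact Finset.sum_congr rfl fun i _ => by ring

theorem integrable_cpeError (D : Measure (X × Fin n)) [IsFiniteMeasure D]
    {η : X → Fin n → ℝ} (hη : IsClassifier η) :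
    Integrable (fun x => ∑ y, |η x y - condProb D x y|) D.fst := by
  refine integrable_finsetSum _ fun y _ => ?_
  refine Integrable.of_bound ((hη.measurable_apply y).sub
    (measurable_condProb D y)).abs.aestronglyMeasurable 1 (Eventually.of_forall fun x => ?_)
  have h1 := hη.nonneg x y
  have h2 := hη.le_one x y
  have h3 := (isClassifier_condProb D).nonneg x y
  have h4 := (isClassifier_condProb D).le_one x y
  rw [Real.norm_eq_abs, abs_abs, abs_le]
  constructor <;> linarith

theorem cpeError_nonneg (D : Measure (X × Fin n)) [IsFiniteMeasure D]
    (η : X → Fin n → ℝ) : 0 ≤ cpeError D η :=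
  integral_nonneg fun _ => Finset.sum_nonneg fun _ _ => abs_nonneg _

/-- The plug-in classifier approximately maximizes a linear gain. -/
theorem frob_conf_le_plugIn (D : Measure (X × Fin n)) [IsFiniteMeasure D]
    {η g : X → Fin n → ℝ} (hη : IsClassifier η) (hg : IsClassifier g)
    {G : Matrix (Fin n) (Fin n) ℝ} {B : ℝ} (hG : ∀ i j, |G i j| ≤ B) :
    frob G (conf D g) ≤ frob G (conf D (plugIn G η)) + 2 * B * cpeError D η := by
  have hu := isClassifier_plugIn G hη.1
  rw [frob_conf_eq_integral hg, frob_conf_eq_integral hu, cpeError, ← integral_const_mul,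
    ← integral_add (integrable_gain hu D G) ((integrable_cpeError D hη).const_mul _)]
  refine integral_mono (integrable_gain hg D G) ((integrable_gain hu D G).add
    ((integrable_cpeError D hη).const_mul _)) fun x => ?_
  -- Replacing the true conditional probabilities by the model costs `B` times their ℓ₁ distance,
  -- once for the competitor and once for the plug-in classifier.
  have hsplit : ∀ p : Fin n → ℝ, ∑ j, p j * ∑ i, G i j * condProb D x i =
      ∑ j, p j * ∑ i, G i j * η x i - ∑ j, p j * ∑ i, G i j * (η x i - condProb D x i) := by
    intro p
    rw [← Finset.sum_sub_distrib]
    refine Finset.sum_congr rfl fun j _ => ?_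
    rw [← mul_sub, ← Finset.sum_sub_distrib]
    congr 1
    exact Finset.sum_congr rfl fun i _ => by ring
  have h1 := sum_mul_le_plugIn G η x (hg.2 x)
  have h2 := abs_gain_le (hg.2 x) hG fun i => η x i - condProb D x i
  have h3 := abs_gain_le (hu.2 x) hG fun i => η x i - condProb D x i
  have h4 := (abs_le.1 h2).1
  have h5 := (abs_le.1 h3).2
  simp only [hsplit]
  linarith

end LinearMax

/-! ### The conditional gradient method -/

/-- The first order lower bound for a smooth function. -/
theorem HasGrad.frob_sub_le {ψ : Matrix (Fin n) (Fin n) ℝ → ℝ}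
    {g : Matrix (Fin n) (Fin n) ℝ → Matrix (Fin n) (Fin n) ℝ} (hg : HasGrad ψ g) {β : ℝ}
    (hβ0 : 0 ≤ β) (hβ : ∀ i j, LipschitzL1On β (fun M => g M i j) (cube n))
    {M N : Matrix (Fin n) (Fin n) ℝ} (hM : M ∈ cube n) (hN : N ∈ cube n) :
    frob (g M) (N - M) - β * l1Norm (N - M) ^ 2 ≤ ψ N - ψ M := by
  -- The mean value inequality for the function minus its linearization. Bounding the derivative
  -- uniformly in `t` gives the constant `β`, without the factor `1 / 2` that integration would
  -- bring.
  have key := Convex.norm_image_sub_le_of_norm_hasDerivWithin_le (𝕜 := ℝ)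
    (f := fun t : ℝ => ψ (M + t • (N - M)) - t * frob (g M) (N - M))
    (f' := fun t : ℝ => frob (g (M + t • (N - M))) (N - M) - 1 * frob (g M) (N - M))
    (s := Set.Icc 0 1) (C := β * l1Norm (N - M) ^ 2)
    (fun t ht => ((hasDerivAt_line (hg _ (lineMap_mem_cube hM hN ht) _)).sub
      ((hasDerivAt_id t).mul_const _)).hasDerivWithinAt)
    (fun t ht => ?_) (convex_Icc 0 1)
    (Set.left_mem_Icc.2 zero_le_one) (Set.right_mem_Icc.2 zero_le_one)
  · simp only [one_smul, zero_smul, add_zero, add_sub_cancel, sub_zero, norm_one, mul_one,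
      Real.norm_eq_abs, one_mul, zero_mul] at key
    linarith [(abs_le.1 key).1]
  · have hV := l1Norm_nonneg (N - M)
    rw [one_mul, ← frob_sub_left, Real.norm_eq_abs, sq, ← mul_assoc]
    refine abs_frob_le (fun i j => ?_) _
    rw [Matrix.sub_apply]
    refine (hβ i j _ (lineMap_mem_cube hM hN ht) _ hM).trans ?_
    rw [add_sub_cancel_left, l1Norm_smul, abs_of_nonneg ht.1]
    exact mul_le_mul_of_nonneg_left (mul_le_of_le_one_left hV ht.2) hβ0

/-- The first order upper bound for a concave function. -/
theorem HasGrad.sub_le_frob {ψ : Matrix (Fin n) (Fin n) ℝ → ℝ}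
    {g : Matrix (Fin n) (Fin n) ℝ → Matrix (Fin n) (Fin n) ℝ} (hg : HasGrad ψ g)
    {s : Set (Matrix (Fin n) (Fin n) ℝ)} (hs : s ⊆ cube n) (hψ : ConcaveOn ℝ s ψ)
    {M N : Matrix (Fin n) (Fin n) ℝ} (hM : M ∈ s) (hN : N ∈ s) :
    ψ N - ψ M ≤ frob (g M) (N - M) := by
  -- By concavity the difference quotients along the segment dominate `ψ N - ψ M`; let the step tend
  -- to zero from the right.
  refine ge_of_tendsto (hg M (hs hM) (N - M)).tendsto_slope_zero_right ?_
  filter_upwards [Ioo_mem_nhdsGT (zero_lt_one (α := ℝ))] with t ht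
  have h := hψ.2 hM hN (sub_nonneg.2 ht.2.le) ht.1.le (by ring)
  rw [show (1 - t) • M + t • N = M + t • (N - M) by module] at h
  simp only [smul_eq_mul, zero_add, zero_smul, add_zero] at h ⊢
  rw [← div_eq_inv_mul, le_div_iff₀ ht.1]
  linarith

section Iterates

variable {X : Type*} [MeasurableSpace X] [NeZero n]

theorem isClassifier_iterate (ψ : Matrix (Fin n) (Fin n) ℝ → ℝ) {η h₀ : X → Fin n → ℝ}
    (hη : IsClassifier η) (hh₀ : IsClassifier h₀) (E : Measure (X × Fin n)) (j : ℕ) :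
    IsClassifier (iterate ψ η E h₀ j) := by
  induction j with
  | zero => exact hh₀
  | succ j ih =>
    have h2 : 2 / (((j + 1 : ℕ) : ℝ) + 1) ≤ 1 := by
      rw [div_le_one (by positivity)]
      push_cast
      linarith [Nat.cast_nonneg (α := ℝ) j]
    exact ih.convexComb (isClassifier_plugIn _ hη.1) (sub_nonneg.2 h2) (by positivity) (by ring)

theorem conf_iterate_succ (ψ : Matrix (Fin n) (Fin n) ℝ → ℝ) {η h₀ : X → Fin n → ℝ}
    (hη : IsClassifier η) (hh₀ : IsClassifier h₀) (E D : Measure (X × Fin n))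
    [IsFiniteMeasure D] (j : ℕ) :
    conf D (iterate ψ η E h₀ (j + 1)) =
      (1 - 2 / (((j + 1 : ℕ) : ℝ) + 1)) • conf D (iterate ψ η E h₀ j) +
      (2 / (((j + 1 : ℕ) : ℝ) + 1)) •
        conf D (plugIn (grad ψ (conf E (iterate ψ η E h₀ j))) η) :=
  conf_convexComb (isClassifier_iterate ψ hη hh₀ E j) (isClassifier_plugIn _ hη.1) D _ _

/-- If the empirical confusion matrices of the plug-in classifiers are uniformly accurate, then
so are those of the iterates. The first step removes the initial classifier. -/
theorem abs_conf_iterate_sub_le (ψ : Matrix (Fin n) (Fin n) ℝ → ℝ) {η h₀ : X → Fin n → ℝ}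
    (hη : IsClassifier η) (hh₀ : IsClassifier h₀) (E D : Measure (X × Fin n))
    [IsFiniteMeasure D] [IsFiniteMeasure E] {ε : ℝ}
    (hε : ∀ G i j, |conf E (plugIn G η) i j - conf D (plugIn G η) i j| ≤ ε) {k : ℕ}
    (hk : 1 ≤ k) (i j : Fin n) :
    |conf E (iterate ψ η E h₀ k) i j - conf D (iterate ψ η E h₀ k) i j| ≤ ε := by
  induction k, hk using Nat.le_induction with
  | base =>
    -- The first weight is `2 / (1 + 1) = 1`, so the first iterate is a plug-in classifier. This
    -- matters because the initial classifier may depend on the second part of the sample.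
    rw [conf_iterate_succ ψ hη hh₀, conf_iterate_succ ψ hη hh₀]
    norm_num
    exact hε _ i j
  | succ k hk ih =>
    rw [conf_iterate_succ ψ hη hh₀, conf_iterate_succ ψ hη hh₀]
    set γ : ℝ := 2 / (((k + 1 : ℕ) : ℝ) + 1) with hγ
    have h2 : γ ≤ 1 := by
      rw [hγ, div_le_one (by positivity)]
      push_cast
      linarith [Nat.cast_nonneg (α := ℝ) k]
    have h0 : 0 ≤ γ := by positivity
    have h3 := hε (grad ψ (conf E (iterate ψ η E h₀ k))) i j
    simp only [Matrix.add_apply, Matrix.smul_apply, smul_eq_mul]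
    rw [abs_le] at ih h3 ⊢
    constructor <;> nlinarith [ih.1, ih.2, h3.1, h3.2]

/-- The approximate conditional gradient method. -/
theorem sub_iterate_le {ψ : Matrix (Fin n) (Fin n) ℝ → ℝ}
    {g : Matrix (Fin n) (Fin n) ℝ → Matrix (Fin n) (Fin n) ℝ} (hg : HasGrad ψ g) {β B ε : ℝ}
    (hβ0 : 0 ≤ β) (hβ : ∀ i j, LipschitzL1On β (fun M => g M i j) (cube n))
    (hB : ∀ M ∈ cube n, ∀ i j, |g M i j| ≤ B)
    {E D : Measure (X × Fin n)} [IsProbabilityMeasure E] [IsProbabilityMeasure D]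
    (hψ : ConcaveOn ℝ (feasible D) ψ) {η h₀ : X → Fin n → ℝ} (hη : IsClassifier η)
    (hh₀ : IsClassifier h₀)
    (hε : ∀ G i j, |conf E (plugIn G η) i j - conf D (plugIn G η) i j| ≤ ε)
    {C : Matrix (Fin n) (Fin n) ℝ} (hC : C ∈ feasible D) {k : ℕ} (hk : 1 ≤ k) :
    ψ C - ψ (conf D (iterate ψ η E h₀ k)) ≤
      4 * (β * (n ^ 2 * ε)) + 2 * B * cpeError D η + (16 * β + 4 * B) / (k + 1) := by
  have hB0 : 0 ≤ B := (abs_nonneg _).trans (hB _ (feasible_subset_cube D hC) 0 0)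
  have hcl := isClassifier_iterate ψ hη hh₀ E
  have hl1 : ∀ u : X → Fin n → ℝ, IsClassifier u → ∀ v : X → Fin n → ℝ, IsClassifier v →
      l1Norm (conf D u - conf D v) ≤ 2 := fun u hu v hv =>
    (l1Norm_sub_le _ _).trans (by rw [l1Norm_conf hu, l1Norm_conf hv]; norm_num)
  obtain ⟨c, hc, rfl⟩ := hC
  have hfeas : ∀ u : X → Fin n → ℝ, IsClassifier u → conf D u ∈ feasible D := fun u hu =>
    ⟨u, hu, rfl⟩
  -- The error that iteration cannot remove. The gradient error `β * (n ^ 2 * ε)` is paired with two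
  -- directions, each of ℓ₁ norm at most two, which makes the factor four.
  set T := 4 * (β * (n ^ 2 * ε)) + 2 * B * cpeError D η with hT
  have hT0 : 0 ≤ T := by
    have hε0 : 0 ≤ ε := (abs_nonneg _).trans (hε 0 0 0)
    have := cpeError_nonneg D η
    positivity
  induction k, hk using Nat.le_induction with
  | base =>
    -- Concavity with gradient bound `B` and diameter two gives a gap of at most `2 * B` at the
    -- first iterate; this explains the summand `4 * B`.
    have h1 := hg.sub_le_frob (feasible_subset_cube D) hψ (hfeas _ (hcl 1)) (hfeas c hc)
    have h2 := (abs_le.1 (abs_frob_le (hB _ (conf_mem_cube (hcl 1) D))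
      (conf D c - conf D (iterate ψ η E h₀ 1)))).2
    have h3 := mul_le_mul_of_nonneg_left (hl1 c hc _ (hcl 1)) hB0
    norm_num
    linarith
  | succ k hk ih =>
    have hh := hcl k
    have hhE := conf_mem_cube hh E
    have hhD := conf_mem_cube hh D
    have hstep := conf_iterate_succ ψ hη hh₀ E D k
    rw [hg.grad_eq hhE] at hstep
    set h := iterate ψ η E h₀ k with hdef
    set Gh := g (conf E h) with hGh
    set u := plugIn Gh η with hudef
    have hu : IsClassifier u := isClassifier_plugIn _ hη.1
    set γ : ℝ := 2 / (((k + 1 : ℕ) : ℝ) + 1) with hγ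
    have hk2 : ((k + 1 : ℕ) : ℝ) + 1 = k + 2 := by push_cast; ring
    rw [hk2] at hγ
    have hγ0 : 0 ≤ γ := by positivity
    have hγ1 : γ ≤ 1 := by
      rw [hγ, div_le_one (by positivity)]
      linarith [Nat.cast_nonneg (α := ℝ) k]
    -- the error of the gradient
    have hGerr : ∀ i j, |(Gh - g (conf D h)) i j| ≤ β * (n ^ 2 * ε) := fun i j =>
      (hβ i j _ hhE _ hhD).trans (mul_le_mul_of_nonneg_left
        (l1Norm_le_of_entry_le fun i j => abs_conf_iterate_sub_le ψ hη hh₀ E D hε hk i j) hβ0)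
    have herr : ∀ v : X → Fin n → ℝ, IsClassifier v →
        |frob Gh (conf D v - conf D h) - frob (g (conf D h)) (conf D v - conf D h)| ≤
          2 * (β * (n ^ 2 * ε)) := by
      intro v hv
      rw [← frob_sub_left]
      refine (abs_frob_le hGerr _).trans ?_
      rw [mul_comm]
      exact mul_le_mul_of_nonneg_right (hl1 v hv h hh) ((abs_nonneg _).trans (hGerr 0 0))
    have e1 := (abs_le.1 (herr u hu)).2
    have e2 := (abs_le.1 (herr c hc)).1
    have e3 : frob Gh (conf D c) ≤ frob Gh (conf D u) + 2 * B * cpeError D η :=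
      frob_conf_le_plugIn D hη hc (hB _ hhE)
    have e4 := hg.sub_le_frob (feasible_subset_cube D) hψ (hfeas h hh) (hfeas c hc)
    have e5 := hg.frob_sub_le hβ0 hβ hhD (conf_mem_cube (hcl (k + 1)) D)
    have hV : conf D (iterate ψ η E h₀ (k + 1)) - conf D h = γ • (conf D u - conf D h) := by
      rw [hstep]
      module
    have hfs : frob (g (conf D h)) (γ • (conf D u - conf D h)) =
        γ * frob (g (conf D h)) (conf D u - conf D h) := by
      simp only [frob, Matrix.smul_apply, smul_eq_mul, Finset.mul_sum]
      exact Finset.sum_congr rfl fun i _ => Finset.sum_congr rfl fun j _ => by ring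
    rw [hV, l1Norm_smul, abs_of_nonneg hγ0, hfs] at e5
    have e6 : β * (γ * l1Norm (conf D u - conf D h)) ^ 2 ≤ 4 * β * γ ^ 2 := by
      have h1 := hl1 u hu h hh
      have h2 := l1Norm_nonneg (conf D u - conf D h)
      calc β * (γ * l1Norm (conf D u - conf D h)) ^ 2 ≤ β * (γ * 2) ^ 2 := by gcongr
        _ = _ := by ring
    rw [frob_sub_right Gh] at e1 e2
    -- Pass from the true gradient to the empirical one in the direction of the competitor, use the
    -- near optimality of the plug-in classifier, and pass back.
    have e7 : ψ (conf D c) - ψ (conf D h) - T ≤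
        frob (g (conf D h)) (conf D u - conf D h) := by
      rw [hT]
      linarith
    have e8 := mul_le_mul_of_nonneg_left e7 hγ0
    have e9 := mul_le_mul_of_nonneg_left ih (sub_nonneg.2 hγ1)
    -- The rate reproduces itself: `γ = 2 / (k + 2)` turns the curvature term into `16 * β / (k + 2)
    -- ^ 2`, and `1 - γ = k / (k + 2)`.
    have e10 : (1 - γ) * ((16 * β + 4 * B) / (k + 1)) + 4 * β * γ ^ 2 ≤
        (16 * β + 4 * B) / (((k + 1 : ℕ) : ℝ) + 1) := by
      have hk0 : (0 : ℝ) ≤ k := Nat.cast_nonneg k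
      have hA : 4 * β * γ ^ 2 ≤ (16 * β + 4 * B) / (k + 2) ^ 2 := by
        rw [hγ, div_pow, ← mul_div_assoc]
        gcongr
        linarith
      have hA2 : (1 - γ) * ((16 * β + 4 * B) / (k + 1)) + (16 * β + 4 * B) / (k + 2) ^ 2 =
          (16 * β + 4 * B) / (k + 2) * (k / (k + 1) + 1 / (k + 2)) := by
        rw [hγ]
        field_simp
        ring
      have hA3 : (k : ℝ) / (k + 1) + 1 / (k + 2) ≤ 1 := by
        rw [div_add_div _ _ (by positivity) (by positivity), div_le_one (by positivity)]
        nlinarith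
      rw [hk2]
      calc _ ≤ (16 * β + 4 * B) / (k + 2) * (k / (k + 1) + 1 / (k + 2)) := by linarith
        _ ≤ (16 * β + 4 * B) / (k + 2) * 1 := by gcongr
        _ = _ := mul_one _
    nlinarith

end Iterates

end BayesCG

end

/-! ### Combinatorial size of the plug-in family and reduction to countably many gains. -/

noncomputable section

namespace BayesCG

variable {n : ℕ}

/-! ### The growth function of the plug-in classifiers -/

section Growth

variable {ι : Type*} [Fintype ι]

open Classical in
/-- The subsets of a finite family of vectors that a closed half-space through the origin cuts
out. -/
def halfspaceTraces {d : ℕ} (v : ι → Fin d → ℝ) : Finset (Finset ι) :=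
  Finset.univ.filter fun s => ∃ w : Fin d → ℝ, ∀ k, k ∈ s ↔ 0 ≤ ∑ a, w a * v k a

theorem mem_halfspaceTraces {d : ℕ} {v : ι → Fin d → ℝ} {s : Finset ι} :
    s ∈ halfspaceTraces v ↔ ∃ w : Fin d → ℝ, ∀ k, k ∈ s ↔ 0 ≤ ∑ a, w a * v k a := by
  simp [halfspaceTraces]

/-- Half-spaces through the origin of `ℝᵈ` shatter at most `d` vectors. -/
theorem card_le_of_shatters_halfspaceTraces [DecidableEq ι] {d : ℕ} {v : ι → Fin d → ℝ} {s : Finset ι}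
    (hs : (halfspaceTraces v).Shatters s) : s.card ≤ d := by
  by_contra! hcard
  have hli : ¬ LinearIndependent ℝ fun k : s => v k := fun h => by
    have := h.fintype_card_le_finrank
    simp at this
    omega
  obtain ⟨c, hc, hc0⟩ := Fintype.not_linearIndependent_iff.1 hli
  -- Suppose a half-space cuts out exactly the vectors with negative coefficient in a linear
  -- relation. Pairing the relation with its normal gives only nonpositive terms, and a strictly
  -- negative one at a positive coefficient, since the excluded vectors lie strictly outside. A
  -- relation without positive coefficient is negated first.
  have key : ∀ c : s → ℝ, ∑ k, c k • v k = 0 → (∃ k, 0 < c k) → False := by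
    rintro c hc ⟨k₀, hk₀⟩
    obtain ⟨u, hu, hsu⟩ := hs (Finset.filter_subset (fun k => ∃ h : k ∈ s, c ⟨k, h⟩ < 0) s)
    obtain ⟨w, hw⟩ := mem_halfspaceTraces.1 hu
    have hiff : ∀ k : s, 0 ≤ ∑ a, w a * v k a ↔ c k < 0 := fun k => by
      rw [← hw]
      have : (k : ι) ∈ s ∩ u ↔ (k : ι) ∈ s.filter fun k => ∃ h : k ∈ s, c ⟨k, h⟩ < 0 := by
        rw [hsu]
      simpa using this
    have hzero : ∑ k : s, c k * ∑ a, w a * v k a = 0 := by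
      calc ∑ k : s, c k * ∑ a, w a * v k a = ∑ a, w a * (∑ k : s, c k • v k) a := by
            simp only [Finset.sum_apply, Pi.smul_apply, smul_eq_mul, Finset.mul_sum]
            rw [Finset.sum_comm]
            exact Finset.sum_congr rfl fun a _ => Finset.sum_congr rfl fun k _ => by ring
        _ = 0 := by rw [hc]; simp
    have hneg : ∀ k : s, c k * ∑ a, w a * v k a ≤ 0 := fun k => by
      by_cases h : c k < 0
      · exact mul_nonpos_of_nonpos_of_nonneg h.le ((hiff k).2 h)
      · have : ∑ a, w a * v k a < 0 := not_le.1 fun h' => h ((hiff k).1 h')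
        exact mul_nonpos_of_nonneg_of_nonpos (not_lt.1 h) this.le
    have hlt : c k₀ * ∑ a, w a * v k₀ a < 0 :=
      mul_neg_of_pos_of_neg hk₀ (not_le.1 fun h' => hk₀.not_gt ((hiff k₀).1 h'))
    exact (Finset.sum_neg' (fun k _ => hneg k) ⟨k₀, Finset.mem_univ _, hlt⟩).ne hzero
  obtain ⟨k, hk⟩ := hc0
  rcases lt_or_gt_of_ne hk with h | h
  · refine key (fun k => -c k) ?_ ⟨k, neg_pos.2 h⟩
    simp only [neg_smul, Finset.sum_neg_distrib, hc, neg_zero]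
  · exact key c hc ⟨k, h⟩

/-- Compare termwise with the binomial expansion, using `N.choose k ≤ N ^ k`. -/
theorem sum_choose_le_pow (N d : ℕ) : ∑ k ∈ Finset.Iic d, N.choose k ≤ (N + 1) ^ d := by
  rw [add_pow]
  have : Finset.Iic d = Finset.range (d + 1) := by ext; simp
  rw [this]
  refine Finset.sum_le_sum fun k hk => ?_
  have hkd : k ≤ d := Nat.lt_succ_iff.1 (Finset.mem_range.1 hk)
  rw [one_pow, mul_one]
  exact (Nat.choose_le_pow N k).trans (Nat.le_mul_of_pos_right _ (Nat.choose_pos hkd))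

/-- Sauer–Shelah: a set family has no more members than shattered sets, and these have at most `d`
elements. -/
theorem card_halfspaceTraces_le {d : ℕ} (v : ι → Fin d → ℝ) :
    (halfspaceTraces v).card ≤ (Fintype.card ι + 1) ^ d := by
  classical
  refine (Finset.card_le_card_shatterer _).trans (Finset.card_shatterer_le_sum_vcDim.trans ?_)
  refine le_trans (Finset.sum_le_sum_of_subset (Finset.Iic_subset_Iic.2 ?_))
    (sum_choose_le_pow _ d)
  exact Finset.sup_le fun s hs => card_le_of_shatters_halfspaceTraces (Finset.mem_shatterer.1 hs)

/-- On `N` instances the `j`-th components of all plug-in classifiers of a model take at most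
`(N + 1) ^ (n * n)` values. -/
theorem exists_finset_plugIn {W : Type*} (η : W → Fin n → ℝ) (x : ι → W) (j : Fin n) :
    ∃ T : Finset (ι → ℝ), T.card ≤ (Fintype.card ι + 1) ^ (n * n) ∧
      (∀ G, (fun k => plugIn G η (x k) j) ∈ T) ∧ ∀ f ∈ T, ∀ k, f k ∈ Set.Icc (0 : ℝ) 1 := by
  classical
  set H := halfspaceTraces fun k => η (x k) with hH
  -- Label `j` is the last maximizer when the instance lies in a closed half-space for each `y ≤ j`
  -- and in the complement of one for each `y > j`. So `n` traces determine the pattern, and each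
  -- has at most `(N + 1) ^ n` values.
  let φ : (Fin n → H) → ι → ℝ := fun A k =>
    if ∀ y, (if j < y then k ∉ (A y : Finset ι) else k ∈ (A y : Finset ι)) then 1 else 0
  refine ⟨Finset.univ.image φ, ?_, fun G => ?_, ?_⟩
  · refine Finset.card_image_le.trans ?_
    rw [Finset.card_univ, Fintype.card_fun, Fintype.card_coe, Fintype.card_fin, pow_mul]
    exact Nat.pow_le_pow_left (card_halfspaceTraces_le _) n
  · let w : Fin n → Fin n → ℝ := fun y a => if j < y then G a y - G a j else G a j - G a y
    have hA : ∀ y, (Finset.univ.filter fun k => 0 ≤ ∑ a, w y a * η (x k) a) ∈ H := fun y =>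
      mem_halfspaceTraces.2 ⟨w y, fun k => by simp⟩
    refine Finset.mem_image.2 ⟨fun y => ⟨_, hA y⟩, Finset.mem_univ _, ?_⟩
    funext k
    unfold plugIn
    simp only [φ, Finset.mem_filter, Finset.mem_univ, true_and]
    refine if_congr ?_ rfl rfl
    have hw : ∀ y, ∑ a, w y a * η (x k) a = if j < y then
        ∑ a, G a y * η (x k) a - ∑ a, G a j * η (x k) a else
        ∑ a, G a j * η (x k) a - ∑ a, G a y * η (x k) a := fun y => by
      simp only [w]
      split_ifs <;> simp [sub_mul, Finset.sum_sub_distrib]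
    simp only [hw]
    constructor
    · intro h
      refine ⟨fun y => ?_, fun y hy => ?_⟩
      · have := h y
        split_ifs at this with hy
        · rw [not_le] at this
          linarith
        · linarith
      · have := h y
        rw [if_pos hy, if_pos hy, not_le] at this
        linarith
    · intro h y
      split_ifs with hy
      · have := h.2 y hy
        rw [not_le]
        linarith
      · have := h.1 y
        linarith
  · intro f hf k
    obtain ⟨A, -, rfl⟩ := Finset.mem_image.1 hf
    simp only [φ]
    split_ifs <;> simp

end Growth

/-! ### Countably many gain matrices suffice -/

section Dense

/-- The gain matrices of a dense sequence. -/
def denseGain (n k : ℕ) : Matrix (Fin n) (Fin n) ℝ :=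
  TopologicalSpace.denseSeq (Fin n → Fin n → ℝ) k

theorem exists_denseGain (G : Matrix (Fin n) (Fin n) ℝ) {δ : ℝ} (hδ : 0 < δ) :
    ∃ k, ∀ a y, |G a y - denseGain n k a y| ≤ δ := by
  obtain ⟨k, hk⟩ := (TopologicalSpace.denseRange_denseSeq (Fin n → Fin n → ℝ)).exists_dist_lt
    (G : Fin n → Fin n → ℝ) hδ
  refine ⟨k, fun a y => ?_⟩
  rw [← Real.dist_eq]
  exact (dist_le_pi_dist (G a) (denseGain n k a) y).trans
    ((dist_le_pi_dist (G : Fin n → Fin n → ℝ) (denseGain n k) a).trans hk.le)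

/-- Every plug-in classifier is the pointwise limit of plug-in classifiers with gain matrices in
the dense sequence: perturb the gains so that ties are broken in favour of larger labels. -/
theorem exists_seq_isLastArgmax (G : Matrix (Fin n) (Fin n) ℝ) :
    ∃ s : ℕ → ℕ, ∀ v ∈ stdSimplex ℝ (Fin n), ∀ i, IsLastArgmax (fun y => ∑ k, G k y * v k) i →
      ∀ᶠ m in atTop, IsLastArgmax (fun y => ∑ k, denseGain n (s m) k y * v k) i := by
  set ε : ℕ → ℝ := fun m => 1 / ((m : ℝ) + 1) with hε
  have hε0 : ∀ m, 0 < ε m := fun m => by simp only [hε]; positivity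
  -- The bonus `ε m * y` is added to the whole column `y`, so it shifts the score by exactly that
  -- amount because `v` sums to one. Distinct labels are separated by at least `ε m`, while the
  -- approximation moves two scores by at most `ε m / 2` together.
  have happ : ∀ m, ∃ k, ∀ a y, |(G a y + ε m * (y : ℕ)) - denseGain n k a y| ≤ ε m / 4 :=
    fun m => exists_denseGain (fun a y => G a y + ε m * (y : ℕ)) (by have := hε0 m; positivity)
  choose s hs using happ
  refine ⟨s, fun v hv i hi => ?_⟩
  have hsc : ∀ m y, |(∑ k, G k y * v k + ε m * (y : ℕ)) - ∑ k, denseGain n (s m) k y * v k| ≤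
      ε m / 4 := by
    intro m y
    have h1 : (∑ k, G k y * v k + ε m * (y : ℕ)) - ∑ k, denseGain n (s m) k y * v k =
        ∑ k, v k * ((G k y + ε m * (y : ℕ)) - denseGain n (s m) k y) := by
      calc _ = ∑ k, G k y * v k + ε m * (y : ℕ) * ∑ k, v k -
            ∑ k, denseGain n (s m) k y * v k := by rw [hv.2, mul_one]
        _ = _ := by
            rw [Finset.mul_sum, ← Finset.sum_add_distrib, ← Finset.sum_sub_distrib]
            exact Finset.sum_congr rfl fun k _ => by ring
    rw [h1]
    calc _ ≤ ∑ k, v k * (ε m / 4) := by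
          refine (Finset.abs_sum_le_sum_abs _ _).trans (Finset.sum_le_sum fun k _ => ?_)
          rw [abs_mul, abs_of_nonneg (hv.1 k)]
          exact mul_le_mul_of_nonneg_left (hs m k y) (hv.1 k)
      _ = ε m / 4 := by rw [← Finset.sum_mul, hv.2, one_mul]
  have hlim : Tendsto (fun m => ε m * (n + 1)) atTop (𝓝 0) := by
    simpa [hε] using tendsto_one_div_add_atTop_nhds_zero_nat.mul_const ((n : ℝ) + 1)
  have hev : ∀ᶠ m in atTop, ∀ y, i < y →
      ε m * (n + 1) < ∑ k, G k i * v k - ∑ k, G k y * v k := by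
    rw [eventually_all]
    intro y
    by_cases hy : i < y
    · filter_upwards [hlim.eventually_lt_const (sub_pos.2 (hi.2 y hy))] with m hm _
      exact hm
    · exact Eventually.of_forall fun m h => absurd h hy
  filter_upwards [hev] with m hm
  have hgt : ∀ y, i < y →
      ∑ k, denseGain n (s m) k y * v k < ∑ k, denseGain n (s m) k i * v k := by
    intro y hy
    have h1 := hm y hy
    have h2 := abs_le.1 (hsc m y)
    have h3 := abs_le.1 (hsc m i)
    have h4 : ε m * (y : ℕ) ≤ ε m * n :=
      mul_le_mul_of_nonneg_left (by exact_mod_cast y.2.le) (hε0 m).le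
    have h5 : 0 ≤ ε m * (i : ℕ) := mul_nonneg (hε0 m).le (Nat.cast_nonneg _)
    have h6 := hε0 m
    linarith [h2.1, h2.2, h3.1, h3.2]
  refine ⟨fun y => ?_, hgt⟩
  rcases lt_trichotomy i y with hy | rfl | hy
  · exact (hgt y hy).le
  · exact le_rfl
  · have h1 := hi.1 y
    have h2 := abs_le.1 (hsc m y)
    have h3 := abs_le.1 (hsc m i)
    have h4 : ε m * ((y : ℕ) + 1) ≤ ε m * (i : ℕ) :=
      mul_le_mul_of_nonneg_left (by exact_mod_cast hy) (hε0 m).le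
    have h6 := hε0 m
    simp only at h1 ⊢
    linarith [h2.1, h2.2, h3.1, h3.2]

theorem exists_seq_plugIn_eq [NeZero n] (G : Matrix (Fin n) (Fin n) ℝ) :
    ∃ s : ℕ → ℕ, ∀ v ∈ stdSimplex ℝ (Fin n), ∀ {W : Type*} (η : W → Fin n → ℝ) (x : W),
      η x = v → ∀ᶠ m in atTop, plugIn (denseGain n (s m)) η x = plugIn G η x := by
  obtain ⟨s, hs⟩ := exists_seq_isLastArgmax G
  refine ⟨s, fun v hv W η x hx => ?_⟩
  obtain ⟨i, hi⟩ := exists_isLastArgmax fun y => ∑ k, G k y * η x k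
  filter_upwards [hs v hv i (hx ▸ hi)] with m hm
  rw [plugIn_eq_single hi, plugIn_eq_single (i := i) (by rw [hx]; exact hm)]

variable {X : Type*} [MeasurableSpace X]

theorem tendsto_conf_of_eventually_eq {h : ℕ → X → Fin n → ℝ} {u : X → Fin n → ℝ}
    (hh : ∀ m, IsClassifier (h m)) (hu : ∀ x, ∀ᶠ m in atTop, h m x = u x)
    (D : Measure (X × Fin n)) [IsFiniteMeasure D] (i j : Fin n) :
    Tendsto (fun m => conf D (h m) i j) atTop (𝓝 (conf D u i j)) := by
  refine tendsto_integral_of_dominated_convergence (fun _ => 1)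
    (fun m => ((hh m).measurable_confIntegrand i j).aestronglyMeasurable)
    (integrable_const _) (fun m => Eventually.of_forall fun z => ?_)
    (Eventually.of_forall fun z => ?_)
  · rw [Real.norm_of_nonneg ((hh m).confIntegrand_nonneg i j z)]
    exact (hh m).confIntegrand_le_one i j z
  · refine tendsto_const_nhds.congr' ?_
    filter_upwards [hu z.1] with m hm
    rw [hm]

/-- A uniform bound over the dense sequence of gain matrices extends to all gain matrices. -/
theorem abs_conf_sub_le_of_denseGain [NeZero n] {η : X → Fin n → ℝ} (hη : IsClassifier η)
    (E D : Measure (X × Fin n)) [IsFiniteMeasure E] [IsFiniteMeasure D] {ε : ℝ} {i j : Fin n}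
    (h : ∀ k, |conf E (plugIn (denseGain n k) η) i j - conf D (plugIn (denseGain n k) η) i j| ≤ ε)
    (G : Matrix (Fin n) (Fin n) ℝ) :
    |conf E (plugIn G η) i j - conf D (plugIn G η) i j| ≤ ε := by
  obtain ⟨s, hs⟩ := exists_seq_plugIn_eq G
  have hlim := fun (F : Measure (X × Fin n)) (_ : IsFiniteMeasure F) =>
    tendsto_conf_of_eventually_eq (fun m => isClassifier_plugIn (denseGain n (s m)) hη.1)
      (fun x => hs (η x) (hη.2 x) η x rfl) F i j
  exact le_of_tendsto ((hlim E inferInstance).sub (hlim D inferInstance)).abs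
    (Eventually.of_forall fun m => h (s m))

end Dense

end BayesCG

end

/-! ### Symmetrization and the maximal inequality for Rademacher sums. -/

noncomputable section

namespace BayesCG

/-! ### Rademacher averages -/

/-- The sign of a Boolean. -/
def boolSign (b : Bool) : ℝ := if b then 1 else -1

/-- The bound for Rademacher averages of `K` vectors of length `m`. -/
def rademacherBound (m : ℕ) (K : ℝ) (l : ℝ) : ℝ := (Real.log (2 * K) / l + l * m / 2 + 1 / l) / m

/-- The sum over sign patterns factorizes, and each factor is controlled by `cosh x ≤ exp (x ^ 2 /
2)`. -/
theorem sum_exp_boolSign_le {m : ℕ} {d : Fin m → ℝ} (hd : ∀ k, |d k| ≤ 1) (l : ℝ) :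
    ∑ σ : Fin m → Bool, Real.exp (l * ∑ k, boolSign (σ k) * d k) ≤
      2 ^ m * Real.exp (l ^ 2 * m / 2) := by
  calc ∑ σ : Fin m → Bool, Real.exp (l * ∑ k, boolSign (σ k) * d k)
      = ∑ σ : Fin m → Bool, ∏ k, Real.exp (l * (boolSign (σ k) * d k)) := by
        simp_rw [Finset.mul_sum, Real.exp_sum]
    _ = ∏ k, ∑ b : Bool, Real.exp (l * (boolSign b * d k)) := by
        rw [Finset.prod_univ_sum, Fintype.piFinset_univ]
    _ ≤ ∏ _k : Fin m, (2 * Real.exp (l ^ 2 / 2)) := by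
        refine Finset.prod_le_prod (fun k _ => Finset.sum_nonneg fun b _ => (Real.exp_pos _).le)
          fun k _ => ?_
        have h1 : ∑ b : Bool, Real.exp (l * (boolSign b * d k)) = 2 * Real.cosh (l * d k) := by
          rw [Fintype.sum_bool, Real.cosh_eq]
          simp only [boolSign, if_true, Bool.false_eq_true, if_false]
          ring_nf
        rw [h1]
        refine mul_le_mul_of_nonneg_left ((Real.cosh_le_exp_half_sq _).trans ?_) zero_le_two
        refine Real.exp_le_exp.2 ?_
        have h2 : d k ^ 2 ≤ 1 := (sq_le_one_iff_abs_le_one _).2 (hd k)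
        rw [mul_pow]
        nlinarith [sq_nonneg l]
    _ = 2 ^ m * Real.exp (l ^ 2 * m / 2) := by
        rw [Finset.prod_const, Finset.card_univ, Fintype.card_fin, mul_pow, ← Real.exp_nat_mul]
        ring_nf

/-- A maximal inequality for Rademacher sums. -/
theorem sum_iSup_boolSign_le {A : Type*} {m : ℕ} (hm : 0 < m) {d : A → Fin m → ℝ}
    {T : Finset (Fin m → ℝ)} {K : ℝ} (hK : 1 ≤ K) (hT : (T.card : ℝ) ≤ K) (hdT : ∀ a, d a ∈ T)
    (hT1 : ∀ f ∈ T, ∀ k, |f k| ≤ 1) {l : ℝ} (hl : 0 < l) :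
    ∑ σ : Fin m → Bool, ⨆ a, ‖1 / (m : ℝ) * ∑ k, boolSign (σ k) * d a k‖ₑ ≤
      2 ^ m * ENNReal.ofReal (rademacherBound m K l) := by
  have hm0 : (0 : ℝ) < m := Nat.cast_pos.2 hm
  set t : ℝ := Real.log (2 * K) / l + l * m / 2 with ht
  -- An explicit majorant of the supremum, from `x - t ≤ exp (l * (x - t)) / l` and a sum over `T`
  -- in place of a maximum. The threshold `t` is chosen so that the exponential part averages to at
  -- most `1 / l`.
  set U : (Fin m → Bool) → ℝ := fun σ => t + 1 / l * Real.exp (-(l * t)) *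
    ∑ f ∈ T, (Real.exp (l * ∑ k, boolSign (σ k) * f k) +
      Real.exp (-l * ∑ k, boolSign (σ k) * f k)) with hU
  have habs : ∀ σ a, |∑ k, boolSign (σ k) * d a k| ≤ U σ := by
    intro σ a
    set x := ∑ k, boolSign (σ k) * d a k with hx
    have h1 : l * (|x| - t) ≤ Real.exp (l * (|x| - t)) := by
      linarith [Real.add_one_le_exp (l * (|x| - t))]
    have h2 : Real.exp (l * |x|) ≤ Real.exp (l * x) + Real.exp (-l * x) := by
      rcases abs_cases x with ⟨h, _⟩ | ⟨h, _⟩ <;> rw [h]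
      · linarith [Real.exp_pos (-l * x)]
      · rw [mul_neg, ← neg_mul]
        linarith [Real.exp_pos (l * x)]
    have h3 : Real.exp (l * x) + Real.exp (-l * x) ≤
        ∑ f ∈ T, (Real.exp (l * ∑ k, boolSign (σ k) * f k) +
          Real.exp (-l * ∑ k, boolSign (σ k) * f k)) :=
      Finset.single_le_sum (f := fun f : Fin m → ℝ =>
        Real.exp (l * ∑ k, boolSign (σ k) * f k) + Real.exp (-l * ∑ k, boolSign (σ k) * f k))
        (fun f _ => by positivity) (hdT a)
    have h4 : Real.exp (l * (|x| - t)) = Real.exp (-(l * t)) * Real.exp (l * |x|) := by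
      rw [← Real.exp_add]
      ring_nf
    have h5 : |x| - t ≤ 1 / l * (Real.exp (-(l * t)) * Real.exp (l * |x|)) := by
      rw [← h4, one_div_mul_eq_div, le_div_iff₀ hl]
      linarith
    have h6 : 1 / l * (Real.exp (-(l * t)) * Real.exp (l * |x|)) ≤ 1 / l * Real.exp (-(l * t)) *
        ∑ f ∈ T, (Real.exp (l * ∑ k, boolSign (σ k) * f k) +
          Real.exp (-l * ∑ k, boolSign (σ k) * f k)) := by
      rw [← mul_assoc]
      exact mul_le_mul_of_nonneg_left (h2.trans h3) (by positivity)
    simp only [hU]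
    linarith
  have ht0 : 0 ≤ t := by
    have := Real.log_nonneg (show 1 ≤ 2 * K by linarith)
    positivity
  have hU0 : ∀ σ, 0 ≤ U σ := fun σ => add_nonneg ht0
    (mul_nonneg (by positivity) (Finset.sum_nonneg fun f _ => by positivity))
  have hsup : ∀ σ, ⨆ a, ‖1 / (m : ℝ) * ∑ k, boolSign (σ k) * d a k‖ₑ ≤
      ENNReal.ofReal (1 / m * U σ) := fun σ => iSup_le fun a => by
    rw [Real.enorm_eq_ofReal_abs, abs_mul, abs_of_pos (by positivity)]
    exact ENNReal.ofReal_le_ofReal (mul_le_mul_of_nonneg_left (habs σ a) (by positivity))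
  have hsumU : ∑ σ, U σ ≤ 2 ^ m * (t + 1 / l) := by
    have h1 : ∑ σ : Fin m → Bool, ∑ f ∈ T, (Real.exp (l * ∑ k, boolSign (σ k) * f k) +
        Real.exp (-l * ∑ k, boolSign (σ k) * f k)) ≤
          K * (2 * (2 ^ m * Real.exp (l ^ 2 * m / 2))) := by
      rw [Finset.sum_comm]
      calc _ ≤ ∑ _f ∈ T, 2 * (2 ^ m * Real.exp (l ^ 2 * m / 2)) := by
            refine Finset.sum_le_sum fun f hf => ?_
            rw [Finset.sum_add_distrib, two_mul]
            refine add_le_add (sum_exp_boolSign_le (hT1 f hf) l) ?_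
            have := sum_exp_boolSign_le (hT1 f hf) (-l)
            rwa [neg_sq] at this
        _ = T.card * (2 * (2 ^ m * Real.exp (l ^ 2 * m / 2))) := by simp
        _ ≤ _ := by gcongr
    have h2 : Real.exp (-(l * t)) * (2 * K * Real.exp (l ^ 2 * m / 2)) = 1 := by
      have hlt : l * t = Real.log (2 * K) + l ^ 2 * m / 2 := by
        rw [ht]
        field_simp
      rw [hlt, Real.exp_neg, Real.exp_add, Real.exp_log (by linarith)]
      exact inv_mul_cancel₀ (by positivity)
    calc ∑ σ, U σ = 2 ^ m * t + 1 / l * Real.exp (-(l * t)) *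
          ∑ σ : Fin m → Bool, ∑ f ∈ T, (Real.exp (l * ∑ k, boolSign (σ k) * f k) +
            Real.exp (-l * ∑ k, boolSign (σ k) * f k)) := by
          simp only [hU]
          rw [Finset.sum_add_distrib, ← Finset.mul_sum]
          simp
      _ ≤ 2 ^ m * t + 1 / l * Real.exp (-(l * t)) *
          (K * (2 * (2 ^ m * Real.exp (l ^ 2 * m / 2)))) := by gcongr
      _ = 2 ^ m * t + 2 ^ m * (1 / l) *
          (Real.exp (-(l * t)) * (2 * K * Real.exp (l ^ 2 * m / 2))) := by ring
      _ = 2 ^ m * (t + 1 / l) := by rw [h2]; ring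
  calc _ ≤ ∑ σ : Fin m → Bool, ENNReal.ofReal (1 / m * U σ) := Finset.sum_le_sum fun σ _ => hsup σ
    _ = ENNReal.ofReal (∑ σ, 1 / m * U σ) := by
        rw [ENNReal.ofReal_sum_of_nonneg]
        exact fun σ _ => mul_nonneg (by positivity) (hU0 σ)
    _ ≤ ENNReal.ofReal (2 ^ m * rademacherBound m K l) := by
        refine ENNReal.ofReal_le_ofReal ?_
        rw [← Finset.mul_sum, rademacherBound]
        calc 1 / (m : ℝ) * ∑ σ, U σ ≤ 1 / m * (2 ^ m * (t + 1 / l)) := by gcongr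
          _ = _ := by rw [ht]; ring
    _ = _ := by
        rw [ENNReal.ofReal_mul (by positivity), ENNReal.ofReal_pow (by norm_num)]
        norm_num

/-! ### Symmetrization -/

section Symmetrization

variable {Z : Type*} [MeasurableSpace Z] {A : Type*} [Countable A]

/-- Exchange the two components of the pairs where `σ` is false. -/
def swapPairs {m : ℕ} (σ : Fin m → Bool) (w : Fin m → Z × Z) : Fin m → Z × Z :=
  fun k => if σ k then w k else (w k).swap

theorem measurePreserving_swapPairs {m : ℕ} (P : Measure Z) [IsProbabilityMeasure P]
    (σ : Fin m → Bool) :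
    MeasurePreserving (swapPairs σ) (Measure.pi fun _ : Fin m => P.prod P)
      (Measure.pi fun _ : Fin m => P.prod P) := by
  refine measurePreserving_pi (fun _ : Fin m => P.prod P) (fun _ : Fin m => P.prod P)
    (f := fun k p => if σ k then p else p.swap) fun k => ?_
  cases σ k
  · simpa using Measure.measurePreserving_swap (μ := P) (ν := P)
  · simp only [if_true]
    exact MeasurePreserving.id (P.prod P)

/-- The expected uniform deviation of the empirical averages of a countable family with values
in `[0, 1]` and bounded growth function. -/
theorem lintegral_iSup_average_sub_le (P : Measure Z) [IsProbabilityMeasure P] {f : A → Z → ℝ}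
    (hf : ∀ a, Measurable (f a)) (hf01 : ∀ a z, f a z ∈ Set.Icc (0 : ℝ) 1) {m : ℕ} (hm : 0 < m)
    {K : ℝ} (hK : 1 ≤ K)
    (hgrowth : ∀ w : Fin m → Z × Z, ∃ T : Finset (Fin m → ℝ), (T.card : ℝ) ≤ K ∧
      (∀ a, (fun k => f a (w k).1 - f a (w k).2) ∈ T) ∧ ∀ d ∈ T, ∀ k, |d k| ≤ 1)
    {l : ℝ} (hl : 0 < l) :
    ∫⁻ S, ⨆ a, ‖1 / (m : ℝ) * ∑ k, f a (S k) - ∫ z, f a z ∂P‖ₑ ∂Measure.pi (fun _ : Fin m => P) ≤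
      ENNReal.ofReal (rademacherBound m K l) := by
  have hm0 : (0 : ℝ) < m := Nat.cast_pos.2 hm
  set μ := Measure.pi (fun _ : Fin m => P) with hμ
  set Φ : (Fin m → Z) × (Fin m → Z) → ENNReal := fun p =>
    ⨆ a, ‖1 / (m : ℝ) * ∑ k, (f a (p.1 k) - f a (p.2 k))‖ₑ with hΦ
  have hmeas1 : ∀ a k, Measurable fun S : Fin m → Z => f a (S k) := fun a k =>
    (hf a).comp (measurable_pi_apply k)
  have hΦm : Measurable Φ := Measurable.iSup fun a => ((Finset.measurable_sum _ fun k _ =>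
    ((hmeas1 a k).comp measurable_fst).sub ((hmeas1 a k).comp measurable_snd)).const_mul _).enorm
  have hint : ∀ a k, Integrable (fun S : Fin m → Z => f a (S k)) μ := fun a k =>
    Integrable.of_bound (hmeas1 a k).aestronglyMeasurable 1 (Eventually.of_forall fun S => by
      rw [Real.norm_of_nonneg (hf01 a _).1]
      exact (hf01 a _).2)
  -- Write the mean as the expected average over an independent ghost sample; the supremum of an
  -- integral is at most the integral of the supremum.
  have hstep1 : ∀ S, ⨆ a, ‖1 / (m : ℝ) * ∑ k, f a (S k) - ∫ z, f a z ∂P‖ₑ ≤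
      ∫⁻ S', Φ (S, S') ∂μ := fun S => iSup_le fun a => by
    have heq : 1 / (m : ℝ) * ∑ k, f a (S k) - ∫ z, f a z ∂P =
        ∫ S', 1 / (m : ℝ) * ∑ k, (f a (S k) - f a (S' k)) ∂μ := by
      rw [integral_const_mul, integral_finsetSum (f := fun k (S' : Fin m → Z) => f a (S k) - f a (S' k)) _
        fun k _ => (integrable_const _).sub (hint a k)]
      have : ∀ k : Fin m, ∫ S' : Fin m → Z, f a (S k) - f a (S' k) ∂μ =
          f a (S k) - ∫ z, f a z ∂P := fun k => by
        rw [integral_sub (integrable_const _) (hint a k), hμ,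
          integral_comp_eval (hf a).aestronglyMeasurable]
        simp
      simp only [this, Finset.sum_sub_distrib, Finset.sum_const, Finset.card_univ,
        Fintype.card_fin, nsmul_eq_mul]
      field_simp
    rw [heq]
    exact (enorm_integral_le_lintegral_enorm _).trans
      (lintegral_mono fun S' => le_iSup (fun a =>
        ‖1 / (m : ℝ) * ∑ k, (f a (S k) - f a (S' k))‖ₑ) a)
  set ν := Measure.pi (fun _ : Fin m => P.prod P) with hν
  set Ψ : (Fin m → Z × Z) → ENNReal := fun w =>
    ⨆ a, ‖1 / (m : ℝ) * ∑ k, (f a (w k).1 - f a (w k).2)‖ₑ with hΨ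
  have hΨm : Measurable Ψ := Measurable.iSup fun a => ((Finset.measurable_sum _ fun k _ =>
    ((hf a).comp (measurable_fst.comp (measurable_pi_apply k))).sub
      ((hf a).comp (measurable_snd.comp (measurable_pi_apply k)))).const_mul _).enorm
  have hstep2 : ∫⁻ p, Φ p ∂μ.prod μ = ∫⁻ w, Ψ w ∂ν :=
    ((measurePreserving_arrowProdEquivProdArrow Z Z (Fin m) (fun _ => P)
      (fun _ => P)).lintegral_comp hΦm).symm
  have hstep3 : ∀ σ : Fin m → Bool, ∫⁻ w, Ψ (swapPairs σ w) ∂ν = ∫⁻ w, Ψ w ∂ν := fun σ =>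
    (measurePreserving_swapPairs P σ).lintegral_comp hΨm
  have hswap : ∀ σ w, Ψ (swapPairs σ w) =
      ⨆ a, ‖1 / (m : ℝ) * ∑ k, boolSign (σ k) * (f a (w k).1 - f a (w k).2)‖ₑ := fun σ w => by
    simp only [hΨ]
    congr 1
    funext a
    congr 2
    refine Finset.sum_congr rfl fun k _ => ?_
    unfold swapPairs boolSign
    cases σ k <;> simp
  -- Swapping within pairs preserves the law, so the integral may be averaged over all `2 ^ m` sign
  -- patterns. For fixed pairs only finitely many difference vectors occur, and the maximal
  -- inequality applies pointwise.
  have hstep4 : (2 : ENNReal) ^ m * ∫⁻ w, Ψ w ∂ν ≤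
      2 ^ m * ENNReal.ofReal (rademacherBound m K l) := by
    calc (2 : ENNReal) ^ m * ∫⁻ w, Ψ w ∂ν = ∑ σ : Fin m → Bool, ∫⁻ w, Ψ (swapPairs σ w) ∂ν := by
          simp [hstep3]
      _ = ∫⁻ w, ∑ σ : Fin m → Bool, Ψ (swapPairs σ w) ∂ν :=
          (lintegral_finsetSum _ fun σ _ =>
            hΨm.comp (measurePreserving_swapPairs P σ).measurable).symm
      _ ≤ ∫⁻ _w, 2 ^ m * ENNReal.ofReal (rademacherBound m K l) ∂ν := by
          refine lintegral_mono fun w => ?_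
          obtain ⟨T, hTK, hT, hT1⟩ := hgrowth w
          simp only [hswap]
          exact sum_iSup_boolSign_le hm hK hTK hT hT1 hl
      _ = _ := by simp
  calc _ ≤ ∫⁻ S, ∫⁻ S', Φ (S, S') ∂μ ∂μ := lintegral_mono hstep1
    _ = ∫⁻ p, Φ p ∂μ.prod μ := (lintegral_prod _ hΦm.aemeasurable).symm
    _ = ∫⁻ w, Ψ w ∂ν := hstep2
    _ ≤ _ := (ENNReal.mul_le_mul_iff_right (by positivity) (by finiteness)).1 hstep4

end Symmetrization

end BayesCG

end

/-! ### Uniform convergence on the split sample, fixed-metric consistency, and the diagonal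
argument. -/

noncomputable section

namespace BayesCG

variable {n : ℕ} {X : Type*} [MeasurableSpace X]

/-! ### Uniform convergence over the plug-in classifiers -/

theorem isProbabilityMeasure_empirical {Z : Type*} [MeasurableSpace Z] {k : ℕ} (hk : 0 < k)
    (S : Fin k → Z) : IsProbabilityMeasure (empirical S) := by
  refine ⟨?_⟩
  simp only [empirical, Measure.smul_apply, Measure.coe_finsetSum, Finset.sum_apply,
    measure_univ, Finset.sum_const, Finset.card_univ, Fintype.card_fin, nsmul_eq_mul, mul_one,
    smul_eq_mul]
  exact ENNReal.inv_mul_cancel (Nat.cast_ne_zero.2 hk.ne') (ENNReal.natCast_ne_top k)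

theorem conf_empirical {h : X → Fin n → ℝ} (hh : IsClassifier h) {k : ℕ}
    (S : Fin k → X × Fin n) (i j : Fin n) :
    conf (empirical S) h i j =
      1 / (k : ℝ) * ∑ b, h (S b).1 j * (if (S b).2 = i then 1 else 0) := by
  unfold conf empirical
  rw [integral_smul_measure, integral_finsetSum_measure fun b _ =>
    hh.integrable_confIntegrand _ i j]
  simp_rw [integral_dirac' _ _ (hh.measurable_confIntegrand i j).stronglyMeasurable]
  simp

/-- The expected uniform deviation of the empirical confusion matrices of the plug-in classifiers
of a fixed model. -/
theorem lintegral_iSup_conf_sub_le [NeZero n] (D : Measure (X × Fin n)) [IsProbabilityMeasure D]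
    {η : X → Fin n → ℝ} (hη : IsClassifier η) {k : ℕ} (hk : 0 < k) (i j : Fin n) {l : ℝ}
    (hl : 0 < l) :
    ∫⁻ S, ⨆ a, ‖conf (empirical S) (plugIn (denseGain n a) η) i j -
        conf D (plugIn (denseGain n a) η) i j‖ₑ ∂Measure.pi (fun _ : Fin k => D) ≤
      ENNReal.ofReal (rademacherBound k ((2 * k + 1) ^ (n * n)) l) := by
  have hcl := fun a => isClassifier_plugIn (denseGain n a) hη.1
  simp_rw [conf_empirical (hcl _)]
  refine lintegral_iSup_average_sub_le D
    (f := fun a z => plugIn (denseGain n a) η z.1 j * (if z.2 = i then 1 else 0))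
    (fun a => (hcl a).measurable_confIntegrand i j)
    (fun a z => ⟨(hcl a).confIntegrand_nonneg i j z, (hcl a).confIntegrand_le_one i j z⟩) hk
    (one_le_pow₀ (by linarith [Nat.cast_nonneg (α := ℝ) k])) (fun w => ?_) hl
  -- The growth bound is used on the sample and the ghost sample together, hence `2 * k` points. The
  -- labels are fixed, so passing to the signed differences creates no new patterns.
  obtain ⟨T, hTc, hT, hT01⟩ := exists_finset_plugIn η
    (Sum.elim (fun b => (w b).1.1) fun b => (w b).2.1) j
  classical
  let Δ : (Fin k ⊕ Fin k → ℝ) → Fin k → ℝ := fun f b =>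
    f (Sum.inl b) * (if (w b).1.2 = i then 1 else 0) -
      f (Sum.inr b) * (if (w b).2.2 = i then 1 else 0)
  refine ⟨T.image Δ, ?_, fun a => ?_, fun d hd b => ?_⟩
  · have h := (Finset.card_image_le (f := Δ)).trans hTc
    rw [Fintype.card_sum, Fintype.card_fin, ← two_mul] at h
    exact_mod_cast h
  · exact Finset.mem_image.2 ⟨_, hT (denseGain n a), rfl⟩
  · obtain ⟨f, hf, rfl⟩ := Finset.mem_image.1 hd
    have h1 := hT01 f hf (Sum.inl b)
    have h2 := hT01 f hf (Sum.inr b)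
    rw [abs_le]
    simp only [Δ]
    split_ifs <;> constructor <;> linarith [h1.1, h1.2, h2.1, h2.2]

/-- The uniform deviation of the empirical confusion matrices on the second sample, for the model
learnt from the first sample. -/
def splitDeviation (D : Measure (X × Fin n))
    (cpe : ∀ k : ℕ, (Fin k → X × Fin n) → X → Fin n → ℝ) (k₁ k₂ : ℕ) (i j : Fin n)
    (p : (Fin k₁ → X × Fin n) × (Fin k₂ → X × Fin n)) : ENNReal :=
  ⨆ a, ‖conf (empirical p.2) (plugIn (denseGain n a) (cpe k₁ p.1)) i j -
    conf D (plugIn (denseGain n a) (cpe k₁ p.1)) i j‖ₑ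

theorem IsLearner.isClassifier {cpe : ∀ k : ℕ, (Fin k → X × Fin n) → X → Fin n → ℝ}
    (hcpe : IsLearner cpe) (k : ℕ) (S : Fin k → X × Fin n) : IsClassifier (cpe k S) :=
  ⟨(hcpe k).1.comp measurable_prodMk_left, (hcpe k).2 S⟩

/-- The supremum is countable, and joint measurability of the learner in sample and instance handles
the parametrized integral. -/
theorem measurable_splitDeviation [NeZero n] (D : Measure (X × Fin n)) [IsProbabilityMeasure D]
    {cpe : ∀ k : ℕ, (Fin k → X × Fin n) → X → Fin n → ℝ} (hcpe : IsLearner cpe) (k₁ k₂ : ℕ)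
    (i j : Fin n) : Measurable (splitDeviation D cpe k₁ k₂ i j) := by
  refine Measurable.iSup fun a => ?_
  have hcl := fun S => isClassifier_plugIn (denseGain n a) (hcpe.isClassifier k₁ S).1
  have hu : Measurable fun p : (Fin k₁ → X × Fin n) × X =>
      plugIn (denseGain n a) (cpe k₁ p.1) p.2 j :=
    (measurable_pi_apply j).comp (measurable_plugIn (denseGain n a) (hcpe k₁).1)
  refine Measurable.enorm (Measurable.sub ?_ ?_)
  · simp_rw [conf_empirical (hcl _)]
    refine (Finset.measurable_sum _ fun b _ => Measurable.mul ?_ ?_).const_mul _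
    · exact hu.comp (measurable_fst.prodMk
        (measurable_fst.comp ((measurable_pi_apply b).comp measurable_snd)))
    · exact (measurable_labelIndicator i).comp ((measurable_pi_apply b).comp measurable_snd)
  · have hm : Measurable fun p : (Fin k₁ → X × Fin n) × (X × Fin n) =>
        plugIn (denseGain n a) (cpe k₁ p.1) p.2.1 j * (if p.2.2 = i then (1 : ℝ) else 0) :=
      (hu.comp (measurable_fst.prodMk (measurable_fst.comp measurable_snd))).mul
        ((measurable_labelIndicator i).comp measurable_snd)
    exact (hm.stronglyMeasurable.integral_prod_right' (ν := D)).measurable.comp measurable_fst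

/-- The two parts are independent i.i.d. samples, so the model can be held fixed while integrating
over the second part. -/
theorem measurePreserving_split {Z : Type*} [MeasurableSpace Z] (D : Measure Z)
    [IsProbabilityMeasure D] {α : ℝ} (hα : α ∈ Set.Ioo (0 : ℝ) 1) (m : ℕ) :
    MeasurePreserving (fun S : Fin m → Z => (part₁ hα S, part₂ hα S))
      (Measure.pi fun _ => D) ((Measure.pi fun _ => D).prod (Measure.pi fun _ => D)) := by
  let e : Fin (size₁ α m) ⊕ Fin (size₂ α m) ≃ Fin m :=
    finSumFinEquiv.trans (finCongr (size_add hα m))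
  exact (measurePreserving_sumPiEquivProdPi fun _ : Fin (size₁ α m) ⊕ Fin (size₂ α m) => D).comp
    ((measurePreserving_piCongrLeft (fun _ : Fin m => D) e).symm _)

/-- Markov's inequality, then Fubini: the bound for a fixed model does not depend on the model. -/
theorem measure_le_splitDeviation_le [NeZero n] (D : Measure (X × Fin n))
    [IsProbabilityMeasure D] {cpe : ∀ k : ℕ, (Fin k → X × Fin n) → X → Fin n → ℝ}
    (hcpe : IsLearner cpe) {α : ℝ} (hα : α ∈ Set.Ioo (0 : ℝ) 1) {m : ℕ} (hm : 0 < size₂ α m)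
    (i j : Fin n) {l δ : ℝ} (hl : 0 < l) (hδ : 0 < δ) :
    Measure.pi (fun _ : Fin m => D) {S | ENNReal.ofReal δ ≤
        splitDeviation D cpe (size₁ α m) (size₂ α m) i j (part₁ hα S, part₂ hα S)} ≤
      ENNReal.ofReal (rademacherBound (size₂ α m) ((2 * size₂ α m + 1) ^ (n * n)) l) /
        ENNReal.ofReal δ := by
  have hmeas := measurable_splitDeviation D hcpe (size₁ α m) (size₂ α m) i j
  have hmp := measurePreserving_split D hα m
  refine (meas_ge_le_lintegral_div (hmeas.comp hmp.measurable).aemeasurable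
    (by simpa using hδ) ENNReal.ofReal_ne_top).trans ?_
  refine ENNReal.div_le_div_right ?_ _
  rw [show ∫⁻ S, (splitDeviation D cpe (size₁ α m) (size₂ α m) i j ∘
    fun S => (part₁ hα S, part₂ hα S)) S ∂Measure.pi (fun _ : Fin m => D) = _ from
    hmp.lintegral_comp hmeas, lintegral_prod _ hmeas.aemeasurable]
  calc _ ≤ ∫⁻ _S, ENNReal.ofReal
        (rademacherBound (size₂ α m) ((2 * size₂ α m + 1) ^ (n * n)) l)
          ∂Measure.pi (fun _ : Fin (size₁ α m) => D) :=
        lintegral_mono fun S =>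
          lintegral_iSup_conf_sub_le D (hcpe.isClassifier _ S) hm i j hl
    _ = _ := by simp

theorem tendsto_log_div_sqrt :
    Tendsto (fun k : ℕ => Real.log (2 * k + 1) / √(k : ℝ)) atTop (𝓝 0) := by
  have h1 : Tendsto (fun x : ℝ => Real.log x / x ^ (1 / 2 : ℝ)) atTop (𝓝 0) :=
    (isLittleO_log_rpow_atTop (by norm_num)).tendsto_div_nhds_zero
  have h2 : Tendsto (fun k : ℕ => 2 * (k : ℝ) + 1) atTop atTop :=
    tendsto_atTop_add_const_right _ _ (tendsto_natCast_atTop_atTop.const_mul_atTop zero_lt_two)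
  have h3 := (h1.comp h2).const_mul 2
  rw [mul_zero] at h3
  refine squeeze_zero' (Eventually.of_forall fun k => ?_) ?_ h3
  · have := Real.log_nonneg (show 1 ≤ 2 * (k : ℝ) + 1 by linarith [Nat.cast_nonneg (α := ℝ) k])
    positivity
  · filter_upwards [eventually_ge_atTop 1] with k hk
    have hk1 : (1 : ℝ) ≤ k := by exact_mod_cast hk
    have hlog := Real.log_nonneg (show 1 ≤ 2 * (k : ℝ) + 1 by linarith)
    simp only [Function.comp, ← Real.sqrt_eq_rpow]
    have h4 : √(2 * (k : ℝ) + 1) ≤ 2 * √(k : ℝ) := by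
      rw [Real.sqrt_le_left (by positivity), mul_pow, Real.sq_sqrt (by linarith)]
      linarith
    have h5 : 0 < √(2 * (k : ℝ) + 1) := Real.sqrt_pos.2 (by linarith)
    have h6 : 0 < √(k : ℝ) := Real.sqrt_pos.2 (by linarith)
    rw [← mul_div_assoc, div_le_div_iff₀ h6 h5]
    nlinarith

/-- With `l = 1 / √k` the bound is `(log (2 * K) + 3 / 2) / √k`, and `log K` grows only
logarithmically in `k`. -/
theorem tendsto_rademacherBound (N : ℕ) :
    Tendsto (fun k : ℕ => rademacherBound k ((2 * k + 1) ^ N) (1 / √(k : ℝ))) atTop (𝓝 0) := by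
  have hs : Tendsto (fun k : ℕ => 1 / √(k : ℝ)) atTop (𝓝 0) := by
    simp only [one_div]
    exact (Real.tendsto_sqrt_atTop.comp tendsto_natCast_atTop_atTop).inv_tendsto_atTop
  have h := ((hs.const_mul (Real.log 2)).add (tendsto_log_div_sqrt.const_mul (N : ℝ))).add
    ((hs.const_mul (1 / 2)).add hs)
  simp only [mul_zero, add_zero] at h
  refine h.congr' ?_
  filter_upwards [eventually_ge_atTop 1] with k hk
  have hk1 : (1 : ℝ) ≤ k := by exact_mod_cast hk
  have h6 : 0 < √(k : ℝ) := Real.sqrt_pos.2 (by linarith)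
  have h7 : (k : ℝ) = √(k : ℝ) ^ 2 := (Real.sq_sqrt (by linarith)).symm
  unfold rademacherBound
  rw [Real.log_mul two_ne_zero (by positivity), Real.log_pow]
  set L := Real.log (2 * (k : ℝ) + 1)
  generalize √(k : ℝ) = s at *
  rw [h7]
  field_simp
  ring

theorem tendsto_size₂ {α : ℝ} (hα : α ∈ Set.Ioo (0 : ℝ) 1) :
    Tendsto (size₂ α) atTop atTop :=
  tendsto_nat_ceil_atTop.comp (tendsto_natCast_atTop_atTop.const_mul_atTop hα.1)

theorem tendsto_measure_splitDeviation [NeZero n] (D : Measure (X × Fin n))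
    [IsProbabilityMeasure D] {cpe : ∀ k : ℕ, (Fin k → X × Fin n) → X → Fin n → ℝ}
    (hcpe : IsLearner cpe) {α : ℝ} (hα : α ∈ Set.Ioo (0 : ℝ) 1) (i j : Fin n) {δ : ℝ}
    (hδ : 0 < δ) :
    Tendsto (fun m => Measure.pi (fun _ : Fin m => D) {S | ENNReal.ofReal δ ≤
      splitDeviation D cpe (size₁ α m) (size₂ α m) i j (part₁ hα S, part₂ hα S)}) atTop
      (𝓝 0) := by
  have h1 : Tendsto (fun m => ENNReal.ofReal (rademacherBound (size₂ α m)
      ((2 * size₂ α m + 1) ^ (n * n)) (1 / √(size₂ α m : ℝ))) / ENNReal.ofReal δ) atTop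
      (𝓝 0) := by
    have h2 := (ENNReal.continuous_ofReal.tendsto 0).comp
      ((tendsto_rademacherBound (n * n)).comp (tendsto_size₂ hα))
    rw [ENNReal.ofReal_zero] at h2
    have h3 := ENNReal.Tendsto.div_const h2
      (Or.inr (show ENNReal.ofReal δ ≠ 0 by simpa using hδ))
    rw [ENNReal.zero_div] at h3
    exact h3
  refine tendsto_of_tendsto_of_tendsto_of_le_of_le' tendsto_const_nhds h1
    (Eventually.of_forall fun m => zero_le) ?_
  filter_upwards [(tendsto_size₂ hα).eventually_ge_atTop 1] with m hm
  have hm0 : (0 : ℝ) < size₂ α m := Nat.cast_pos.2 hm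
  exact measure_le_splitDeviation_le D hcpe hα hm i j (by positivity) hδ

/-! ### Consistency for a fixed smooth metric -/

/-- The event that some feasible confusion matrix improves on the output by at least `ε`. -/
def gapEvent (D : Measure (X × Fin n)) {α : ℝ} (hα : α ∈ Set.Ioo (0 : ℝ) 1) (κ : ℕ)
    (cpe h₀ : ∀ k : ℕ, (Fin k → X × Fin n) → X → Fin n → ℝ)
    (ψ : Matrix (Fin n) (Fin n) ℝ → ℝ) (ε : ℝ) (m : ℕ) : Set (Fin m → X × Fin n) :=
  {S | ∃ C ∈ feasible D, ε ≤ ψ C - ψ (conf D (bayesCG hα κ cpe h₀ ψ m S))}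

/-- Outside the events of a large CPE error or a large deviation, `sub_iterate_le` excludes a gap of
`ε`. The gap event enters only through this inclusion, so its measurability is not needed. -/
theorem tendsto_measure_gapEvent [NeZero n] (D : Measure (X × Fin n)) [IsProbabilityMeasure D]
    {α : ℝ} (hα : α ∈ Set.Ioo (0 : ℝ) 1) {κ : ℕ} (hκ : 0 < κ)
    {cpe h₀ : ∀ k : ℕ, (Fin k → X × Fin n) → X → Fin n → ℝ}
    (hcpe : IsLearner cpe) (hh₀ : IsLearner h₀)
    (hcons : TendstoInProb D (fun m S => cpeError D (cpe (size₁ α m) (part₁ hα S))) 0)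
    {ψ : Matrix (Fin n) (Fin n) ℝ → ℝ}
    {g : Matrix (Fin n) (Fin n) ℝ → Matrix (Fin n) (Fin n) ℝ} (hg : HasGrad ψ g) {β B : ℝ}
    (hβ0 : 0 ≤ β) (hβ : ∀ i j, LipschitzL1On β (fun M => g M i j) (cube n)) (hB0 : 0 ≤ B)
    (hB : ∀ M ∈ cube n, ∀ i j, |g M i j| ≤ B) (hψ : ConcaveOn ℝ (feasible D) ψ) {ε : ℝ}
    (hε : 0 < ε) :
    Tendsto (fun m => Measure.pi (fun _ : Fin m => D) (gapEvent D hα κ cpe h₀ ψ ε m)) atTop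
      (𝓝 0) := by
  -- `δ` and `τ` make the gradient error and the linear maximization error at most `ε / 4` each; the
  -- optimization error is eventually below `ε / 4`. The added ones keep the denominators positive
  -- when `β` or `B` vanishes.
  set δ : ℝ := ε / (16 * (β * n ^ 2 + 1)) with hδ
  set τ : ℝ := ε / (8 * (B + 1)) with hτ
  have hδ0 : 0 < δ := by positivity
  have hτ0 : 0 < τ := by positivity
  have hδε : 4 * (β * (n ^ 2 * δ)) ≤ ε / 4 := by
    have hne : β * (n : ℝ) ^ 2 + 1 ≠ 0 := by positivity
    rw [hδ, show 4 * (β * ((n : ℝ) ^ 2 * (ε / (16 * (β * n ^ 2 + 1))))) =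
      ε / 4 * ((β * n ^ 2) / (β * n ^ 2 + 1)) by
        field_simp
        ring]
    refine mul_le_of_le_one_right (by positivity) ?_
    rw [div_le_one (by positivity)]
    linarith
  have hτε : 2 * B * τ ≤ ε / 4 := by
    have hne : B + 1 ≠ 0 := by positivity
    rw [hτ, show 2 * B * (ε / (8 * (B + 1))) = ε / 4 * (B / (B + 1)) by
      field_simp
      ring]
    refine mul_le_of_le_one_right (by positivity) ?_
    rw [div_le_one (by positivity)]
    linarith
  have hlim : Tendsto (fun m => Measure.pi (fun _ : Fin m => D)
      {S | τ ≤ |cpeError D (cpe (size₁ α m) (part₁ hα S)) - 0|} +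
      ∑ i, ∑ j, Measure.pi (fun _ : Fin m => D) {S | ENNReal.ofReal δ ≤
        splitDeviation D cpe (size₁ α m) (size₂ α m) i j (part₁ hα S, part₂ hα S)}) atTop
      (𝓝 0) := by
    have h := (hcons τ hτ0).add (tendsto_finsetSum Finset.univ fun i _ =>
      tendsto_finsetSum Finset.univ fun j _ => tendsto_measure_splitDeviation D hcpe hα i j hδ0)
    simpa using h
  have hiter : Tendsto (fun m : ℕ => (16 * β + 4 * B) / (((κ * m : ℕ) : ℝ) + 1)) atTop
      (𝓝 0) := by
    refine Tendsto.const_div_atTop (tendsto_atTop_add_const_right _ _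
      (tendsto_natCast_atTop_atTop.comp ?_)) _
    exact tendsto_atTop_mono (fun m => Nat.le_mul_of_pos_left m hκ) tendsto_id
  refine tendsto_of_tendsto_of_tendsto_of_le_of_le' tendsto_const_nhds hlim
    (Eventually.of_forall fun m => zero_le) ?_
  filter_upwards [hiter.eventually_lt_const (show 0 < ε / 4 by positivity),
    (tendsto_size₂ hα).eventually_ge_atTop 1, eventually_ge_atTop 1] with m hm hm2 hm1
  have hsub : gapEvent D hα κ cpe h₀ ψ ε m ⊆
      {S | τ ≤ |cpeError D (cpe (size₁ α m) (part₁ hα S)) - 0|} ∪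
      ⋃ i, ⋃ j, {S | ENNReal.ofReal δ ≤
        splitDeviation D cpe (size₁ α m) (size₂ α m) i j (part₁ hα S, part₂ hα S)} := by
    rintro S ⟨C, hC, hCε⟩
    by_contra hS
    simp only [Set.mem_union, Set.mem_iUnion, Set.mem_ofPred_eq, not_or, not_exists, not_le,
      sub_zero] at hS
    obtain ⟨hS1, hS2⟩ := hS
    have hη := hcpe.isClassifier (size₁ α m) (part₁ hα S)
    have hE := isProbabilityMeasure_empirical hm2 (part₂ hα S)
    have hunif : ∀ G i j, |conf (empirical (part₂ hα S))
        (plugIn G (cpe (size₁ α m) (part₁ hα S))) i j -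
          conf D (plugIn G (cpe (size₁ α m) (part₁ hα S))) i j| ≤ δ := fun G i j =>
      abs_conf_sub_le_of_denseGain hη _ D (fun a => by
        have h := (le_iSup (fun a => ‖conf (empirical (part₂ hα S))
          (plugIn (denseGain n a) (cpe (size₁ α m) (part₁ hα S))) i j -
            conf D (plugIn (denseGain n a) (cpe (size₁ α m) (part₁ hα S))) i j‖ₑ) a).trans
          (hS2 i j).le
        rw [Real.enorm_eq_ofReal_abs] at h
        exact (ENNReal.ofReal_le_ofReal_iff hδ0.le).1 h) G
    have h := sub_iterate_le hg hβ0 hβ hB hψ hη (hh₀.isClassifier m S) hunif hC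
      (Nat.mul_pos hκ hm1)
    have h2 : 2 * B * cpeError D (cpe (size₁ α m) (part₁ hα S)) ≤ 2 * B * τ :=
      mul_le_mul_of_nonneg_left ((le_abs_self _).trans hS1.le) (by positivity)
    have h3 : ψ C - ψ (conf D (bayesCG hα κ cpe h₀ ψ m S)) < ε := by
      refine h.trans_lt ?_
      linarith
    linarith
  calc _ ≤ _ := measure_mono hsub
    _ ≤ _ := measure_union_le _ _
    _ ≤ _ := by
        gcongr
        refine (measure_iUnion_fintype_le _ _).trans (Finset.sum_le_sum fun i _ => ?_)
        exact measure_iUnion_fintype_le _ _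

/-! ### Letting the smoothing parameter tend to zero -/

/-- Index `k` may be used once `m` has passed a threshold `N k`, after which `a k m` is at most `1 /
(k + 1)`; take the largest admissible index up to `m`. -/
theorem exists_diagonal {a : ℕ → ℕ → ENNReal} (ha : ∀ k, Tendsto (a k) atTop (𝓝 0)) :
    ∃ φ : ℕ → ℕ, Tendsto φ atTop atTop ∧ Tendsto (fun m => a (φ m) m) atTop (𝓝 0) := by
  have hex : ∀ k : ℕ, ∃ N, ∀ m ≥ N, a k m ≤ ((k : ENNReal) + 1)⁻¹ := fun k =>
    eventually_atTop.1 ((ha k).eventually_le_const (by simp))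
  choose N hN using hex
  set φ : ℕ → ℕ := fun m => Nat.findGreatest (fun k => N k ≤ m) m with hφ
  have hφt : Tendsto φ atTop atTop := tendsto_atTop.2 fun K => by
    filter_upwards [eventually_ge_atTop K, eventually_ge_atTop (N K)] with m h1 h2
    exact Nat.le_findGreatest h1 h2
  refine ⟨φ, hφt, ?_⟩
  have hinv : Tendsto (fun m => ((φ m : ENNReal) + 1)⁻¹) atTop (𝓝 0) := by
    have h := (ENNReal.tendsto_inv_nat_nhds_zero.comp (tendsto_add_atTop_nat 1)).comp hφt
    refine h.congr fun m => ?_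
    simp
  refine tendsto_of_tendsto_of_tendsto_of_le_of_le' tendsto_const_nhds hinv
    (Eventually.of_forall fun m => zero_le) ?_
  -- Before `N 0` there may be no admissible index, and `Nat.findGreatest` would return a
  -- meaningless zero.
  filter_upwards [eventually_ge_atTop (N 0)] with m hm
  exact hN _ _ (Nat.findGreatest_spec (P := fun k => N k ≤ m) (Nat.zero_le m) hm)

/-- The approximation error is paid twice, at the competitor and at the output. The same estimate
shows that the supremum is over a bounded family, so it is not a default value. -/
theorem abs_regret_le (D : Measure (X × Fin n)) {ψ ψ' : Matrix (Fin n) (Fin n) ℝ → ℝ}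
    {θ ε : ℝ} (hθ : ∀ C ∈ feasible D, |ψ C - ψ' C| ≤ θ) {h : X → Fin n → ℝ}
    (hh : IsClassifier h) (hgap : ∀ C ∈ feasible D, ψ' C - ψ' (conf D h) ≤ ε) :
    |regret D ψ h| ≤ 2 * θ + ε := by
  have hb : ∀ g : {g : X → Fin n → ℝ // IsClassifier g},
      ψ (conf D g) ≤ ψ (conf D h) + (2 * θ + ε) := fun g => by
    have h1 := (abs_le.1 (hθ (conf D g) ⟨g, g.2, rfl⟩)).2
    have h2 := (abs_le.1 (hθ (conf D h) ⟨h, hh, rfl⟩)).1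
    have h3 := hgap (conf D g) ⟨g, g.2, rfl⟩
    linarith
  have hne : Nonempty {g : X → Fin n → ℝ // IsClassifier g} := ⟨⟨h, hh⟩⟩
  have h1 := ciSup_le hb
  have h2 : ψ (conf D h) ≤ ⨆ g : {g : X → Fin n → ℝ // IsClassifier g}, ψ (conf D g) :=
    le_ciSup (f := fun g : {g : X → Fin n → ℝ // IsClassifier g} => ψ (conf D g))
      ⟨_, Set.forall_mem_range.2 hb⟩ ⟨h, hh⟩
  rw [regret, abs_of_nonneg (sub_nonneg.2 h2)]
  linarith

/-- Consistency of BayesCG for a metric that has smooth concave approximations. -/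
theorem exists_tendstoInProb_regret [NeZero n] (D : Measure (X × Fin n))
    [IsProbabilityMeasure D] {α : ℝ} (hα : α ∈ Set.Ioo (0 : ℝ) 1) {κ : ℕ} (hκ : 0 < κ)
    {cpe h₀ : ∀ k : ℕ, (Fin k → X × Fin n) → X → Fin n → ℝ}
    (hcpe : IsLearner cpe) (hh₀ : IsLearner h₀)
    (hcons : TendstoInProb D (fun m S => cpeError D (cpe (size₁ α m) (part₁ hα S))) 0)
    {ψ : Matrix (Fin n) (Fin n) ℝ → ℝ} {ψρ : ℝ → Matrix (Fin n) (Fin n) ℝ → ℝ} {θ L β : ℝ → ℝ}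
    (hs : IsSmoothing D ψ ψρ θ L β) (hθ : Tendsto θ (𝓝 0) (𝓝 0))
    {g : ℝ → Matrix (Fin n) (Fin n) ℝ → Matrix (Fin n) (Fin n) ℝ} {B : ℝ → ℝ}
    (hg : ∀ ρ ∈ Set.Ioo (0 : ℝ) 1, HasGrad (ψρ ρ) (g ρ))
    (hβ : ∀ ρ ∈ Set.Ioo (0 : ℝ) 1, ∀ i j, LipschitzL1On (β ρ) (fun M => g ρ M i j) (cube n))
    (hβ0 : ∀ ρ ∈ Set.Ioo (0 : ℝ) 1, 0 ≤ β ρ) (hB0 : ∀ ρ ∈ Set.Ioo (0 : ℝ) 1, 0 ≤ B ρ)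
    (hB : ∀ ρ ∈ Set.Ioo (0 : ℝ) 1, ∀ M ∈ cube n, ∀ i j, |g ρ M i j| ≤ B ρ) :
    ∃ ρ : ℕ → ℝ, (∀ m, ρ m ∈ Set.Ioo (0 : ℝ) 1) ∧ Tendsto ρ atTop (𝓝 0) ∧
      TendstoInProb D
        (fun m S => regret D ψ (bayesCG hα κ cpe h₀ (ψρ (ρ m)) m S)) 0 := by
  -- One sequence serves as smoothing parameter and as tolerance for the gap; the shift by two keeps
  -- it below one at `k = 0`.
  set q : ℕ → ℝ := fun k => 1 / ((k : ℝ) + 2) with hq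
  have hq01 : ∀ k, q k ∈ Set.Ioo (0 : ℝ) 1 := fun k => by
    have hk : (0 : ℝ) ≤ k := Nat.cast_nonneg k
    refine ⟨by simp only [hq]; positivity, ?_⟩
    simp only [hq]
    rw [div_lt_one (by positivity)]
    linarith
  have hq0 : Tendsto q atTop (𝓝 0) :=
    Tendsto.const_div_atTop (tendsto_atTop_add_const_right _ _ tendsto_natCast_atTop_atTop) _
  obtain ⟨φ, hφ, hφ0⟩ := exists_diagonal fun k =>
    tendsto_measure_gapEvent D hα hκ hcpe hh₀ hcons (hg _ (hq01 k)) (hβ0 _ (hq01 k))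
      (hβ _ (hq01 k)) (hB0 _ (hq01 k)) (hB _ (hq01 k)) (hs _ (hq01 k)).1 (hq01 k).1
  have hρ0 : Tendsto (fun m => q (φ m)) atTop (𝓝 0) := hq0.comp hφ
  refine ⟨fun m => q (φ m), fun m => hq01 _, hρ0, fun ε hε => ?_⟩
  have hlim : Tendsto (fun m => 2 * θ (q (φ m)) + q (φ m)) atTop (𝓝 0) := by
    simpa using ((hθ.comp hρ0).const_mul 2).add hρ0
  refine tendsto_of_tendsto_of_tendsto_of_le_of_le' tendsto_const_nhds hφ0
    (Eventually.of_forall fun m => zero_le) ?_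
  filter_upwards [hlim.eventually_lt_const hε] with m hm
  refine measure_mono fun S hS => ?_
  by_contra hgap
  have hgap' : ∀ C ∈ feasible D, ψρ (q (φ m)) C -
      ψρ (q (φ m)) (conf D (bayesCG hα κ cpe h₀ (ψρ (q (φ m))) m S)) ≤ q (φ m) := fun C hC =>
    (not_le.1 fun h => hgap ⟨C, hC, h⟩).le
  have h := abs_regret_le D (hs _ (hq01 (φ m))).2.2.2
    (isClassifier_iterate _ (hcpe.isClassifier _ _) (hh₀.isClassifier m S) _ _) hgap'
  have hS' : ε ≤ |regret D ψ (bayesCG hα κ cpe h₀ (ψρ (q (φ m))) m S) - 0| := hS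
  rw [sub_zero] at hS'
  exact absurd (hS'.trans h) (not_le.2 hm)

end BayesCG

end

/-! ### The three metrics. -/

theorem mainTheorem7 {X : Type*} [MeasurableSpace X] {n : ℕ} [NeZero n]
    (D : MeasureTheory.Measure (X × Fin n)) [MeasureTheory.IsProbabilityMeasure D]
    (hprior : ∀ y, 0 < BayesCG.prior D y)
    {α : ℝ} (hα : α ∈ Set.Ioo (0 : ℝ) 1) {κ : ℕ} (hκ : 0 < κ)
    (cpe h₀ : ∀ k : ℕ, (Fin k → X × Fin n) → X → Fin n → ℝ)
    (hcpe : BayesCG.IsLearner cpe) (hh₀ : BayesCG.IsLearner h₀)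
    (hcons : BayesCG.TendstoInProb D
      (fun m S => BayesCG.cpeError D
        (cpe (BayesCG.size₁ α m) (BayesCG.part₁ hα S))) 0) :
    (BayesCG.IsSmoothing D BayesCG.hMean BayesCG.hMeanSmooth
        (fun ρ => n / BayesCG.priorMin D * ρ) (fun ρ => n / ρ) (fun ρ => 2 * n / ρ ^ 2) ∧
      ∃ ρ : ℕ → ℝ, (∀ m, ρ m ∈ Set.Ioo (0 : ℝ) 1) ∧ Tendsto ρ atTop (𝓝 0) ∧
        BayesCG.TendstoInProb D (fun m S => BayesCG.regret D BayesCG.hMean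
          (BayesCG.bayesCG hα κ cpe h₀ (BayesCG.hMeanSmooth (ρ m)) m S)) 0) ∧
    (BayesCG.IsSmoothing D BayesCG.qMean BayesCG.qMeanSmooth
        (fun ρ => 1 / BayesCG.priorMin D * ρ) (fun ρ => 1 / √(n : ℝ) * (1 / ρ))
        (fun ρ => 2 / √(n : ℝ) * (1 / ρ ^ 2) * (1 + 1 / ρ)) ∧
      ∃ ρ : ℕ → ℝ, (∀ m, ρ m ∈ Set.Ioo (0 : ℝ) 1) ∧ Tendsto ρ atTop (𝓝 0) ∧
        BayesCG.TendstoInProb D (fun m S => BayesCG.regret D BayesCG.qMean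
          (BayesCG.bayesCG hα κ cpe h₀ (BayesCG.qMeanSmooth (ρ m)) m S)) 0) ∧
    (BayesCG.IsSmoothing D BayesCG.gMean BayesCG.gMeanSmooth
        (fun ρ => 2 * (ρ / BayesCG.priorMin D) ^ (1 / (n : ℝ)))
        (fun ρ => 1 / (n : ℝ) * (1 / ρ) * (1 + 1 / ρ) ^ (1 - 1 / (n : ℝ)))
        (fun ρ => 2 / (n * ρ ^ 2)) ∧
      ∃ ρ : ℕ → ℝ, (∀ m, ρ m ∈ Set.Ioo (0 : ℝ) 1) ∧ Tendsto ρ atTop (𝓝 0) ∧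
        BayesCG.TendstoInProb D (fun m S => BayesCG.regret D BayesCG.gMean
          (BayesCG.bayesCG hα κ cpe h₀ (BayesCG.gMeanSmooth (ρ m)) m S)) 0) := by
  have hn : (0 : ℝ) < n := Nat.cast_pos.2 (NeZero.pos n)
  have hH := BayesCG.isSmoothing_hMean D hprior
  have hQ := BayesCG.isSmoothing_qMean D hprior
  have hG := BayesCG.isSmoothing_gMean D hprior
  refine ⟨⟨hH, ?_⟩, ⟨hQ, ?_⟩, ⟨hG, ?_⟩⟩
  · refine BayesCG.exists_tendstoInProb_regret D hα hκ hcpe hh₀ hcons hH ?_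
      (fun ρ hρ => BayesCG.hasGrad_hMeanSmooth hρ.1)
      (fun ρ hρ => BayesCG.lipschitzL1On_hGrad hρ.1)
      (fun ρ hρ => by have := hρ.1; positivity) (B := fun ρ => n / ρ)
      (fun ρ hρ => by have := hρ.1; positivity)
      (fun ρ hρ M hM => BayesCG.abs_hGrad_le hρ.1 hM)
    exact Continuous.tendsto' (by fun_prop) _ _ (by simp)
  · refine BayesCG.exists_tendstoInProb_regret D hα hκ hcpe hh₀ hcons hQ ?_
      (fun ρ hρ => BayesCG.hasGrad_qMeanSmooth hρ.1)
      (fun ρ hρ => BayesCG.lipschitzL1On_qGrad hρ)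
      (fun ρ hρ => by have := hρ.1; positivity) (B := fun ρ => 1 / √(n : ℝ) * (1 / ρ))
      (fun ρ hρ => by have := hρ.1; positivity)
      (fun ρ hρ M hM => BayesCG.abs_qGrad_le hρ.1 hM)
    exact Continuous.tendsto' (by fun_prop) _ _ (by simp)
  -- The gradient bound `B` used here is the sharper `1 / n * (1 / ρ)`; any finite bound for each
  -- `ρ` suffices for consistency.
  · refine BayesCG.exists_tendstoInProb_regret D hα hκ hcpe hh₀ hcons hG ?_
      (fun ρ hρ => BayesCG.hasGrad_gMeanSmooth hρ.1)
      (fun ρ hρ => BayesCG.lipschitzL1On_gGrad hρ.1)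
      (fun ρ hρ => by have := hρ.1; positivity) (B := fun ρ => 1 / (n : ℝ) * (1 / ρ))
      (fun ρ hρ => by have := hρ.1; positivity)
      (fun ρ hρ M hM => BayesCG.abs_gGrad_le hρ.1 hM)
    have hn0 : 0 < 1 / (n : ℝ) := by positivity
    refine Continuous.tendsto' ?_ _ _ ?_
    · exact continuous_const.mul ((continuous_id.div_const _).rpow_const fun _ => Or.inr hn0.le)
    · rw [zero_div, Real.zero_rpow hn0.ne', mul_zero]
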